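/- **Setting.** Parameters are sequences $P=(p_i,n_i,k_i,\sigma_i)_{i\ge 1}$ with $p_i,n_i,k_i\in\mathbb N$ and real $\sigma_i>0$; $\mathrm{SNR}_i=k_i/\sigma_i^2$. All asymptotics are as $i\to\infty$, and the index is dropped. $\mathcal C_1$ is the set of sequences with $p\to\infty$, $k=o(\sqrt p)$, $n=\omega(\max\{k,\log p\})$ and $n=o\big((k+\sigma^2)^2/\log p\big)$; $\mathcal C_2$ is the set of sequences with the same first three conditions and $n\gtrsim k\log p/\log(1+k/\sigma^2)$ (i.e. $k\log p/\log(1+k/\sigma^2)=O(n)$). Signals are vectors in $\{-1,0,1\}^p$ with exactly $k$ non-zero entries. A *signal prior* is a joint law of two such signals $(\beta_1,\beta_2)$ both of whose marginals are uniform. *Recovery.* One observes $X\in\mathbb R^{n\times p}$ with i.i.d. $N(0,1)$ entries and $y=X\beta_1\odot z+X\beta_2\odot(1-z)+w$, where $z_q\sim\mathrm{Bernoulli}(1/2)$ and $w_q\sim N(0,\sigma^2)$ are i.i.d. and $(\beta_1,\beta_2),X,z,w$ are independent. An algorithm, given $(p,n,k,\sigma,X,y)$, solves exact recovery under a sequence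 of priors if the probability that its output differs from $(\beta_1,\beta_2)$ up to swapping the two signals tends to $0$. For integers $a=a_i$, put $J=\{j\in\mathrm{supp}(\beta_1)\cap\mathrm{supp}(\beta_2):\beta_{1,j}=-\beta_{2,j}\}$. An algorithm *solves PSBMSLR with $|J|=a$* along $P$ if it solves exact recovery under every sequence of signal priors for which, for all large $i$, $|J|=a_i$ almost surely. *Detection (SBMSLRD).* Given $(p,n,k,\sigma,X,y)$, decide between the null, where $y=\sqrt{k/\sigma^2+1}\,w$ is independent of $X$, and the planted law, where $y=\frac1\sigma X\beta\odot z-\frac1\sigma X\beta\odot(1-z)+w$ with $\beta$ a uniform signal, $z_q\sim\mathrm{Bernoulli}(1/2)$ i.i.d.; in both cases $X$ and $w$ have i.i.d. $N(0,1)$ entries and all variables are independent. Strong detection means that the sum of type I and type II errors tends to $0$. *Algorithms* are programs of a randomized real RAM (unit-cost exact field operations and comparisons of reals, addition and truncated subtraction of natural numbers, indirect addressing, clearing of an array, rational constants, draws of independent $N(0,1)$ variables, no rounding of reals). *Polynomial time* means at most $C(p+n+1)^\eta$ steps, for some constants $C,\eta$, on every input with $k\le p$ and every outcome of the random draws. **Theorem.**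 Let $P=(p,n,k,\sigma)\in\mathcal C_1\cap\mathcal C_2$ with $\mathrm{SNR}\to\infty$, let $a=a_i\in\mathbb N$ with $ck\le a\le k$ for all large $i$ and a constant $c>0$ (so $a=\Theta(k)$), and let $A$ be a randomized polynomial-time algorithm. Suppose that, along $P$, 1. $A$ solves PSBMSLR with $|J|=a$; or only that 2. $A$ solves exact recovery under the single prior that is uniform over the pairs of signals with overlap $\xi=|\mathrm{supp}(\beta_1)\cap\mathrm{supp}(\beta_2)|/k=1$ and signed overlap $\tau=\langle\beta_1,\beta_2\rangle/|\mathrm{supp}(\beta_1)\cap\mathrm{supp}(\beta_2)|=1-2a/k$. Then, in either case, there are a sequence $Q=(p^*,n^*,k^*,\sigma^*)\in\mathcal C_1\cap\mathcal C_2$ with $\sigma^*=\sigma$, $p^*=\Theta(p)$, $n^*=\Theta(n)$, $k^*=\Theta(k)$ and $\mathrm{SNR}^*=k^*/(\sigma^*)^2\to\infty$, and a randomized polynomial-time algorithm that solves strong detection in SBMSLRD along $Q$. Moreover $Q$ lies in the regime $k^*=o(\sqrt{p^*})$, $n^*=\omega(\max\{k^*,\log p^*\})$, $n^*=o\big(\frac{(k^*)^2(\mathrm{SNR}^*+1)^2}{(\mathrm{SNR}^*)^2\log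 p^*}\big)$, in which the low-degree method predicts that strong detection requires running time $\exp\big(\tilde\Omega(\min\{\frac{(k^*)^2(\mathrm{SNR}^*+1)^2}{n^*(\mathrm{SNR}^*)^2},n^*\})\big)$ and has no randomized polynomial-time algorithm, and along $Q$ this minimum is $\omega(\log p^*)$. Hence such an $A$ would contradict the predicted hardness of SBMSLRD. -/

import Mathlib

open Filter Topology MeasureTheory ProbabilityTheory Asymptotics
open scoped NNReal ENNReal

noncomputable section

/-! ### Randomized algorithms on real inputs

A uniform machine model: finite programs of a randomized real RAM. The memory consists of
arrays of natural numbers and of two-dimensional arrays of reals, named by numerals that occur in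
the program and addressed indirectly. Natural numbers can be added and subtracted (truncated),
reals can be added, subtracted, multiplied, divided (`x / 0 = 0`) and compared, constants are
natural and rational, and independent standard Gaussian reals can be drawn. There is no rounding
from reals to naturals. Every executed statement or test costs one unit of time; as a program
contains finitely many expressions, this differs by a constant factor from counting the operations
inside expressions. -/

/-- Expressions with values in the natural numbers; `get u e` is the entry `e` of the array `u`. -/
inductive NExpr : Type
  | const (c : ℕ) : NExpr
  | get (u : ℕ) (e : NExpr) : NExpr
  | plus (e f : NExpr) : NExpr
  | minus (e f : NExpr) : NExpr

/-- Expressions with values in the reals; `get u e f` is the entry `(e, f)` of the array `u`. -/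
inductive RExpr : Type
  | const (q : ℚ) : RExpr
  | ofNat (e : NExpr) : RExpr
  | get (u : ℕ) (e f : NExpr) : RExpr
  | plus (r s : RExpr) : RExpr
  | minus (r s : RExpr) : RExpr
  | times (r s : RExpr) : RExpr
  | divide (r s : RExpr) : RExpr

/-- Tests. -/
inductive Test : Type
  | natLt (e f : NExpr) : Test
  | realLt (r s : RExpr) : Test

/-- Programs. `clearNat u` and `clearReal u` replace an array by a fresh one filled with zeros;
`gauss u e f` stores a fresh standard Gaussian real in entry `(e, f)` of the real array `u`. -/
inductive Prog : Type
  | skip : Prog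
  | setNat (u : ℕ) (e : NExpr) (v : NExpr) : Prog
  | setReal (u : ℕ) (e f : NExpr) (r : RExpr) : Prog
  | clearNat (u : ℕ) : Prog
  | clearReal (u : ℕ) : Prog
  | gauss (u : ℕ) (e f : NExpr) : Prog
  | seq (S T : Prog) : Prog
  | ite (b : Test) (S T : Prog) : Prog
  | while (b : Test) (S : Prog) : Prog

/-- Memory contents, together with the number of random reals drawn so far. -/
structure RamState where
  nat : ℕ → ℕ → ℕ
  real : ℕ → ℕ → ℕ → ℝ
  drawn : ℕ

def NExpr.eval (m : RamState) : NExpr → ℕ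
  | .const c => c
  | .get u e => m.nat u (e.eval m)
  | .plus e f => e.eval m + f.eval m
  | .minus e f => e.eval m - f.eval m

def RExpr.eval (m : RamState) : RExpr → ℝ
  | .const q => (q : ℝ)
  | .ofNat e => (e.eval m : ℝ)
  | .get u e f => m.real u (e.eval m) (f.eval m)
  | .plus r s => r.eval m + s.eval m
  | .minus r s => r.eval m - s.eval m
  | .times r s => r.eval m * s.eval m
  | .divide r s => r.eval m / s.eval m

def Test.Holds (m : RamState) : Test → Prop
  | .natLt e f => e.eval m < f.eval m
  | .realLt r s => r.eval m < s.eval m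

/-- Write `v` into entry `x` of the natural-number array `u`. -/
def RamState.writeNat (m : RamState) (u x v : ℕ) : RamState :=
  { m with nat := Function.update m.nat u (Function.update (m.nat u) x v) }

/-- Write `r` into entry `(x, y)` of the real array `u`. -/
def RamState.writeReal (m : RamState) (u x y : ℕ) (r : ℝ) : RamState :=
  { m with
    real := Function.update m.real u
      (Function.update (m.real u) x (Function.update (m.real u x) y r)) }

/-- `Run ω S m t m'`: with the random reals `ω 0, ω 1, …`, the program `S` started in `m` halts in
`m'` after exactly `t` units of time. -/
inductive Run (ω : ℕ → ℝ) : Prog → RamState → ℕ → RamState → Prop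
  | skip (m : RamState) : Run ω .skip m 1 m
  | setNat (m : RamState) (u : ℕ) (e v : NExpr) :
      Run ω (.setNat u e v) m 1 (m.writeNat u (e.eval m) (v.eval m))
  | setReal (m : RamState) (u : ℕ) (e f : NExpr) (r : RExpr) :
      Run ω (.setReal u e f r) m 1 (m.writeReal u (e.eval m) (f.eval m) (r.eval m))
  | clearNat (m : RamState) (u : ℕ) :
      Run ω (.clearNat u) m 1 { m with nat := Function.update m.nat u (fun _ => 0) }
  | clearReal (m : RamState) (u : ℕ) :
      Run ω (.clearReal u) m 1 { m with real := Function.update m.real u (fun _ _ => 0) }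
  | gauss (m : RamState) (u : ℕ) (e f : NExpr) :
      Run ω (.gauss u e f) m 1
        { m.writeReal u (e.eval m) (f.eval m) (ω m.drawn) with drawn := m.drawn + 1 }
  | seq {m m' m'' : RamState} {S T : Prog} {s t : ℕ} (hS : Run ω S m s m')
      (hT : Run ω T m' t m'') : Run ω (.seq S T) m (s + t) m''
  | ite_pos {m m' : RamState} {b : Test} {S T : Prog} {t : ℕ} (hb : b.Holds m)
      (h : Run ω S m t m') : Run ω (.ite b S T) m (t + 1) m'
  | ite_neg {m m' : RamState} {b : Test} {S T : Prog} {t : ℕ} (hb : ¬ b.Holds m)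
      (h : Run ω T m t m') : Run ω (.ite b S T) m (t + 1) m'
  | while_done {m : RamState} {b : Test} {S : Prog} (hb : ¬ b.Holds m) :
      Run ω (.while b S) m 1 m
  | while_step {m m' m'' : RamState} {b : Test} {S : Prog} {s t : ℕ} (hb : b.Holds m)
      (hS : Run ω S m s m') (hW : Run ω (.while b S) m' t m'') :
      Run ω (.while b S) m (s + t + 1) m''

/-- The law of the random reals of a machine: i.i.d. standard Gaussians. -/
def tapeLaw : Measure (ℕ → ℝ) := Measure.infinitePi fun _ => gaussianReal 0 1

/-! ### Parameters and scaling regimes -/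

/-- Dimension `p`, sample size `n`, sparsity `k`, noise level `σ`. -/
structure Params where
  p : ℕ
  n : ℕ
  k : ℕ
  σ : ℝ
  σ_pos : 0 < σ

/-- Signal-to-noise ratio `‖β‖² / σ²`, where `‖β‖² = k` for signals with `k` entries `±1`. -/
def Params.snr (P : Params) : ℝ := P.k / P.σ ^ 2

/-- The growth conditions common to all regimes:
`p = ω(1)`, `k = o(√p)`, `n = ω(max{k, log p})`. -/
def BaseRegime (P : ℕ → Params) : Prop :=
  Tendsto (fun i => (P i).p) atTop atTop ∧
  (fun i => ((P i).k : ℝ)) =o[atTop] (fun i => Real.sqrt (P i).p) ∧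
  (fun i => max ((P i).k : ℝ) (Real.log (P i).p)) =o[atTop] (fun i => ((P i).n : ℝ))

/-- The regime `C₁`: in addition `n = o((k + σ²)² / log p)`. -/
def RegimeC1 (P : ℕ → Params) : Prop :=
  BaseRegime P ∧
  (fun i => ((P i).n : ℝ)) =o[atTop]
    (fun i => ((P i).k + (P i).σ ^ 2) ^ 2 * (1 / Real.log (P i).p))

/-- The regime `C₂`: in addition `n ≳ k log p / log (1 + k / σ²)`. -/
def RegimeC2 (P : ℕ → Params) : Prop :=
  BaseRegime P ∧
  (fun i => (P i).k * Real.log (P i).p / Real.log (1 + (P i).k / (P i).σ ^ 2)) =O[atTop]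
    (fun i => ((P i).n : ℝ))

/-- `min {k² (snr + 1)² / (n snr²), n}`: up to polylogarithmic factors, the logarithm of the running
time that the low-degree method predicts for detection. -/
def Params.hardnessExponent (P : Params) : ℝ :=
  min ((P.k : ℝ) ^ 2 * (P.snr + 1) ^ 2 / (P.n * P.snr ^ 2)) P.n

/-- The regime in which detection is predicted to be hard:
`k = o(√p)`, `n = ω(max{k, log p})`, `n = o(k² (snr + 1)² / (snr² log p))`. -/
def HardRegime (P : ℕ → Params) : Prop :=
  BaseRegime P ∧
  (fun i => ((P i).n : ℝ)) =o[atTop]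
    (fun i => ((P i).k : ℝ) ^ 2 * ((P i).snr + 1) ^ 2 / (P i).snr ^ 2 * (1 / Real.log (P i).p))

/-! ### Signals, priors and observation models -/

abbrev Signal (p : ℕ) : Type := Fin p → ℝ

/-- Designs `X`, one row for each sample. -/
abbrev Design (n p : ℕ) : Type := Fin n → Fin p → ℝ

/-- `k`-sparse signals whose non-zero entries are `±1`. -/
def sparseSigns (p k : ℕ) : Set (Signal p) :=
  {β | (∀ j, β j = -1 ∨ β j = 0 ∨ β j = 1) ∧ (Function.support β).ncard = k}

/-- Joint signal priors with non-zero entries in `{-1, 1}`: both marginals are uniform over the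
`k`-sparse signals. -/
def IsSignalPrior (p k : ℕ) (π : Measure (Signal p × Signal p)) : Prop :=
  IsProbabilityMeasure π ∧
  π.map Prod.fst = uniformOn (sparseSigns p k) ∧
  π.map Prod.snd = uniformOn (sparseSigns p k)

/-- The coordinates in the intersection of the supports at which the signals are opposite. -/
def oppositeSet {p : ℕ} (β₁ β₂ : Signal p) : Set (Fin p) :=
  {j | j ∈ Function.support β₁ ∩ Function.support β₂ ∧ β₁ j = -β₂ j}

/-- Signal priors under which the two signals are opposite at exactly `a` common support points. -/
def IsPartiallySymmetricPrior (p k a : ℕ) (π : Measure (Signal p × Signal p)) : Prop :=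
  IsSignalPrior p k π ∧ ∀ᵐ b ∂π, (oppositeSet b.1 b.2).ncard = a

/-- The uniform prior on pairs of `k`-sparse sign vectors with overlap `ξ = |S₁ ∩ S₂| / k` and
signed overlap `τ = ⟨β₁, β₂⟩ / |S₁ ∩ S₂|`. -/
def overlapPrior (p k : ℕ) (ξ τ : ℝ) : Measure (Signal p × Signal p) :=
  uniformOn {b | b.1 ∈ sparseSigns p k ∧ b.2 ∈ sparseSigns p k ∧
    ((Function.support b.1 ∩ Function.support b.2).ncard : ℝ) = ξ * k ∧
    b.1 ⬝ᵥ b.2 = τ * (Function.support b.1 ∩ Function.support b.2).ncard}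

/-- The symmetric prior: `β₁` uniform over `k`-sparse sign vectors and `β₂ = -β₁`. -/
def symmetricPrior (p k : ℕ) : Measure (Signal p × Signal p) :=
  (uniformOn (sparseSigns p k)).map fun β => (β, -β)

/-- I.i.d. standard Gaussian entries. -/
def designLaw (n p : ℕ) : Measure (Design n p) :=
  Measure.pi fun _ => Measure.pi fun _ => gaussianReal 0 1

/-- I.i.d. centred Gaussian entries of variance `v`. -/
def noiseLaw (n : ℕ) (v : ℝ≥0) : Measure (Fin n → ℝ) :=
  Measure.pi fun _ => gaussianReal 0 v

/-- I.i.d. Bernoulli labels with values in `{0, 1}`. -/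
def labelLaw (n : ℕ) (φ : unitInterval) : Measure (Fin n → ℝ) :=
  Measure.pi fun _ => bernoulliMeasure (1 : ℝ) 0 φ

/-- The balanced mixture parameter `φ = 1/2`. -/
def balanced : unitInterval := ⟨1 / 2, by norm_num, by norm_num⟩

/-- The joint law of signals, design, labels and noise of variance `v`, all independent. -/
def mslrLaw (n p : ℕ) (π : Measure (Signal p × Signal p)) (φ : unitInterval) (v : ℝ≥0) :
    Measure ((Signal p × Signal p) × Design n p × (Fin n → ℝ) × (Fin n → ℝ)) :=
  π.prod ((designLaw n p).prod ((labelLaw n φ).prod (noiseLaw n v)))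

/-- The responses `s (X β₁ ⊙ z + X β₂ ⊙ (1 - z)) + w`, where `s` is a scaling of the signals. -/
def mslrResponse {n p : ℕ} (s : ℝ) (b : Signal p × Signal p) (X : Design n p)
    (z w : Fin n → ℝ) : Fin n → ℝ :=
  fun q => s * ((X q ⬝ᵥ b.1) * z q + (X q ⬝ᵥ b.2) * (1 - z q)) + w q

/-! ### Algorithms for recovery and for detection -/

/-- The initial memory on the parameters `P` and the data `(X, y)`: entries `0, 1, 2` of the
natural-number array `0` hold `p, n, k`; the real arrays `0, 1, 2` hold `X`, `y` (in column `0`) and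
`σ` (in entry `(0, 0)`); everything else is `0`. -/
def initState (P : Params) (X : Design P.n P.p) (y : Fin P.n → ℝ) : RamState where
  nat u x :=
    if u = 0 then (if x = 0 then P.p else if x = 1 then P.n else if x = 2 then P.k else 0) else 0
  real u x j :=
    if u = 0 then (if h : x < P.n ∧ j < P.p then X ⟨x, h.1⟩ ⟨j, h.2⟩ else 0)
    else if u = 1 then (if h : x < P.n ∧ j = 0 then y ⟨x, h.1⟩ else 0)
    else if u = 2 then (if x = 0 ∧ j = 0 then P.σ else 0)
    else 0
  drawn := 0

/-- Polynomial time: for some polynomial bound, on every input with `k ≤ p` and for every outcome of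
the random draws, the program halts within that bound in `p + n`. -/
def PolyTime (A : Prog) : Prop :=
  ∃ C η : ℕ, ∀ (P : Params), P.k ≤ P.p → ∀ (X : Design P.n P.p) (y : Fin P.n → ℝ) (ω : ℕ → ℝ),
    ∃ t m, Run ω A (initState P X y) t m ∧ t ≤ C * (P.p + P.n + 1) ^ η

/-- The error of a pair of estimates, up to relabelling, in the supremum norm. -/
def pairError {p : ℕ} (b b' : Signal p × Signal p) : ℝ :=
  min (‖b.1 - b'.1‖ + ‖b.2 - b'.2‖) (‖b.2 - b'.1‖ + ‖b.1 - b'.2‖)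

/-- The estimates that a program leaves in rows `0` and `1` of the real array `3`. -/
def outputPair (p : ℕ) (m : RamState) : Signal p × Signal p :=
  (fun j => m.real 3 0 j, fun j => m.real 3 1 j)

/-- On this input the program halts with exact estimates of both signals, up to relabelling. -/
def ExactlyRecovers (A : Prog) (P : Params) (b : Signal P.p × Signal P.p) (X : Design P.n P.p)
    (y : Fin P.n → ℝ) (ω : ℕ → ℝ) : Prop :=
  ∃ t m, Run ω A (initState P X y) t m ∧ ¬ 0 < pairError (outputPair P.p m) b

/-- The probability that `A` fails to recover the signals exactly in the balanced mixed regression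
`y = X β₁ ⊙ z + X β₂ ⊙ (1 - z) + w`, `w` of variance `σ²`, with joint signal prior `π`. -/
def recoveryError (A : Prog) (P : Params) (π : Measure (Signal P.p × Signal P.p)) : ℝ≥0∞ :=
  ((mslrLaw P.n P.p π balanced (Real.toNNReal (P.σ ^ 2))).prod tapeLaw)
    {x | ¬ ExactlyRecovers A P x.1.1 x.1.2.1
      (mslrResponse 1 x.1.1 x.1.2.1 x.1.2.2.1 x.1.2.2.2) x.2}

/-- `A` solves exact recovery along the parameters `P` under the signal priors `π`. -/
def SolvesRecovery (A : Prog) (P : ℕ → Params)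
    (π : ∀ i, Measure (Signal (P i).p × Signal (P i).p)) : Prop :=
  Tendsto (fun i => recoveryError A (P i) (π i)) atTop (𝓝 0)

/-- `A` solves exact recovery in the partially symmetric balanced regime with `a i` opposite common
support points: it does so under all joint signal priors of that regime. -/
def SolvesPSBMSLR (A : Prog) (P : ℕ → Params) (a : ℕ → ℕ) : Prop :=
  ∀ π : ∀ i, Measure (Signal (P i).p × Signal (P i).p),
    (∀ᶠ i in atTop, IsPartiallySymmetricPrior (P i).p (P i).k (a i) (π i)) →
      SolvesRecovery A P π

/-- The program halts and declares the data to be planted: entry `0` of the natural-number array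
`1` is non-zero at the end. -/
def DeclaresPlanted (D : Prog) (P : Params) (X : Design P.n P.p) (y : Fin P.n → ℝ)
    (ω : ℕ → ℝ) : Prop :=
  ∃ t m, Run ω D (initState P X y) t m ∧ m.nat 1 0 ≠ 0

/-- Type I error for symmetric balanced detection: the probability of declaring planted when `X` and
`y = √(‖β‖² / σ² + 1) w` are independent, where `‖β‖² = k` and `w` is standard Gaussian. -/
def typeIError (D : Prog) (P : Params) : ℝ≥0∞ :=
  (((designLaw P.n P.p).prod (noiseLaw P.n 1)).prod tapeLaw)
    {x | DeclaresPlanted D P x.1.1 (Real.sqrt (P.k / P.σ ^ 2 + 1) • x.1.2) x.2}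

/-- Type II error for symmetric balanced detection: the probability of not declaring planted when
`y = σ⁻¹ X β₁ ⊙ z + σ⁻¹ X β₂ ⊙ (1 - z) + w`, `β₂ = -β₁`, with standard Gaussian noise. -/
def typeIIError (D : Prog) (P : Params) : ℝ≥0∞ :=
  ((mslrLaw P.n P.p (symmetricPrior P.p P.k) balanced 1).prod tapeLaw)
    {x | ¬ DeclaresPlanted D P x.1.2.1
      (mslrResponse (1 / P.σ) x.1.1 x.1.2.1 x.1.2.2.1 x.1.2.2.2) x.2}

/-- `D` solves strong detection in the symmetric balanced problem along the parameters `P`. -/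
def StronglyDetects (D : Prog) (P : ℕ → Params) : Prop :=
  Tendsto (fun i => typeIError D (P i) + typeIIError D (P i)) atTop (𝓝 0)

/-- The predicted hardness of symmetric balanced detection fails at parameters comparable with `P`:
some sequence `Q` with the same noise levels, with `p`, `n`, `k` of the same orders as in `P` and
with diverging signal-to-noise ratio lies in `C₁ ∩ C₂` and in the hard regime, where the hardness
exponent is `ω(log p)` (so that polynomial time is `exp` of a vanishing fraction of the exponent),
and strong detection along `Q` is nevertheless solved in randomized polynomial time. -/
def DetectionHardnessFails (P : ℕ → Params) : Prop :=
  ∃ Q : ℕ → Params,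
    (∀ i, (Q i).σ = (P i).σ) ∧
    (fun i => ((Q i).p : ℝ)) =Θ[atTop] (fun i => ((P i).p : ℝ)) ∧
    (fun i => ((Q i).n : ℝ)) =Θ[atTop] (fun i => ((P i).n : ℝ)) ∧
    (fun i => ((Q i).k : ℝ)) =Θ[atTop] (fun i => ((P i).k : ℝ)) ∧
    Tendsto (fun i => (Q i).snr) atTop atTop ∧
    RegimeC1 Q ∧ RegimeC2 Q ∧ HardRegime Q ∧
    Tendsto (fun i => (Q i).hardnessExponent / Real.log (Q i).p) atTop atTop ∧
    ∃ D : Prog, PolyTime D ∧ StronglyDetects D Q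

end

noncomputable section

/-! ### Basic theory of runs -/

/-! Recovery with `a` opposite and `k - a` equal common coordinates contains symmetric detection
with sparsity `a`, because the equal coordinates can be planted by whoever holds the detection data.
Let (X, y) be detection data at Q = (p - k + a, 2n, a, σ), the parameters `Detector.reduced`.
Rescale the responses to σy, append d = k - a fresh Gaussian columns to X and add their row sums to
σy. Planted data with signals ±β become a mixed regression with signals (β, 1) and (-β, 1). A random
permutation and random signs of the columns keep the design i.i.d. Gaussian and make the pair of
signals uniform over `oppositePairs` (`shuffleLaw_eq_uniformOn`,
`Detector.measurePreserving_augment`). This is the overlap prior with ξ = 1 and τ = 1 - 2a/k, and it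
is partially symmetric with |J| = a; so the first case of the theorem follows from the second.

The recovery algorithm runs on one half of the samples. The test statistic is the sum, over the
other half, of the smaller of the two squared residuals, compared with nσ√a. Under the planted law
and after exact recovery it is at most σ²∑w², of mean nσ²; the threshold is larger by the factor
√SNR*, and Markov's inequality suffices (`Detector.noise_tail`, `Detector.typeIIError_le`). Under
the null law the held-out responses have variance a + σ² and are independent of both fits. A
response is within (σ√a)^(1/2) of one of two fixed values with probability O((σ/√a)^(1/2)), which
tends to 0, and a Chernoff bound over the n test samples gives εⁿ with ε → 0
(`pi_gaussian_sum_min_sq_lt`, `Detector.measure_accepts_le`).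

The number k - a is not part of the input, and `a` is an arbitrary sequence, so the detector tries
all d ≤ p* and declares the data planted if some d passes. As n = ω(log p), the bound εⁿ survives
the union over the p* + 1 guesses (`Detector.tendsto_typeIError`). The parameters Q are comparable
with P up to constants, so the regimes carry over; the hard regime is C₁ rewritten, since k²(snr +
1)²/snr² = (k + σ²)².

The rest is programming. A simulation lemma (`Run.memo`) lets the algorithm be called repeatedly
with the same random tape, a calculus of timed runs (`HaltsWith`) verifies the detector and bounds
its time, and `measurable_of_run` makes the estimates measurable, as conditioning on the training
data requires. -/

theorem Run.deterministic {ω : ℕ → ℝ} {S : Prog} {m m₁ m₂ : RamState} {t₁ t₂ : ℕ}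
    (h₁ : Run ω S m t₁ m₁) (h₂ : Run ω S m t₂ m₂) : t₁ = t₂ ∧ m₁ = m₂ := by
  induction h₁ generalizing t₂ m₂ with
  | skip | setNat | setReal | clearNat | clearReal | gauss => cases h₂; exact ⟨rfl, rfl⟩
  | seq _ _ ihS ihT =>
    cases h₂ with
    | seq hS hT =>
      obtain ⟨rfl, rfl⟩ := ihS hS
      obtain ⟨rfl, rfl⟩ := ihT hT
      exact ⟨rfl, rfl⟩
  | ite_pos hb _ ih =>
    cases h₂ with
    | ite_pos _ h => obtain ⟨rfl, rfl⟩ := ih h; exact ⟨rfl, rfl⟩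
    | ite_neg hb' _ => exact absurd hb hb'
  | ite_neg hb _ ih =>
    cases h₂ with
    | ite_neg _ h => obtain ⟨rfl, rfl⟩ := ih h; exact ⟨rfl, rfl⟩
    | ite_pos hb' _ => exact absurd hb' hb
  | while_done hb =>
    cases h₂ with
    | while_done _ => exact ⟨rfl, rfl⟩
    | while_step hb' _ _ => exact absurd hb' hb
  | while_step hb _ _ ihS ihW =>
    cases h₂ with
    | while_done hb' => exact absurd hb hb'
    | while_step _ hS hW =>
      obtain ⟨rfl, rfl⟩ := ihS hS
      obtain ⟨rfl, rfl⟩ := ihW hW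
      exact ⟨rfl, rfl⟩

/-- The natural-number arrays that a program may modify. -/
def Prog.natWrites : Prog → Finset ℕ
  | .skip => ∅
  | .setNat u _ _ => {u}
  | .setReal _ _ _ _ => ∅
  | .clearNat u => {u}
  | .clearReal _ => ∅
  | .gauss _ _ _ => ∅
  | .seq S T => S.natWrites ∪ T.natWrites
  | .ite _ S T => S.natWrites ∪ T.natWrites
  | .while _ S => S.natWrites

/-- The real arrays that a program may modify. -/
def Prog.realWrites : Prog → Finset ℕ
  | .skip => ∅
  | .setNat _ _ _ => ∅
  | .setReal u _ _ _ => {u}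
  | .clearNat _ => ∅
  | .clearReal u => {u}
  | .gauss u _ _ => {u}
  | .seq S T => S.realWrites ∪ T.realWrites
  | .ite _ S T => S.realWrites ∪ T.realWrites
  | .while _ S => S.realWrites

/-- Whether a program contains no random draws. -/
def Prog.drawFree : Prog → Bool
  | .gauss _ _ _ => false
  | .seq S T => S.drawFree && T.drawFree
  | .ite _ S T => S.drawFree && T.drawFree
  | .while _ S => S.drawFree
  | _ => true

/-- Only entries are addressed indirectly, arrays are named by numerals; hence a syntactic set
bounds the side effects. For concrete programs membership is decidable, and this is how the phases
of the detector are kept from interfering. -/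
theorem Run.nat_frame {ω : ℕ → ℝ} {S : Prog} {m m' : RamState} {t : ℕ} (h : Run ω S m t m')
    {u : ℕ} (hu : u ∉ S.natWrites) : m'.nat u = m.nat u := by
  induction h with
  | seq _ _ ihS ihT =>
    simp only [Prog.natWrites, Finset.mem_union, not_or] at hu
    rw [ihT hu.2, ihS hu.1]
  | ite_pos _ _ ih | ite_neg _ _ ih =>
    simp only [Prog.natWrites, Finset.mem_union, not_or] at hu
    first | exact ih hu.1 | exact ih hu.2
  | while_step _ _ _ ihS ihW => rw [ihW hu, ihS hu]
  | _ =>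
    simp_all [Prog.natWrites, RamState.writeNat, RamState.writeReal]

theorem Run.real_frame {ω : ℕ → ℝ} {S : Prog} {m m' : RamState} {t : ℕ} (h : Run ω S m t m')
    {u : ℕ} (hu : u ∉ S.realWrites) : m'.real u = m.real u := by
  induction h with
  | seq _ _ ihS ihT =>
    simp only [Prog.realWrites, Finset.mem_union, not_or] at hu
    rw [ihT hu.2, ihS hu.1]
  | ite_pos _ _ ih | ite_neg _ _ ih =>
    simp only [Prog.realWrites, Finset.mem_union, not_or] at hu
    first | exact ih hu.1 | exact ih hu.2
  | while_step _ _ _ ihS ihW => rw [ihW hu, ihS hu]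
  | _ =>
    simp_all [Prog.realWrites, RamState.writeNat, RamState.writeReal]

theorem Run.drawn_frame {ω : ℕ → ℝ} {S : Prog} {m m' : RamState} {t : ℕ} (h : Run ω S m t m')
    (hS : S.drawFree = true) : m'.drawn = m.drawn := by
  induction h with
  | seq _ _ ihS ihT =>
    simp only [Prog.drawFree, Bool.and_eq_true] at hS
    rw [ihT hS.2, ihS hS.1]
  | ite_pos _ _ ih | ite_neg _ _ ih =>
    simp only [Prog.drawFree, Bool.and_eq_true] at hS
    first | exact ih hS.1 | exact ih hS.2
  | while_step _ _ _ ihS ihW => rw [ihW hS, ihS hS]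
  | _ =>
    simp_all [Prog.drawFree, RamState.writeNat, RamState.writeReal]

/-! ### Running a program on shifted arrays with a memoised tape -/

/-- Rename all arrays by adding `s`. -/
def NExpr.shift (s : ℕ) : NExpr → NExpr
  | .const c => .const c
  | .get u e => .get (u + s) (e.shift s)
  | .plus e f => .plus (e.shift s) (f.shift s)
  | .minus e f => .minus (e.shift s) (f.shift s)

/-- Rename all arrays by adding `s`. -/
def RExpr.shift (s : ℕ) : RExpr → RExpr
  | .const q => .const q
  | .ofNat e => .ofNat (e.shift s)
  | .get u e f => .get (u + s) (e.shift s) (f.shift s)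
  | .plus r t => .plus (r.shift s) (t.shift s)
  | .minus r t => .minus (r.shift s) (t.shift s)
  | .times r t => .times (r.shift s) (t.shift s)
  | .divide r t => .divide (r.shift s) (t.shift s)

/-- Rename all arrays by adding `s`. -/
def Test.shift (s : ℕ) : Test → Test
  | .natLt e f => .natLt (e.shift s) (f.shift s)
  | .realLt r t => .realLt (r.shift s) (t.shift s)

/-- Entry `0` of a natural-number array, used as a scalar. -/
abbrev NExpr.var (u : ℕ) : NExpr := .get u (.const 0)

/-- Assignment to entry `0` of a natural-number array. -/
abbrev Prog.setVar (u : ℕ) (e : NExpr) : Prog := .setNat u (.const 0) e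

/-- Rename all arrays by adding `s`, and replace random draws by reading the next entry of row `0`
of the real array `R`, the number of entries read being counted in `c`. Row `0` of `R` is extended
by fresh draws when it is exhausted; its length is kept in `f`. -/
def Prog.memo (s R c f : ℕ) : Prog → Prog
  | .skip => .skip
  | .setNat u e v => .setNat (u + s) (e.shift s) (v.shift s)
  | .setReal u e g r => .setReal (u + s) (e.shift s) (g.shift s) (r.shift s)
  | .clearNat u => .clearNat (u + s)
  | .clearReal u => .clearReal (u + s)
  | .gauss u e g =>
    .seq
      (.ite (.natLt (.var c) (.var f)) .skip
        (.seq (.gauss R (.const 0) (.var c)) (.setVar f (.plus (.var c) (.const 1)))))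
      (.seq (.setReal (u + s) (e.shift s) (g.shift s) (.get R (.const 0) (.var c)))
        (.setVar c (.plus (.var c) (.const 1))))
  | .seq S T => .seq (S.memo s R c f) (T.memo s R c f)
  | .ite b S T => .ite (b.shift s) (S.memo s R c f) (T.memo s R c f)
  | .while b S => .while (b.shift s) (S.memo s R c f)

/-- The memory `M` of the memoised program represents the memory `m` of the original one, which
reads the tape `ω` from position `N₀` on. -/
structure MemoSim (s R c f : ℕ) (ω : ℕ → ℝ) (N₀ : ℕ) (m M : RamState) : Prop where
  nat_eq : ∀ u, M.nat (u + s) = m.nat u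
  real_eq : ∀ u, M.real (u + s) = m.real u
  count_eq : M.nat c 0 = m.drawn
  count_le : m.drawn ≤ M.nat f 0
  drawn_eq : M.drawn = N₀ + M.nat f 0
  tape_eq : ∀ j < M.nat f 0, M.real R 0 j = ω (N₀ + j)

variable {s R c f N₀ : ℕ} {ω : ℕ → ℝ} {m M : RamState}

theorem MemoSim.eval_nat (h : MemoSim s R c f ω N₀ m M) (e : NExpr) :
    (e.shift s).eval M = e.eval m := by
  induction e with
  | const => rfl
  | get u e ih => simp only [NExpr.shift, NExpr.eval, ih, h.nat_eq]
  | plus e f ihe ihf | minus e f ihe ihf => simp only [NExpr.shift, NExpr.eval, ihe, ihf]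

theorem MemoSim.eval_real (h : MemoSim s R c f ω N₀ m M) (r : RExpr) :
    (r.shift s).eval M = r.eval m := by
  induction r with
  | const => rfl
  | ofNat e => simp only [RExpr.shift, RExpr.eval, h.eval_nat]
  | get u e f => simp only [RExpr.shift, RExpr.eval, h.eval_nat, h.real_eq]
  | plus e f ihe ihf | minus e f ihe ihf | times e f ihe ihf | divide e f ihe ihf =>
    simp only [RExpr.shift, RExpr.eval, ihe, ihf]

theorem MemoSim.holds (h : MemoSim s R c f ω N₀ m M) (b : Test) :
    (b.shift s).Holds M ↔ b.Holds m := by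
  cases b <;> simp only [Test.shift, Test.Holds, h.eval_nat, h.eval_real]

theorem update_add_right {α : Type*} (g : ℕ → α) (g' : ℕ → α) (hg : ∀ u, g (u + s) = g' u)
    (v : ℕ) (x : α) (u : ℕ) :
    Function.update g (v + s) x (u + s) = Function.update g' v x u := by
  by_cases huv : u = v
  · subst huv; simp
  · rw [Function.update_of_ne (by omega), Function.update_of_ne huv, hg]

/-- Without memoisation the stretch of tape read in one trial would depend on what earlier trials
consumed. Here every call replays the tape from `N₀` on, so its result is a function of the data and
of `ω`. The bounds by `s` keep the bookkeeping arrays apart from the renamed ones. The factor 5 is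
the largest cost of a simulated draw. -/
theorem Run.memo (hR : R < s) (hc : c < s) (hf : f < s) (hcf : c ≠ f) {S : Prog} {t : ℕ}
    {m' : RamState} (h : Run (fun j => ω (N₀ + j)) S m t m') (hM : MemoSim s R c f ω N₀ m M) :
    ∃ t' M', t' ≤ 5 * t ∧ Run ω (S.memo s R c f) M t' M' ∧ MemoSim s R c f ω N₀ m' M' := by
  induction h generalizing M with
  | skip => exact ⟨1, M, by omega, .skip _, hM⟩
  | setNat m u e v =>
    refine ⟨1, _, by omega, .setNat _ _ _ _, ⟨fun w => ?_, hM.real_eq, ?_, ?_, ?_, ?_⟩⟩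
    · simp only [RamState.writeNat, hM.eval_nat, hM.nat_eq]
      exact update_add_right _ _ hM.nat_eq _ _ _
    all_goals
      simp only [RamState.writeNat]
      try rw [Function.update_of_ne (by omega : f ≠ u + s)]
      try rw [Function.update_of_ne (by omega : c ≠ u + s)]
    exacts [hM.count_eq, hM.count_le, hM.drawn_eq, hM.tape_eq]
  | setReal m u e g r =>
    refine ⟨1, _, by omega, .setReal _ _ _ _ _,
      ⟨hM.nat_eq, fun w => ?_, hM.count_eq, hM.count_le, hM.drawn_eq, fun j hj => ?_⟩⟩
    · simp only [RamState.writeReal, hM.eval_nat, hM.eval_real, hM.real_eq]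
      exact update_add_right _ _ hM.real_eq _ _ _
    · simp only [RamState.writeReal]
      rw [Function.update_of_ne (by omega)]
      exact hM.tape_eq j hj
  | clearNat m u =>
    refine ⟨1, _, by omega, .clearNat _ _, ⟨fun w => ?_, hM.real_eq, ?_, ?_, ?_, ?_⟩⟩
    · exact update_add_right _ _ hM.nat_eq _ _ _
    all_goals
      dsimp only
      try rw [Function.update_of_ne (by omega : f ≠ u + s)]
      try rw [Function.update_of_ne (by omega : c ≠ u + s)]
    exacts [hM.count_eq, hM.count_le, hM.drawn_eq, hM.tape_eq]
  | clearReal m u =>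
    refine ⟨1, _, by omega, .clearReal _ _,
      ⟨hM.nat_eq, fun w => ?_, hM.count_eq, hM.count_le, hM.drawn_eq, fun j hj => ?_⟩⟩
    · exact update_add_right _ _ hM.real_eq _ _ _
    · dsimp only
      rw [Function.update_of_ne (by omega)]
      exact hM.tape_eq j hj
  | gauss m u e g =>
    obtain ⟨t₁, M₁, ht₁, hrun, hM₁, hlt⟩ : ∃ t₁ M₁, t₁ ≤ 3 ∧ Run ω
        (.ite (.natLt (.var c) (.var f)) .skip
        (.seq (.gauss R (.const 0) (.var c)) (.setVar f (.plus (.var c) (.const 1))))) M t₁ M₁ ∧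
        MemoSim s R c f ω N₀ m M₁ ∧ m.drawn < M₁.nat f 0 := by
      by_cases hlt : M.nat c 0 < M.nat f 0
      · exact ⟨2, M, by omega, .ite_pos hlt (.skip _), hM, hM.count_eq ▸ hlt⟩
      -- By `count_le` the count equals the length here, so the fresh draw is `ω` at `N₀` plus the
      -- count, which is the entry that the original program would read.
      · refine ⟨3, _, le_rfl, .ite_neg hlt (.seq (.gauss _ _ _ _) (.setNat _ _ _ _)),
          ⟨fun w => ?_, fun w => ?_, ?_, ?_, ?_, fun j hj => ?_⟩, ?_⟩
        all_goals have h1 := hM.count_le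
        all_goals have h2 := hM.count_eq
        all_goals have h3 := hM.drawn_eq
        · simp only [RamState.writeNat, RamState.writeReal, NExpr.eval]
          rw [Function.update_of_ne (by omega)]; exact hM.nat_eq w
        · simp only [RamState.writeNat, RamState.writeReal, NExpr.eval]
          rw [Function.update_of_ne (by omega)]; exact hM.real_eq w
        · simp only [RamState.writeNat, RamState.writeReal, NExpr.eval]
          rw [Function.update_of_ne hcf]; exact h2
        · simp [RamState.writeNat, RamState.writeReal, NExpr.eval]; omega
        · simp [RamState.writeNat, RamState.writeReal, NExpr.eval]; omega
        · simp only [RamState.writeNat, RamState.writeReal, NExpr.eval, Function.update_self]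
            at hj ⊢
          by_cases hjc : j = M.nat c 0
          · subst hjc
            rw [Function.update_self]; congr 1; omega
          · rw [Function.update_of_ne hjc]
            exact hM.tape_eq j (by omega)
        · simp [RamState.writeNat, RamState.writeReal, NExpr.eval]; omega
    refine ⟨t₁ + (1 + 1), _, by omega, .seq hrun (.seq (.setReal _ _ _ _ _) (.setNat _ _ _ _)),
      ⟨fun w => ?_, fun w => ?_, ?_, ?_, ?_, fun j hj => ?_⟩⟩
    · simp only [RamState.writeNat, RamState.writeReal, NExpr.eval]
      rw [Function.update_of_ne (by omega)]; exact hM₁.nat_eq w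
    · simp only [RamState.writeNat, RamState.writeReal, NExpr.eval, RExpr.eval, hM₁.eval_nat,
        hM₁.real_eq, hM₁.count_eq, hM₁.tape_eq _ hlt]
      exact update_add_right _ _ hM₁.real_eq _ _ _
    · simp [RamState.writeNat, RamState.writeReal, NExpr.eval, hM₁.count_eq]
    · simp [RamState.writeNat, RamState.writeReal, NExpr.eval, Function.update_of_ne hcf.symm]
      omega
    · simp [RamState.writeNat, RamState.writeReal, NExpr.eval, Function.update_of_ne hcf.symm,
        hM₁.drawn_eq]
    · simp only [RamState.writeNat, RamState.writeReal, NExpr.eval,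
        Function.update_of_ne hcf.symm] at hj ⊢
      rw [Function.update_of_ne (by omega)]
      exact hM₁.tape_eq j hj
  | seq _ _ ihS ihT =>
    obtain ⟨t₁, M₁, ht₁, h₁, hM₁⟩ := ihS hM
    obtain ⟨t₂, M₂, ht₂, h₂, hM₂⟩ := ihT hM₁
    exact ⟨_, M₂, by omega, .seq h₁ h₂, hM₂⟩
  | ite_pos hb _ ih =>
    obtain ⟨t₁, M₁, ht₁, h₁, hM₁⟩ := ih hM
    exact ⟨_, M₁, by omega, .ite_pos ((hM.holds _).2 hb) h₁, hM₁⟩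
  | ite_neg hb _ ih =>
    obtain ⟨t₁, M₁, ht₁, h₁, hM₁⟩ := ih hM
    exact ⟨_, M₁, by omega, .ite_neg (mt (hM.holds _).1 hb) h₁, hM₁⟩
  | while_done hb => exact ⟨1, M, by omega, .while_done (mt (hM.holds _).1 hb), hM⟩
  | while_step hb _ _ ihS ihW =>
    obtain ⟨t₁, M₁, ht₁, h₁, hM₁⟩ := ihS hM
    obtain ⟨t₂, M₂, ht₂, h₂, hM₂⟩ := ihW hM₁
    exact ⟨_, M₂, by omega, .while_step ((hM.holds _).2 hb) h₁ h₂, hM₂⟩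

theorem Prog.natWrites_memo (S : Prog) {u : ℕ} (hu : u ∈ (S.memo s R c f).natWrites) :
    u = c ∨ u = f ∨ ∃ v ∈ S.natWrites, u = v + s := by
  induction S with
  | seq S T ihS ihT | ite b S T ihS ihT =>
    simp only [Prog.memo, Prog.natWrites, Finset.mem_union] at hu ⊢
    rcases hu with hu | hu
    · rcases ihS hu with h | h | ⟨v, hv, rfl⟩ <;> simp_all
    · rcases ihT hu with h | h | ⟨v, hv, rfl⟩ <;> simp_all
  | skip | setNat | setReal | clearNat | clearReal | gauss =>
    simp_all [Prog.memo, Prog.natWrites] <;> tauto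
  | _ b S ih => exact ih hu

theorem Prog.realWrites_memo (S : Prog) {u : ℕ} (hu : u ∈ (S.memo s R c f).realWrites) :
    u = R ∨ ∃ v ∈ S.realWrites, u = v + s := by
  induction S with
  | seq S T ihS ihT | ite b S T ihS ihT =>
    simp only [Prog.memo, Prog.realWrites, Finset.mem_union] at hu ⊢
    rcases hu with hu | hu
    · rcases ihS hu with h | ⟨v, hv, rfl⟩ <;> simp_all
    · rcases ihT hu with h | ⟨v, hv, rfl⟩ <;> simp_all
  | skip | setNat | setReal | clearNat | clearReal | gauss =>
    simp_all [Prog.memo, Prog.realWrites]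
  | _ b S ih => exact ih hu

/-! ### Counting loops -/

/-- Execute `S` with the counter `c` equal to `0, …, b - 1`. -/
def Prog.loop (c : ℕ) (b : NExpr) (S : Prog) : Prog :=
  .seq (.setVar c (.const 0))
    (.while (.natLt (.var c) b) (.seq S (.setVar c (.plus (.var c) (.const 1)))))

/-- Agreement outside the arrays that `S` may modify. -/
structure Prog.Frame (S : Prog) (m m' : RamState) : Prop where
  nat_eq : ∀ u, u ∉ S.natWrites → m'.nat u = m.nat u
  real_eq : ∀ u, u ∉ S.realWrites → m'.real u = m.real u
  drawn_eq : S.drawFree = true → m'.drawn = m.drawn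

theorem Run.frame {S : Prog} {t : ℕ} {m' : RamState} (h : Run ω S m t m') : S.Frame m m' :=
  ⟨fun _ => h.nat_frame, fun _ => h.real_frame, h.drawn_frame⟩

theorem Prog.Frame.trans {S : Prog} {m₁ m₂ m₃ : RamState} (h : S.Frame m₁ m₂)
    (h' : S.Frame m₂ m₃) : S.Frame m₁ m₃ :=
  ⟨fun u hu => (h'.nat_eq u hu).trans (h.nat_eq u hu),
    fun u hu => (h'.real_eq u hu).trans (h.real_eq u hu),
    fun hS => (h'.drawn_eq hS).trans (h.drawn_eq hS)⟩

/-- `S` halts within `T` steps from `m`, in a memory with the property `Q`. -/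
def HaltsWith (ω : ℕ → ℝ) (S : Prog) (m : RamState) (T : ℕ) (Q : RamState → Prop) : Prop :=
  ∃ t m', t ≤ T ∧ Run ω S m t m' ∧ Q m'

/-! ### Composition rules for timed runs -/

theorem HaltsWith.mono {S : Prog} {T T' : ℕ} {Q Q' : RamState → Prop} (h : HaltsWith ω S m T Q)
    (hT : T ≤ T') (hQ : ∀ m', S.Frame m m' → Q m' → Q' m') : HaltsWith ω S m T' Q' := by
  obtain ⟨t, m', ht, hr, hq⟩ := h
  exact ⟨t, m', ht.trans hT, hr, hQ m' hr.frame hq⟩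

theorem HaltsWith.of_le {S : Prog} {T T' : ℕ} {Q : RamState → Prop} (h : HaltsWith ω S m T Q)
    (hT : T ≤ T') : HaltsWith ω S m T' Q :=
  h.mono hT fun _ _ h => h

theorem HaltsWith.seq {S S' : Prog} {T T' : ℕ} {Q Q' : RamState → Prop}
    (h : HaltsWith ω S m T Q) (h' : ∀ m', S.Frame m m' → Q m' → HaltsWith ω S' m' T' Q') :
    HaltsWith ω (.seq S S') m (T + T') Q' := by
  obtain ⟨t, m', ht, hr, hq⟩ := h
  obtain ⟨t', m'', ht', hr', hq'⟩ := h' m' hr.frame hq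
  exact ⟨_, m'', by omega, .seq hr hr', hq'⟩

theorem HaltsWith.ite {b : Test} {S S' : Prog} {T : ℕ} {Q : RamState → Prop}
    (h : b.Holds m → HaltsWith ω S m T Q) (h' : ¬ b.Holds m → HaltsWith ω S' m T Q) :
    HaltsWith ω (.ite b S S') m (T + 1) Q := by
  by_cases hb : b.Holds m
  · obtain ⟨t, m', ht, hr, hq⟩ := h hb
    exact ⟨_, m', by omega, .ite_pos hb hr, hq⟩
  · obtain ⟨t, m', ht, hr, hq⟩ := h' hb
    exact ⟨_, m', by omega, .ite_neg hb hr, hq⟩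

theorem HaltsWith.skip {Q : RamState → Prop} (hQ : Q m) : HaltsWith ω .skip m 1 Q :=
  ⟨1, m, le_rfl, .skip _, hQ⟩

theorem HaltsWith.setNat {u : ℕ} {e v : NExpr} {Q : RamState → Prop}
    (hQ : Q (m.writeNat u (e.eval m) (v.eval m))) : HaltsWith ω (.setNat u e v) m 1 Q :=
  ⟨1, _, le_rfl, .setNat _ _ _ _, hQ⟩

theorem HaltsWith.setReal {u : ℕ} {e g : NExpr} {r : RExpr} {Q : RamState → Prop}
    (hQ : Q (m.writeReal u (e.eval m) (g.eval m) (r.eval m))) :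
    HaltsWith ω (.setReal u e g r) m 1 Q :=
  ⟨1, _, le_rfl, .setReal _ _ _ _ _, hQ⟩

theorem HaltsWith.gauss {u : ℕ} {e g : NExpr} {Q : RamState → Prop}
    (hQ : Q { m.writeReal u (e.eval m) (g.eval m) (ω m.drawn) with drawn := m.drawn + 1 }) :
    HaltsWith ω (.gauss u e g) m 1 Q :=
  ⟨1, _, le_rfl, .gauss _ _ _ _, hQ⟩

theorem HaltsWith.clearNat {u : ℕ} {Q : RamState → Prop}
    (hQ : Q { m with nat := Function.update m.nat u (fun _ => 0) }) :
    HaltsWith ω (.clearNat u) m 1 Q :=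
  ⟨1, _, le_rfl, .clearNat _ _, hQ⟩

theorem HaltsWith.clearReal {u : ℕ} {Q : RamState → Prop}
    (hQ : Q { m with real := Function.update m.real u (fun _ _ => 0) }) :
    HaltsWith ω (.clearReal u) m 1 Q :=
  ⟨1, _, le_rfl, .clearReal _ _, hQ⟩

/-- The rule for counting loops. The invariant `I i` describes the memory before iteration `i`;
it may rely on the arrays that the loop does not modify. -/
theorem HaltsWith.loop {b : NExpr} {S : Prog} (B T : ℕ) (I : ℕ → RamState → Prop)
    (hc : c ∉ S.natWrites)
    (hb : ∀ m', (Prog.loop c b S).Frame m m' → b.eval m' = B)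
    (h0 : I 0 (m.writeNat c 0 0))
    (hS : ∀ i < B, ∀ m', (Prog.loop c b S).Frame m m' → m'.nat c 0 = i → I i m' →
      HaltsWith ω S m' T fun m'' => I (i + 1) (m''.writeNat c 0 (i + 1))) :
    HaltsWith ω (Prog.loop c b S) m (B * (T + 2) + 2) (I B) := by
  -- Induction on the number `r` of remaining iterations. Each costs `T` plus one for the test and
  -- one for the increment; the initialisation and the last test add 2.
  have key : ∀ r i m', i + r = B → (Prog.loop c b S).Frame m m' → m'.nat c 0 = i → I i m' →
      HaltsWith ω (.while (.natLt (.var c) b) (.seq S (.setVar c (.plus (.var c) (.const 1)))))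
        m' (r * (T + 2) + 1) (I B) := by
    intro r
    induction r with
    | zero =>
      intro i m' hi hF hci hI
      have hib : i = B := by omega
      refine ⟨1, m', by omega, .while_done ?_, hib ▸ hI⟩
      simp only [Test.Holds, NExpr.eval, hb m' hF]
      omega
    | succ r ih =>
      intro i m' hi hF hci hI
      obtain ⟨t, m'', ht, hr, hq⟩ := hS i (by omega) m' hF hci hI
      have hci' : m''.nat c 0 = i := by rw [hr.nat_frame hc, hci]
      have hrun : Run ω (.seq S (.setVar c (.plus (.var c) (.const 1)))) m' (t + 1)
          (m''.writeNat c 0 (i + 1)) := by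
        refine .seq hr ?_
        have := Run.setNat (ω := ω) m'' c (.const 0) (.plus (.var c) (.const 1))
        simpa only [NExpr.eval, hci'] using this
      have hF' : (Prog.loop c b S).Frame m' (m''.writeNat c 0 (i + 1)) := by
        have h2 := hrun.frame
        refine ⟨fun u hu => h2.nat_eq u ?_, fun u hu => h2.real_eq u ?_, fun hd => h2.drawn_eq ?_⟩
        · simp_all [Prog.loop, Prog.natWrites]
        · simpa [Prog.loop, Prog.realWrites] using hu
        · simpa [Prog.loop, Prog.drawFree] using hd
      obtain ⟨t', m₃, ht', hr', hq'⟩ := ih (i + 1) _ (by omega) (hF.trans hF')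
        (by simp [RamState.writeNat]) hq
      refine ⟨_, m₃, ?_, .while_step ?_ hrun hr', hq'⟩
      · have : (r + 1) * (T + 2) = r * (T + 2) + (T + 2) := by ring
        omega
      · simp only [Test.Holds, NExpr.eval, hb m' hF]
        omega
  obtain ⟨t, m', ht, hr, hq⟩ := key B 0 (m.writeNat c 0 0) (by omega)
    ⟨fun u hu => by
      have : u ≠ c := by rintro rfl; simp [Prog.loop, Prog.natWrites] at hu
      simp [RamState.writeNat, Function.update_of_ne this], fun _ _ => rfl, fun _ => rfl⟩
    (by simp [RamState.writeNat]) h0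
  exact ⟨1 + t, m', by omega, .seq (.setNat m c (.const 0) (.const 0)) hr, hq⟩

end

noncomputable section

/-! ### Measurability of runs -/

/-- The product σ-algebra of the entries: a memory-valued map is measurable as soon as all its
entries are. -/
instance RamState.instMeasurableSpace : MeasurableSpace RamState :=
  MeasurableSpace.comap (fun m => (m.nat, m.real, m.drawn)) inferInstance

theorem measurable_ramState :
    Measurable (fun m : RamState => (m.nat, m.real, m.drawn)) := comap_measurable _

variable {α : Type*} [MeasurableSpace α]

theorem Measurable.ramState {F : α → RamState} (h₁ : ∀ u x, Measurable fun a => (F a).nat u x)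
    (h₂ : ∀ u x y, Measurable fun a => (F a).real u x y)
    (h₃ : Measurable fun a => (F a).drawn) : Measurable F := by
  refine measurable_comap_iff.2 (Measurable.prodMk ?_ (Measurable.prodMk ?_ h₃))
  · exact measurable_pi_lambda _ fun u => measurable_pi_lambda _ fun x => h₁ u x
  · exact measurable_pi_lambda _ fun u => measurable_pi_lambda _ fun x =>
      measurable_pi_lambda _ fun y => h₂ u x y

theorem RamState.measurable_nat (u x : ℕ) : Measurable fun m : RamState => m.nat u x :=
  (measurable_pi_apply x).comp ((measurable_pi_apply u).comp measurable_ramState.fst)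

theorem RamState.measurable_real (u x y : ℕ) : Measurable fun m : RamState => m.real u x y :=
  (measurable_pi_apply y).comp ((measurable_pi_apply x).comp ((measurable_pi_apply u).comp
    measurable_ramState.snd.fst))

theorem RamState.measurable_drawn : Measurable RamState.drawn :=
  measurable_ramState.snd.snd

/-- Indirect addressing evaluates an array at a random index; measurability survives because there
are only countably many indices. -/
theorem measurable_apply_countable {β : Type*} [MeasurableSpace β] {F : α → ℕ → β}
    (hF : ∀ x, Measurable fun a => F a x) {g : α → ℕ} (hg : Measurable g) :
    Measurable fun a => F a (g a) := by
  have : Measurable fun q : α × ℕ => F q.1 q.2 := measurable_from_prod_countable_left hF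
  exact this.comp (measurable_id.prodMk hg)

theorem NExpr.measurable_eval (e : NExpr) : Measurable fun m : RamState => e.eval m := by
  induction e with
  | const c => exact measurable_const
  | get u e ih => exact measurable_apply_countable (fun x => RamState.measurable_nat u x) ih
  | plus e f he hf => exact he.add hf
  | minus e f he hf => exact he.sub hf

theorem RExpr.measurable_eval (r : RExpr) : Measurable fun m : RamState => r.eval m := by
  induction r with
  | const c => exact measurable_const
  | ofNat e => exact (measurable_of_countable _).comp e.measurable_eval
  | get u e f =>
    exact measurable_apply_countable (F := fun m y => m.real u (e.eval m) y)
      (fun y => measurable_apply_countable (F := fun m x => m.real u x y)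
        (fun x => RamState.measurable_real u x y) e.measurable_eval) f.measurable_eval
  | plus e f he hf => exact he.add hf
  | minus e f he hf => exact he.sub hf
  | times e f he hf => exact he.mul hf
  | divide e f he hf => exact he.div hf

theorem Test.measurableSet_holds (b : Test) : MeasurableSet {m : RamState | b.Holds m} := by
  cases b with
  | natLt e f => exact measurableSet_lt e.measurable_eval f.measurable_eval
  | realLt e f => exact measurableSet_lt e.measurable_eval f.measurable_eval

theorem measurable_update_countable {β : Type*} [MeasurableSpace β] {F : α → ℕ → β} {g : α → ℕ}
    {v : α → β} (x : ℕ) (hF : Measurable fun a => F a x) (hg : Measurable g) (hv : Measurable v) :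
    Measurable fun a => Function.update (F a) (g a) (v a) x := by
  simp only [Function.update_apply]
  exact Measurable.ite (measurableSet_eq_fun measurable_const hg) hv hF

theorem measurable_writeNat {F : α → RamState} (hF : Measurable F) (u : ℕ) {x v : α → ℕ}
    (hx : Measurable x) (hv : Measurable v) :
    Measurable fun a => (F a).writeNat u (x a) (v a) := by
  refine .ramState (fun w y => ?_) (fun w y z => ((RamState.measurable_real w y z).comp hF :))
    (RamState.measurable_drawn.comp hF :)
  simp only [RamState.writeNat]
  by_cases h : w = u
  · subst h
    simp only [Function.update_self]
    exact measurable_update_countable y ((RamState.measurable_nat w y).comp hF) hx hv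
  · simp only [Function.update_of_ne h]
    exact (RamState.measurable_nat w y).comp hF

theorem measurable_writeReal {F : α → RamState} (hF : Measurable F) (u : ℕ) {x y : α → ℕ}
    {r : α → ℝ} (hx : Measurable x) (hy : Measurable y) (hr : Measurable r) :
    Measurable fun a => (F a).writeReal u (x a) (y a) (r a) := by
  refine .ramState (fun w y => ((RamState.measurable_nat w y).comp hF :)) (fun w z z' => ?_)
    (RamState.measurable_drawn.comp hF :)
  simp only [RamState.writeReal]
  by_cases h : w = u
  · subst h
    simp only [Function.update_self, Function.update_apply (f := (F _).real w)]
    simp only [apply_ite (fun f : ℕ → ℝ => f z')]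
    refine Measurable.ite (measurableSet_eq_fun measurable_const hx) ?_
      ((RamState.measurable_real w z z').comp hF)
    refine measurable_update_countable z' ?_ hy hr
    exact measurable_apply_countable (F := fun a x => (F a).real w x z')
      (fun x => (RamState.measurable_real w x z').comp hF) hx
  · simp only [Function.update_of_ne h]
    exact (RamState.measurable_real w z z').comp hF

/-- The tapes and memories from which `S` halts after `t` steps in `B`. -/
def haltSet (S : Prog) (t : ℕ) (B : Set ((ℕ → ℝ) × RamState)) : Set ((ℕ → ℝ) × RamState) :=
  {x | ∃ m', Run x.1 S x.2 t m' ∧ (x.1, m') ∈ B}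

theorem haltSet_eq_preimage {S : Prog} {B : Set ((ℕ → ℝ) × RamState)}
    {F : (ℕ → ℝ) × RamState → RamState} (hF : ∀ ω m t m', Run ω S m t m' ↔ t = 1 ∧ m' = F (ω, m))
    (hm : Measurable F) (hB : MeasurableSet B) (t : ℕ) : MeasurableSet (haltSet S t B) := by
  have : haltSet S t B = {x | t = 1 ∧ (x.1, F x) ∈ B} := by
    ext ⟨ω, m⟩
    simp only [haltSet, hF, Set.mem_ofPred_eq]
    constructor
    · rintro ⟨m', ⟨h, rfl⟩, h'⟩; exact ⟨h, h'⟩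
    · rintro ⟨h, h'⟩; exact ⟨_, ⟨h, rfl⟩, h'⟩
  rw [this]
  by_cases ht : t = 1
  · simp only [ht, true_and]
    exact (measurable_fst.prodMk hm) hB
  · simp [ht]

/-- Induction on the program, with the target set arbitrary so that composition becomes a countable
union over the ways to split the running time. The target contains the tape because the second
program reads the same one. Fixing `t` handles loops: an iteration costs at least one unit, so
strong induction on `t` applies. -/
theorem measurableSet_haltSet (S : Prog) (t : ℕ) {B : Set ((ℕ → ℝ) × RamState)}
    (hB : MeasurableSet B) : MeasurableSet (haltSet S t B) := by
  induction S generalizing t B with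
  | skip =>
    refine haltSet_eq_preimage (F := fun x => x.2) (fun ω m t m' => ⟨?_, ?_⟩) measurable_snd hB t
    · rintro ⟨⟩; exact ⟨rfl, rfl⟩
    · rintro ⟨rfl, rfl⟩; exact .skip _
  | setNat u e v =>
    refine haltSet_eq_preimage (F := fun x => x.2.writeNat u (e.eval x.2) (v.eval x.2))
      (fun ω m t m' => ⟨?_, ?_⟩) ?_ hB t
    · rintro ⟨⟩; exact ⟨rfl, rfl⟩
    · rintro ⟨rfl, rfl⟩; exact .setNat _ _ _ _
    · exact measurable_writeNat measurable_snd _ (e.measurable_eval.comp measurable_snd)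
        (v.measurable_eval.comp measurable_snd)
  | setReal u e f r =>
    refine haltSet_eq_preimage
      (F := fun x => x.2.writeReal u (e.eval x.2) (f.eval x.2) (r.eval x.2))
      (fun ω m t m' => ⟨?_, ?_⟩) ?_ hB t
    · rintro ⟨⟩; exact ⟨rfl, rfl⟩
    · rintro ⟨rfl, rfl⟩; exact .setReal _ _ _ _ _
    · exact measurable_writeReal measurable_snd _ (e.measurable_eval.comp measurable_snd)
        (f.measurable_eval.comp measurable_snd) (r.measurable_eval.comp measurable_snd)
  | clearNat u =>
    refine haltSet_eq_preimage
      (F := fun x => { x.2 with nat := Function.update x.2.nat u (fun _ => 0) })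
      (fun ω m t m' => ⟨?_, ?_⟩) ?_ hB t
    · rintro ⟨⟩; exact ⟨rfl, rfl⟩
    · rintro ⟨rfl, rfl⟩; exact .clearNat _ _
    · refine .ramState (fun w y => ?_)
        (fun w y z => ((RamState.measurable_real w y z).comp measurable_snd :))
        (RamState.measurable_drawn.comp measurable_snd :)
      by_cases h : w = u
      · subst h; simp
      · simp only [Function.update_of_ne h]
        exact (RamState.measurable_nat w y).comp measurable_snd
  | clearReal u =>
    refine haltSet_eq_preimage
      (F := fun x => { x.2 with real := Function.update x.2.real u (fun _ _ => 0) })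
      (fun ω m t m' => ⟨?_, ?_⟩) ?_ hB t
    · rintro ⟨⟩; exact ⟨rfl, rfl⟩
    · rintro ⟨rfl, rfl⟩; exact .clearReal _ _
    · refine .ramState (fun w y => ((RamState.measurable_nat w y).comp measurable_snd :))
        (fun w y z => ?_) (RamState.measurable_drawn.comp measurable_snd :)
      by_cases h : w = u
      · subst h; simp
      · simp only [Function.update_of_ne h]
        exact (RamState.measurable_real w y z).comp measurable_snd
  | gauss u e f =>
    refine haltSet_eq_preimage
      (F := fun x => { x.2.writeReal u (e.eval x.2) (f.eval x.2) (x.1 x.2.drawn) with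
        drawn := x.2.drawn + 1 }) (fun ω m t m' => ⟨?_, ?_⟩) ?_ hB t
    · rintro ⟨⟩; exact ⟨rfl, rfl⟩
    · rintro ⟨rfl, rfl⟩; exact .gauss _ _ _ _
    · have h := measurable_writeReal (F := fun x : (ℕ → ℝ) × RamState => x.2) measurable_snd u
        (e.measurable_eval.comp measurable_snd) (f.measurable_eval.comp measurable_snd)
        (measurable_apply_countable (F := fun (x : (ℕ → ℝ) × RamState) j => x.1 j)
          (fun j => (measurable_pi_apply j).comp measurable_fst)
          (RamState.measurable_drawn.comp measurable_snd))
      exact .ramState (fun w y => ((RamState.measurable_nat w y).comp h :))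
        (fun w y z => ((RamState.measurable_real w y z).comp h :))
        ((RamState.measurable_drawn.comp measurable_snd).add_const 1)
  | seq S T ihS ihT =>
    have : haltSet (.seq S T) t B =
        ⋃ (s : ℕ) (s' : ℕ) (_ : s + s' = t), haltSet S s (haltSet T s' B) := by
      ext ⟨ω, m⟩
      simp only [haltSet, Set.mem_ofPred_eq, Set.mem_iUnion]
      constructor
      · rintro ⟨m', h, h'⟩
        cases h with
        | seq hS hT => exact ⟨_, _, rfl, _, hS, _, hT, h'⟩
      · rintro ⟨s, s', rfl, m₁, hS, m₂, hT, h'⟩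
        exact ⟨_, .seq hS hT, h'⟩
    rw [this]
    exact .iUnion fun s => .iUnion fun s' => .iUnion fun _ => ihS s (ihT s' hB)
  | ite b S T ihS ihT =>
    have : haltSet (.ite b S T) t B = ⋃ (s : ℕ) (_ : s + 1 = t),
        (Prod.snd ⁻¹' {m | b.Holds m} ∩ haltSet S s B) ∪
          ((Prod.snd ⁻¹' {m | b.Holds m})ᶜ ∩ haltSet T s B) := by
      ext ⟨ω, m⟩
      simp only [haltSet, Set.mem_ofPred_eq, Set.mem_iUnion, Set.mem_union, Set.mem_inter_iff,
        Set.mem_preimage, Set.mem_compl_iff]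
      constructor
      · rintro ⟨m', h, h'⟩
        cases h with
        | ite_pos hb hS => exact ⟨_, rfl, .inl ⟨hb, _, hS, h'⟩⟩
        | ite_neg hb hS => exact ⟨_, rfl, .inr ⟨hb, _, hS, h'⟩⟩
      · rintro ⟨s, rfl, ⟨hb, m₁, hS, h'⟩ | ⟨hb, m₁, hS, h'⟩⟩
        · exact ⟨_, .ite_pos hb hS, h'⟩
        · exact ⟨_, .ite_neg hb hS, h'⟩
    rw [this]
    have hb : MeasurableSet ((Prod.snd : (ℕ → ℝ) × RamState → _) ⁻¹' {m | b.Holds m}) :=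
      measurable_snd b.measurableSet_holds
    exact .iUnion fun s => .iUnion fun _ => (hb.inter (ihS s hB)).union (hb.compl.inter (ihT s hB))
  | _ b S ih =>
    have hb : MeasurableSet ((Prod.snd : (ℕ → ℝ) × RamState → _) ⁻¹' {m | b.Holds m}) :=
      measurable_snd b.measurableSet_holds
    induction t using Nat.strong_induction_on generalizing B with
    | _ t iht =>
    have : haltSet (.while b S) t B =
        ((Prod.snd ⁻¹' {m | b.Holds m})ᶜ ∩ {x | t = 1 ∧ x ∈ B}) ∪
        ⋃ (s : ℕ) (s' : ℕ) (_ : s + s' + 1 = t),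
        (Prod.snd ⁻¹' {m | b.Holds m} ∩ haltSet S s (haltSet (.while b S) s' B)) := by
      ext ⟨ω, m⟩
      simp only [haltSet, Set.mem_ofPred_eq, Set.mem_iUnion, Set.mem_union, Set.mem_inter_iff,
        Set.mem_preimage, Set.mem_compl_iff]
      constructor
      · rintro ⟨m', h, h'⟩
        cases h with
        | while_done hb => exact .inl ⟨hb, rfl, h'⟩
        | while_step hb hS hW => exact .inr ⟨_, _, rfl, hb, _, hS, _, hW, h'⟩
      · rintro (⟨hb, rfl, h'⟩ | ⟨s, s', rfl, hb, m₁, hS, m₂, hT, h'⟩)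
        · exact ⟨_, .while_done hb, h'⟩
        · exact ⟨_, .while_step hb hS hT, h'⟩
    rw [this]
    refine (hb.compl.inter ?_).union
      (.iUnion fun s => .iUnion fun s' => .iUnion fun hs => hb.inter (ih s (iht s' (by omega) hB)))
    by_cases ht : t = 1 <;> simp [ht, hB]

/-- The final memory of a program that halts on all inputs is a measurable function. -/
theorem measurable_of_run {S : Prog} {T : α → ℕ → ℝ} (hT : Measurable T) {F G : α → RamState}
    (hF : Measurable F) (h : ∀ a, ∃ t, Run (T a) S (F a) t (G a)) : Measurable G := by
  intro B hB
  -- Determinism gives the inclusion from right to left: whichever running time is found, the final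
  -- memory is `G a`.
  have : G ⁻¹' B = ⋃ t, (fun a => (T a, F a)) ⁻¹' haltSet S t (Prod.snd ⁻¹' B) := by
    ext a
    simp only [Set.mem_preimage, Set.mem_iUnion, haltSet, Set.mem_ofPred_eq]
    obtain ⟨t, ht⟩ := h a
    constructor
    · exact fun hGa => ⟨t, _, ht, hGa⟩
    · rintro ⟨t', m', hr, hm'⟩
      rwa [(ht.deterministic hr).2]
  rw [this]
  exact .iUnion fun t => (hT.prodMk hF) (measurableSet_haltSet S t (measurable_snd hB))

end

noncomputable section

/-! ### The detector

Arrays of natural numbers: `2` the size of the training sample, `3` the guessed number `d` of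
planted coordinates, `5, 6, 7` loop counters, `8` ranks, `10, 11` position in the memoised tape and
its length. Arrays of reals: `4` predrawn Gaussians, `5` the augmented design, `6` the augmented
responses, `7` accumulators, `10` the memoised tape. The arrays of the recovery algorithm are
renamed by adding `20`. -/

namespace Detector

abbrev dim : NExpr := .plus (.var 0) (.var 3)
abbrev samples : NExpr := .get 0 (.const 1)
abbrev sparsity : NExpr := .get 0 (.const 2)
abbrev noise : RExpr := .get 2 (.const 0) (.const 0)
abbrev acc (i : ℕ) : RExpr := .get 7 (.const 0) (.const i)
abbrev setAcc (i : ℕ) (r : RExpr) : Prog := .setReal 7 (.const 0) (.const i) r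

/-- Half of the sample size, rounded up. -/
def half : Prog :=
  .loop 7 samples (.ite (.natLt (.plus (.var 2) (.var 2)) samples)
    (.setVar 2 (.plus (.var 2) (.const 1))) .skip)

/-- Rows `0, …, n - 1` supply the added columns, row `n` the ranks and row `n + 1` the column signs.
The width `2p + 1` suffices for every `p + d` with `d ≤ p` and is positive even for `p = 0`. -/
def predraw : Prog :=
  .loop 7 (.plus samples (.const 2)) (.loop 6 (.plus (.plus (.var 0) (.var 0)) (.const 1))
    (.gauss 4 (.var 7) (.var 6)))

/-- Random integers are not available; the ranks of i.i.d. Gaussians, found by counting, form almost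
surely a uniform permutation. -/
def ranks : Prog :=
  .loop 5 dim (.seq (.setNat 8 (.var 5) (.const 0))
    (.loop 6 dim (.ite (.realLt (.get 4 samples (.var 6)) (.get 4 samples (.var 5)))
      (.setNat 8 (.var 5) (.plus (.get 8 (.var 5)) (.const 1))) .skip)))

/-- The detection problem has unit noise, so the factor σ restores the noise of the recovery
problem. Adding `d` Gaussians to each response plants `d` coordinates at which both signals are 1.
-/
def responses : Prog :=
  .loop 7 samples (.seq
    (.setReal 6 (.var 7) (.const 0) (.times noise (.get 1 (.var 7) (.const 0))))
    (.loop 6 (.var 3) (.setReal 6 (.var 7) (.const 0)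
      (.plus (.get 6 (.var 7) (.const 0)) (.get 4 (.var 7) (.var 6))))))

/-- A rank below `p` selects a given column, any other rank an added one; the signs come from the
last predrawn row. -/
def design : Prog :=
  .loop 7 samples (.loop 5 dim (.seq
    (.ite (.natLt (.get 8 (.var 5)) (.var 0))
      (.setReal 5 (.var 7) (.var 5) (.get 0 (.var 7) (.get 8 (.var 5))))
      (.setReal 5 (.var 7) (.var 5) (.get 4 (.var 7) (.minus (.get 8 (.var 5)) (.var 0)))))
    (.ite (.realLt (.get 4 (.plus samples (.const 1)) (.var 5)) (.const 0))
      (.setReal 5 (.var 7) (.var 5) (.minus (.const 0) (.get 5 (.var 7) (.var 5)))) .skip)))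

/-- Clear the arrays `20, …, 20 + N - 1`. -/
def clear : ℕ → Prog
  | 0 => .skip
  | N + 1 => .seq (clear N) (.seq (.clearNat (N + 20)) (.clearReal (N + 20)))

/-- Copy the training data to the input of the recovery algorithm. -/
def copy : Prog :=
  .loop 7 (.var 2) (.seq
    (.setReal 21 (.var 7) (.const 0) (.get 6 (.var 7) (.const 0)))
    (.loop 5 dim (.setReal 20 (.var 7) (.var 5) (.get 5 (.var 7) (.var 5)))))

/-- Resetting entry `0` of array `10` rewinds the memoised tape; its length, in array `11`, is kept.
-/
def scalars : Prog :=
  .seq (.setNat 20 (.const 0) dim) (.seq (.setNat 20 (.const 1) (.var 2))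
    (.seq (.setNat 20 (.const 2) (.plus sparsity (.var 3)))
      (.seq (.setReal 22 (.const 0) (.const 0) noise) (.setVar 10 (.const 0)))))

/-- The sum over the test sample of the smaller squared residual. -/
def residuals : Prog :=
  .seq (setAcc 0 (.const 0)) (.loop 7 (.minus samples (.var 2)) (.seq
    (setAcc 1 (.get 6 (.plus (.var 2) (.var 7)) (.const 0))) (.seq
    (setAcc 2 (.get 6 (.plus (.var 2) (.var 7)) (.const 0))) (.seq
    (.loop 5 dim (.seq
      (setAcc 1 (.minus (acc 1) (.times (.get 5 (.plus (.var 2) (.var 7)) (.var 5))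
        (.get 23 (.const 0) (.var 5)))))
      (setAcc 2 (.minus (acc 2) (.times (.get 5 (.plus (.var 2) (.var 7)) (.var 5))
        (.get 23 (.const 1) (.var 5)))))))
    (.ite (.realLt (.times (acc 1) (acc 1)) (.times (acc 2) (acc 2)))
      (setAcc 0 (.plus (acc 0) (.times (acc 1) (acc 1))))
      (setAcc 0 (.plus (acc 0) (.times (acc 2) (acc 2)))))))))

/-- The comparison of the loss with Nσ√k, N being the size of the training half, squared because
there are no square roots. The flag is never reset, so it records the disjunction over all trials.
-/
def decision : Prog :=
  .ite (.realLt (.times (acc 0) (acc 0)) (.times (.times (.times (.ofNat (.var 2)) (.ofNat (.var 2)))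
    (.ofNat sparsity)) (.times noise noise))) (.setVar 1 (.const 1)) .skip

/-- Prepare the input of the recovery algorithm. -/
def prepare (N : ℕ) : Prog :=
  .seq ranks (.seq responses (.seq design (.seq (clear N) (.seq scalars copy))))

def trial (A : Prog) (N : ℕ) : Prog :=
  .seq (prepare N) (.seq (A.memo 20 10 10 11) (.seq residuals decision))

/-- Only one guess is right along the reduced parameters, but it depends on the arbitrary sequence
`a`, so a single program has to try them all. -/
def detector (A : Prog) (N : ℕ) : Prog :=
  .seq half (.seq predraw (.loop 3 (.plus (.var 0) (.const 1)) (trial A N)))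

/-! ### The quantities computed by the detector, as functions of the data and the tape -/

variable {P : Params} {X : Design P.n P.p} {y : Fin P.n → ℝ} {ω : ℕ → ℝ} {d : ℕ}

/-- The predrawn Gaussians. -/
def pre (P : Params) (ω : ℕ → ℝ) (q l : ℕ) : ℝ := ω (q * (P.p + P.p + 1) + l)

/-- The part of the tape that is left for the recovery algorithm. -/
def tail (P : Params) (ω : ℕ → ℝ) (j : ℕ) : ℝ := ω ((P.n + 2) * (P.p + P.p + 1) + j)

def rank (P : Params) (ω : ℕ → ℝ) (d j : ℕ) : ℕ :=
  ((Finset.range (P.p + d)).filter fun l => pre P ω P.n l < pre P ω P.n j).card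

def sgn (P : Params) (ω : ℕ → ℝ) (j : ℕ) : ℝ := if pre P ω (P.n + 1) j < 0 then -1 else 1

def entry (P : Params) (X : Design P.n P.p) (ω : ℕ → ℝ) (q : Fin P.n) (l : ℕ) : ℝ :=
  if h : l < P.p then X q ⟨l, h⟩ else pre P ω q (l - P.p)

/-- The parameters of the recovery problem if `d` coordinates are planted. -/
def guess (P : Params) (d : ℕ) : Params := ⟨P.p + d, (P.n + 1) / 2, P.k + d, P.σ, P.σ_pos⟩

/-- The augmented design, with signed and permuted columns. -/
def augX (P : Params) (X : Design P.n P.p) (ω : ℕ → ℝ) (d : ℕ) (q : Fin P.n) (j : ℕ) : ℝ :=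
  sgn P ω j * entry P X ω q (rank P ω d j)

/-- The augmented responses. -/
def augY (P : Params) (y : Fin P.n → ℝ) (ω : ℕ → ℝ) (d : ℕ) (q : Fin P.n) : ℝ :=
  P.σ * y q + ∑ l ∈ Finset.range d, pre P ω q l

theorem half_le (P : Params) : (P.n + 1) / 2 ≤ P.n := by omega

def train (P : Params) (d : ℕ) (q : Fin (guess P d).n) : Fin P.n := q.castLE (half_le P)

/-- The residual of a test sample with respect to an estimate. -/
def residual (P : Params) (X : Design P.n P.p) (y : Fin P.n → ℝ) (ω : ℕ → ℝ) (d : ℕ)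
    (b : Signal (guess P d).p) (q : Fin P.n) : ℝ :=
  augY P y ω d q - ∑ j : Fin (guess P d).p, augX P X ω d q j * b j

/-- The sum over the test sample of the smaller squared residual. -/
def loss (P : Params) (X : Design P.n P.p) (y : Fin P.n → ℝ) (ω : ℕ → ℝ) (d : ℕ)
    (b : Signal (guess P d).p × Signal (guess P d).p) : ℝ :=
  ∑ q : Fin P.n, if (P.n + 1) / 2 ≤ q then
    min (residual P X y ω d b.1 q ^ 2) (residual P X y ω d b.2 q ^ 2) else 0

/-- The test accepts an estimate as evidence for the planted law. -/
def Passes (P : Params) (X : Design P.n P.p) (y : Fin P.n → ℝ) (ω : ℕ → ℝ) (d : ℕ)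
    (b : Signal (guess P d).p × Signal (guess P d).p) : Prop :=
  loss P X y ω d b ^ 2 < (((P.n + 1) / 2 : ℕ) : ℝ) ^ 2 * P.k * P.σ ^ 2

/-- The initial memory of the recovery algorithm if `d` coordinates are planted. -/
def start (P : Params) (X : Design P.n P.p) (y : Fin P.n → ℝ) (ω : ℕ → ℝ) (d : ℕ) : RamState :=
  initState (guess P d) (fun q j => augX P X ω d (train P d q) j)
    (fun q => augY P y ω d (train P d q))

/-- What all parts of the detector rely on. -/
structure Data (P : Params) (X : Design P.n P.p) (y : Fin P.n → ℝ) (ω : ℕ → ℝ) (m : RamState) :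
    Prop where
  p_eq : m.nat 0 0 = P.p
  n_eq : m.nat 0 1 = P.n
  k_eq : m.nat 0 2 = P.k
  X_eq : ∀ (q : Fin P.n) (l : Fin P.p), m.real 0 q l = X q l
  y_eq : ∀ q : Fin P.n, m.real 1 q 0 = y q
  σ_eq : m.real 2 0 0 = P.σ
  half_eq : m.nat 2 0 = (P.n + 1) / 2
  pre_eq : ∀ q < P.n + 2, ∀ l < P.p + P.p + 1, m.real 4 q l = pre P ω q l

variable {m : RamState}

theorem Data.of_frame {S : Prog} {m' : RamState} (h : Data P X y ω m) (hF : S.Frame m m')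
    (h0 : 0 ∉ S.natWrites) (h2 : 2 ∉ S.natWrites) (h0' : 0 ∉ S.realWrites)
    (h1' : 1 ∉ S.realWrites) (h2' : 2 ∉ S.realWrites) (h4' : 4 ∉ S.realWrites) :
    Data P X y ω m' := by
  have e0 := hF.nat_eq 0 h0
  have e2 := hF.nat_eq 2 h2
  have e0' := hF.real_eq 0 h0'
  have e1' := hF.real_eq 1 h1'
  have e2' := hF.real_eq 2 h2'
  have e4' := hF.real_eq 4 h4'
  constructor
  · rw [e0]; exact h.p_eq
  · rw [e0]; exact h.n_eq
  · rw [e0]; exact h.k_eq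
  · rw [e0']; exact h.X_eq
  · rw [e1']; exact h.y_eq
  · rw [e2']; exact h.σ_eq
  · rw [e2]; exact h.half_eq
  · rw [e4']; exact h.pre_eq

/-! ### Correctness and time of the preliminary phases -/

theorem half_run (hn : m.nat 0 1 = P.n) (h2 : m.nat 2 0 = 0) :
    HaltsWith ω half m (P.n * (2 + 2) + 2) fun m' => m'.nat 2 0 = (P.n + 1) / 2 := by
  -- The variable grows as long as its double is below `n`, so it follows the counter up to half of
  -- `n` and stays there.
  refine (HaltsWith.loop P.n 2 (fun i m' => m'.nat 2 0 = min i ((P.n + 1) / 2)) (by decide)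
    (fun m' hF => ?_) ?_ (fun i hi m' hF hci hI => ?_)).mono le_rfl fun m' _ h => ?_
  · simpa only [NExpr.eval, hF.nat_eq 0 (by decide)] using hn
  · simpa [RamState.writeNat] using h2
  · have hn' : m'.nat 0 1 = P.n := by rw [hF.nat_eq 0 (by decide), hn]
    refine HaltsWith.ite (fun hb => HaltsWith.setNat ?_) (fun hb => HaltsWith.skip ?_)
    all_goals
      simp [RamState.writeNat, NExpr.eval, Test.Holds, hI, hn'] at hb ⊢
      omega
  · simp only [h]; omega

theorem predraw_run (hp : m.nat 0 0 = P.p) (hn : m.nat 0 1 = P.n) (hd : m.drawn = 0) :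
    HaltsWith ω predraw m ((P.n + 2) * (((P.p + P.p + 1) * (1 + 2) + 2) + 2) + 2) fun m' =>
      (∀ q < P.n + 2, ∀ l < P.p + P.p + 1, m'.real 4 q l = pre P ω q l) ∧
      m'.drawn = (P.n + 2) * (P.p + P.p + 1) := by
  refine (HaltsWith.loop (P.n + 2) _ (fun i m' =>
    (∀ q < i, ∀ l < P.p + P.p + 1, m'.real 4 q l = pre P ω q l) ∧
      m'.drawn = i * (P.p + P.p + 1)) (by decide)
    (fun m' hF => ?_) ?_ (fun i hi m' hF hci hI => ?_)).mono le_rfl fun m' _ h => h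
  · simp only [NExpr.eval, hF.nat_eq 0 (by decide), hn]
  · simp [RamState.writeNat, hd]
  refine (HaltsWith.loop (P.p + P.p + 1) 1 (fun j m'' =>
    (∀ q < i, ∀ l < P.p + P.p + 1, m''.real 4 q l = pre P ω q l) ∧
    (∀ l < j, m''.real 4 i l = pre P ω i l) ∧
      m''.drawn = i * (P.p + P.p + 1) + j) (by decide)
    (fun m'' hF' => ?_) ?_ (fun j hj m'' hF' hcj hJ => ?_)).mono le_rfl fun m'' _ h => ?_
  · simp only [NExpr.eval, hF'.nat_eq 0 (by decide), hF.nat_eq 0 (by decide), hp]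
  · exact ⟨hI.1, by simp, hI.2⟩
  · have h7 : m''.nat 7 0 = i := by rw [hF'.nat_eq 7 (by decide), hci]
    refine HaltsWith.gauss ⟨fun q hq l hl => ?_, fun l hl => ?_, ?_⟩
    · simp only [RamState.writeNat, RamState.writeReal, NExpr.eval, h7, Function.update_self]
      rw [Function.update_of_ne (by omega)]
      exact hJ.1 q hq l hl
    · simp only [RamState.writeNat, RamState.writeReal, NExpr.eval, h7, hcj,
        Function.update_self]
      by_cases hlj : l = j
      · subst hlj; rw [Function.update_self, hJ.2.2, pre]
      · rw [Function.update_of_ne hlj]; exact hJ.2.1 l (by omega)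
    · simp only [RamState.writeNat, hJ.2.2]; omega
  · refine ⟨fun q hq l hl => ?_, ?_⟩
    · by_cases hqi : q = i
      · subst hqi; exact h.2.1 l hl
      · exact h.1 q (by omega) l hl
    · simp only [RamState.writeNat, h.2.2]; ring

theorem ranks_run (h : Data P X y ω m) (h3 : m.nat 3 0 = d) (hd : d ≤ P.p) :
    HaltsWith ω ranks m ((P.p + d) * ((1 + ((P.p + d) * (2 + 2) + 2)) + 2) + 2) fun m' =>
      ∀ j < P.p + d, m'.nat 8 j = rank P ω d j := by
  refine (HaltsWith.loop (P.p + d) _ (fun i m' => ∀ j < i, m'.nat 8 j = rank P ω d j) (by decide)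
    (fun m' hF => ?_) (by simp) (fun i hi m' hF hci hI => ?_)).mono le_rfl fun m' _ h => h
  · simp only [NExpr.eval, hF.nat_eq 0 (by decide), hF.nat_eq 3 (by decide), h.p_eq, h3]
  have hD := h.of_frame hF (by decide) (by decide) (by decide) (by decide) (by decide) (by decide)
  have h3' : m'.nat 3 0 = d := by rw [hF.nat_eq 3 (by decide), h3]
  refine HaltsWith.seq (HaltsWith.setNat (Q := fun m'' => m''.nat 8 i = 0 ∧
    ∀ j < i, m''.nat 8 j = rank P ω d j) ?_) fun m₁ hF₁ hQ => ?_
  · simp only [RamState.writeNat, NExpr.eval, hci, Function.update_self, true_and]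
    intro j hj
    rw [Function.update_of_ne (by omega)]
    exact hI j hj
  have hD₁ := hD.of_frame hF₁ (by decide) (by decide) (by decide) (by decide) (by decide)
    (by decide)
  have h3₁ : m₁.nat 3 0 = d := by rw [hF₁.nat_eq 3 (by decide), h3']
  have h5₁ : m₁.nat 5 0 = i := by rw [hF₁.nat_eq 5 (by decide), hci]
  refine (HaltsWith.loop (P.p + d) 2 (fun l m'' =>
    m''.nat 8 i = ((Finset.range l).filter fun l => pre P ω P.n l < pre P ω P.n i).card ∧
    ∀ j < i, m''.nat 8 j = rank P ω d j) (by decide)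
    (fun m'' hF' => ?_) ?_ (fun l hl m'' hF' hcl hJ => ?_)).mono le_rfl fun m'' _ h => ?_
  · simp only [NExpr.eval, hF'.nat_eq 0 (by decide), hF'.nat_eq 3 (by decide), hD₁.p_eq, h3₁]
  · simpa [RamState.writeNat] using hQ
  · have hD₂ := hD₁.of_frame hF' (by decide) (by decide) (by decide) (by decide) (by decide)
      (by decide)
    have h5₂ : m''.nat 5 0 = i := by rw [hF'.nat_eq 5 (by decide), h5₁]
    have hb : (Test.realLt (.get 4 samples (.var 6)) (.get 4 samples (.var 5))).Holds m'' ↔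
        pre P ω P.n l < pre P ω P.n i := by
      simp only [Test.Holds, RExpr.eval, NExpr.eval, hD₂.n_eq, hcl, h5₂]
      rw [hD₂.pre_eq _ (by omega) _ (by omega), hD₂.pre_eq _ (by omega) _ (by omega)]
    refine HaltsWith.ite (fun hb' => HaltsWith.setNat ?_) (fun hb' => HaltsWith.skip ?_)
    · rw [hb] at hb'
      simp only [RamState.writeNat, NExpr.eval, h5₂]
      rw [Function.update_of_ne (by decide), Function.update_self, Function.update_self,
        Finset.range_add_one, Finset.filter_insert, if_pos hb',
        Finset.card_insert_of_notMem (by simp), hJ.1]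
      refine ⟨rfl, fun j hj => ?_⟩
      rw [Function.update_of_ne (by omega)]
      exact hJ.2 j hj
    · rw [hb] at hb'
      simp only [RamState.writeNat]
      rw [Function.update_of_ne (by decide), Finset.range_add_one, Finset.filter_insert,
        if_neg hb']
      exact hJ
  · intro j hj
    simp only [RamState.writeNat]
    rw [Function.update_of_ne (by decide)]
    by_cases hji : j = i
    · subst hji; exact h.1
    · exact h.2 j (by omega)

end Detector

end

noncomputable section

namespace Detector

variable {P : Params} {X : Design P.n P.p} {y : Fin P.n → ℝ} {ω : ℕ → ℝ} {d : ℕ} {m : RamState}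

/-! ### Correctness and time of the preparation of one trial -/

theorem rank_lt {j : ℕ} (hj : j < P.p + d) : rank P ω d j < P.p + d := by
  have h : (Finset.range (P.p + d)).filter (fun l => pre P ω P.n l < pre P ω P.n j) ⊂
      Finset.range (P.p + d) :=
    (Finset.filter_ssubset).2 ⟨j, Finset.mem_range.2 hj, lt_irrefl _⟩
  exact (Finset.card_lt_card h).trans_eq (Finset.card_range _)

theorem responses_run (h : Data P X y ω m) (h3 : m.nat 3 0 = d) (hd : d ≤ P.p) :
    HaltsWith ω responses m (P.n * ((1 + (d * (1 + 2) + 2)) + 2) + 2) fun m' =>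
      ∀ q : Fin P.n, m'.real 6 q 0 = augY P y ω d q := by
  refine (HaltsWith.loop P.n _ (fun i m' => ∀ q : Fin P.n, (q : ℕ) < i →
    m'.real 6 q 0 = augY P y ω d q) (by decide)
    (fun m' hF => ?_) (by simp) (fun i hi m' hF hci hI => ?_)).mono le_rfl
    fun m' _ h q => h q q.2
  · simp only [NExpr.eval, hF.nat_eq 0 (by decide), h.n_eq]
  have hD := h.of_frame hF (by decide) (by decide) (by decide) (by decide) (by decide) (by decide)
  have h3' : m'.nat 3 0 = d := by rw [hF.nat_eq 3 (by decide), h3]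
  refine HaltsWith.seq (HaltsWith.setReal (Q := fun m'' => m''.real 6 i 0 = P.σ * y ⟨i, hi⟩ ∧
    ∀ q : Fin P.n, (q : ℕ) < i → m''.real 6 q 0 = augY P y ω d q) ?_) fun m₁ hF₁ hQ => ?_
  · have := hD.y_eq ⟨i, hi⟩
    simp only [RamState.writeReal, NExpr.eval, RExpr.eval, hci, hD.σ_eq,
      Function.update_self] at this ⊢
    refine ⟨by rw [this], fun q hq => ?_⟩
    rw [Function.update_of_ne (by omega)]
    exact hI q hq
  have hD₁ := hD.of_frame hF₁ (by decide) (by decide) (by decide) (by decide) (by decide)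
    (by decide)
  have h3₁ : m₁.nat 3 0 = d := by rw [hF₁.nat_eq 3 (by decide), h3']
  have h7₁ : m₁.nat 7 0 = i := by rw [hF₁.nat_eq 7 (by decide), hci]
  refine (HaltsWith.loop d 1 (fun l m'' =>
    m''.real 6 i 0 = P.σ * y ⟨i, hi⟩ + ∑ l ∈ Finset.range l, pre P ω i l ∧
    ∀ q : Fin P.n, (q : ℕ) < i → m''.real 6 q 0 = augY P y ω d q) (by decide)
    (fun m'' hF' => ?_) ?_ (fun l hl m'' hF' hcl hJ => ?_)).mono le_rfl fun m'' _ h => ?_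
  · simp only [NExpr.eval, hF'.nat_eq 3 (by decide), h3₁]
  · simpa [RamState.writeNat] using hQ
  · have hD₂ := hD₁.of_frame hF' (by decide) (by decide) (by decide) (by decide) (by decide)
      (by decide)
    have h7₂ : m''.nat 7 0 = i := by rw [hF'.nat_eq 7 (by decide), h7₁]
    refine HaltsWith.setReal ?_
    simp only [RamState.writeReal, RamState.writeNat, NExpr.eval, RExpr.eval, h7₂, hcl,
      Function.update_self]
    refine ⟨?_, fun q hq => ?_⟩
    · rw [hJ.1, hD₂.pre_eq _ (by omega) _ (by omega), Finset.sum_range_succ, add_assoc]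
    · rw [Function.update_of_ne (by omega)]
      exact hJ.2 q hq
  · intro q hq
    simp only [RamState.writeNat]
    by_cases hqi : (q : ℕ) = i
    · subst hqi; exact h.1
    · exact h.2 q (by omega)

theorem design_run (h : Data P X y ω m) (h3 : m.nat 3 0 = d) (hd : d ≤ P.p)
    (h8 : ∀ j < P.p + d, m.nat 8 j = rank P ω d j) :
    HaltsWith ω design m (P.n * (((P.p + d) * (2 + 2 + 2) + 2) + 2) + 2) fun m' =>
      ∀ q : Fin P.n, ∀ j < P.p + d, m'.real 5 q j = augX P X ω d q j := by
  refine (HaltsWith.loop P.n _ (fun i m' => ∀ q : Fin P.n, (q : ℕ) < i → ∀ j < P.p + d,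
    m'.real 5 q j = augX P X ω d q j) (by decide)
    (fun m' hF => ?_) (by simp) (fun i hi m' hF hci hI => ?_)).mono le_rfl
    fun m' _ h q => h q q.2
  · simp only [NExpr.eval, hF.nat_eq 0 (by decide), h.n_eq]
  refine (HaltsWith.loop (P.p + d) _ (fun k m'' =>
    (∀ j < k, m''.real 5 i j = augX P X ω d ⟨i, hi⟩ j) ∧
    ∀ q : Fin P.n, (q : ℕ) < i → ∀ j < P.p + d, m''.real 5 q j = augX P X ω d q j) (by decide)
    (fun m'' hF' => ?_) ⟨by simp, hI⟩ (fun j hj m'' hF' hcj hJ => ?_)).mono le_rfl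
    fun m'' _ h => ?_
  · simp only [NExpr.eval, hF'.nat_eq 0 (by decide), hF.nat_eq 0 (by decide),
      hF'.nat_eq 3 (by decide), hF.nat_eq 3 (by decide), h.p_eq, h3]
  · have hD := (h.of_frame hF (by decide) (by decide) (by decide) (by decide) (by decide)
      (by decide)).of_frame hF' (by decide) (by decide) (by decide) (by decide) (by decide)
      (by decide)
    have h7 : m''.nat 7 0 = i := by rw [hF'.nat_eq 7 (by decide), hci]
    have h8' : m''.nat 8 j = rank P ω d j := by
      rw [hF'.nat_eq 8 (by decide), hF.nat_eq 8 (by decide), h8 j hj]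
    have hr := rank_lt (ω := ω) hj
    -- A write at `(i, j)` preserves the finished rows and the finished part of row `i`; needed for
    -- both sources of the entry and for the sign change.
    have hw : ∀ m₁ : RamState, ∀ r : ℝ, m₁.nat 7 0 = i → m₁.nat 5 0 = j →
        ((∀ l < j, m₁.real 5 i l = augX P X ω d ⟨i, hi⟩ l) ∧
        ∀ q : Fin P.n, (q : ℕ) < i → ∀ j < P.p + d, m₁.real 5 q j = augX P X ω d q j) →
        (∀ l < j, (m₁.writeReal 5 i j r).real 5 i l = augX P X ω d ⟨i, hi⟩ l) ∧
        ∀ q : Fin P.n, (q : ℕ) < i → ∀ l < P.p + d,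
          (m₁.writeReal 5 i j r).real 5 q l = augX P X ω d q l := by
      intro m₁ r _ _ hJ
      simp only [RamState.writeReal, Function.update_self]
      refine ⟨fun l hl => ?_, fun q hq l hl => ?_⟩
      · rw [Function.update_of_ne (by omega)]; exact hJ.1 l hl
      · rw [Function.update_of_ne (by omega)]; exact hJ.2 q hq l hl
    refine HaltsWith.seq (Q := fun m₁ => m₁.real 5 i j = entry P X ω ⟨i, hi⟩ (rank P ω d j) ∧
      (∀ l < j, m₁.real 5 i l = augX P X ω d ⟨i, hi⟩ l) ∧
        ∀ q : Fin P.n, (q : ℕ) < i → ∀ j < P.p + d, m₁.real 5 q j = augX P X ω d q j)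
      (HaltsWith.ite (fun hb => HaltsWith.setReal ?_) (fun hb => HaltsWith.setReal ?_))
      fun m₁ hF₁ hQ => ?_
    · simp only [Test.Holds, NExpr.eval, hcj, h8', hD.p_eq] at hb
      simp only [NExpr.eval, RExpr.eval, hcj, h8', h7]
      refine ⟨?_, hw _ _ h7 hcj hJ⟩
      simp only [RamState.writeReal, Function.update_self, entry, hb, dif_pos]
      exact hD.X_eq ⟨i, hi⟩ ⟨_, hb⟩
    · simp only [Test.Holds, NExpr.eval, hcj, h8', hD.p_eq] at hb
      simp only [NExpr.eval, RExpr.eval, hcj, h8', h7, hD.p_eq]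
      refine ⟨?_, hw _ _ h7 hcj hJ⟩
      simp only [RamState.writeReal, Function.update_self, entry, hb, dif_neg,
        not_false_eq_true]
      exact hD.pre_eq _ (by omega) _ (by omega)
    · have h7₁ : m₁.nat 7 0 = i := by rw [hF₁.nat_eq 7 (by decide), h7]
      have h5₁ : m₁.nat 5 0 = j := by rw [hF₁.nat_eq 5 (by decide), hcj]
      have hD₁ := hD.of_frame hF₁ (by decide) (by decide) (by decide) (by decide) (by decide)
        (by decide)
      have hb : (Test.realLt (.get 4 (.plus samples (.const 1)) (.var 5)) (.const 0)).Holds m₁ ↔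
          pre P ω (P.n + 1) j < 0 := by
        simp only [Test.Holds, RExpr.eval, NExpr.eval, hD₁.n_eq, h5₁]
        rw [hD₁.pre_eq _ (by omega) _ (by omega)]
        simp
      have hJ' : ∀ m₂ : RamState, m₂.real 5 i j = augX P X ω d ⟨i, hi⟩ j →
          ((∀ l < j, m₂.real 5 i l = augX P X ω d ⟨i, hi⟩ l) ∧
          ∀ q : Fin P.n, (q : ℕ) < i → ∀ j < P.p + d, m₂.real 5 q j = augX P X ω d q j) →
          (∀ l < j + 1, m₂.real 5 i l = augX P X ω d ⟨i, hi⟩ l) ∧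
          ∀ q : Fin P.n, (q : ℕ) < i → ∀ j < P.p + d, m₂.real 5 q j = augX P X ω d q j := by
        refine fun m₂ h₁ h₂ => ⟨fun l hl => ?_, h₂.2⟩
        by_cases hlj : l = j
        · subst hlj; exact h₁
        · exact h₂.1 l (by omega)
      refine HaltsWith.ite (fun hb' => HaltsWith.setReal (hJ' (RamState.writeNat _ _ _ _) ?_ ?_))
        (fun hb' => HaltsWith.skip (hJ' (RamState.writeNat _ _ _ _) ?_ ?_))
      · rw [hb] at hb'
        simp only [RamState.writeNat, RamState.writeReal, NExpr.eval, RExpr.eval, h7₁, h5₁,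
          Function.update_self, hQ.1, augX, sgn, hb', if_true]
        simp
      · simp only [NExpr.eval, RExpr.eval, h7₁, h5₁]
        exact hw _ _ h7₁ h5₁ hQ.2
      · rw [hb] at hb'
        simp only [RamState.writeNat, hQ.1, augX, sgn, hb', if_false, one_mul]
      · exact hQ.2
  · intro q hq
    by_cases hqi : (q : ℕ) = i
    · subst hqi; exact h.1
    · exact h.2 q (by omega)

theorem clear_run (N : ℕ) (m : RamState) : HaltsWith ω (clear N) m (2 * N + 1) fun m' =>
    (∀ u < N, m'.nat (u + 20) = fun _ => 0) ∧ ∀ u < N, m'.real (u + 20) = fun _ _ => 0 := by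
  induction N with
  | zero => exact HaltsWith.skip (by simp)
  | succ N ih =>
    refine (HaltsWith.seq ih fun m' _ hQ => HaltsWith.seq (HaltsWith.clearNat
      (Q := fun m' => (∀ u < N + 1, m'.nat (u + 20) = fun _ => 0) ∧
        ∀ u < N, m'.real (u + 20) = fun _ _ => 0) ⟨fun u hu => ?_, hQ.2⟩) fun m'' _ hQ' =>
      HaltsWith.clearReal ⟨hQ'.1, fun u hu => ?_⟩).mono (by omega) fun _ _ h => h
    · by_cases h : u = N
      · subst h; simp
      · simp only [Function.update_of_ne (show u + 20 ≠ N + 20 by omega)]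
        exact hQ.1 u (by omega)
    · by_cases h : u = N
      · subst h; simp
      · simp only [Function.update_of_ne (show u + 20 ≠ N + 20 by omega)]
        exact hQ'.2 u (by omega)

theorem mem_natWrites_clear {N u : ℕ} (hu : u ∈ (clear N).natWrites) : 20 ≤ u ∧ u < N + 20 := by
  induction N with
  | zero => simp [clear, Prog.natWrites] at hu
  | succ N ih =>
    simp only [clear, Prog.natWrites, Finset.mem_union, Finset.mem_singleton,
      Finset.notMem_empty, or_false] at hu
    rcases hu with hu | rfl
    · have := ih hu; omega
    · omega

theorem mem_realWrites_clear {N u : ℕ} (hu : u ∈ (clear N).realWrites) : 20 ≤ u ∧ u < N + 20 := by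
  induction N with
  | zero => simp [clear, Prog.realWrites] at hu
  | succ N ih =>
    simp only [clear, Prog.realWrites, Finset.mem_union, Finset.mem_singleton,
      Finset.notMem_empty, false_or] at hu
    rcases hu with hu | rfl
    · have := ih hu; omega
    · omega

theorem drawFree_clear (N : ℕ) : (clear N).drawFree = true := by
  induction N with
  | zero => rfl
  | succ N ih => simp [clear, Prog.drawFree, ih]

theorem scalars_run (h : Data P X y ω m) (h3 : m.nat 3 0 = d)
    (hn : ∀ u, m.nat (u + 20) = fun _ => 0) (hr : ∀ u, m.real (u + 20) = fun _ _ => 0) :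
    HaltsWith ω scalars m 5 fun m' =>
      (∀ u, m'.nat (u + 20) = (start P X y ω d).nat u) ∧
      (∀ u, m'.real (u + 20) = if u = 2 then (start P X y ω d).real 2 else fun _ _ => 0) ∧
      m'.nat 10 0 = 0 := by
  refine ⟨5, _, le_rfl, .seq (s := 1) (t := 4) (.setNat _ _ _ _) (.seq (s := 1) (t := 3)
    (.setNat _ _ _ _) (.seq (s := 1) (t := 2) (.setNat _ _ _ _)
    (.seq (s := 1) (t := 1) (.setReal _ _ _ _ _) (.setNat _ _ _ _)))), fun u => ?_, fun u => ?_, ?_⟩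
  · simp only [RamState.writeNat, RamState.writeReal, NExpr.eval, RExpr.eval]
    rw [Function.update_of_ne (by omega)]
    by_cases hu : u = 0
    · subst hu
      funext x
      have h0 := hn 0
      simp only [zero_add] at h0
      simp only [zero_add, Function.update_self, Function.update_of_ne (show 3 ≠ 20 by decide),
        Function.update_of_ne (show 2 ≠ 20 by decide),
        Function.update_of_ne (show 0 ≠ 20 by decide), Function.update_apply, h0, h.p_eq, h3,
        h.half_eq, h.k_eq, start, initState, guess, if_true]
      split_ifs <;> simp_all
    · simp only [Function.update_of_ne (show u + 20 ≠ 20 by omega), hn]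
      funext x
      simp [start, initState, hu]
  · simp only [RamState.writeNat, RamState.writeReal, NExpr.eval, RExpr.eval, h.σ_eq]
    by_cases hu : u = 2
    · subst hu
      funext x j
      have h0 := hr 2
      simp only [Nat.reduceAdd] at h0
      simp only [Nat.reduceAdd, Function.update_self, if_true, Function.update_apply, h0,
        start, initState, guess, OfNat.ofNat_ne_zero, OfNat.ofNat_ne_one, if_false]
      by_cases hx : x = 0 <;> by_cases hj : j = 0 <;> simp [hx, hj]
    · rw [if_neg hu, Function.update_of_ne (by omega), hr]
  · simp [RamState.writeNat, NExpr.eval]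

theorem start_real_zero {x j : ℕ} (hx : x < (P.n + 1) / 2) (hj : j < P.p + d) :
    (start P X y ω d).real 0 x j = augX P X ω d ⟨x, hx.trans_le (half_le P)⟩ j := by
  have : x < (guess P d).n ∧ j < (guess P d).p := ⟨hx, hj⟩
  simp [start, initState, this, train]
  rfl

theorem start_real_zero_of_not {x j : ℕ} (h : ¬ (x < (P.n + 1) / 2 ∧ j < P.p + d)) :
    (start P X y ω d).real 0 x j = 0 := by
  have : ¬ (x < (guess P d).n ∧ j < (guess P d).p) := h
  simp [start, initState, this]

theorem start_real_one {x : ℕ} (hx : x < (P.n + 1) / 2) :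
    (start P X y ω d).real 1 x 0 = augY P y ω d ⟨x, hx.trans_le (half_le P)⟩ := by
  have : x < (guess P d).n := hx
  simp [start, initState, this, train]
  rfl

theorem start_real_one_of_not {x j : ℕ} (h : ¬ (x < (P.n + 1) / 2 ∧ j = 0)) :
    (start P X y ω d).real 1 x j = 0 := by
  have : ¬ (x < (guess P d).n ∧ j = 0) := h
  simp [start, initState, this]

/-- The recovery algorithm is only controlled on genuine initial memories, so its arrays have to
agree with `start` at all indices. Outside the data range both sides vanish, the machine's side
because the arrays have been cleared. -/
theorem copy_run (h : Data P X y ω m) (h3 : m.nat 3 0 = d)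
    (h5 : ∀ q : Fin P.n, ∀ j < P.p + d, m.real 5 q j = augX P X ω d q j)
    (h6 : ∀ q : Fin P.n, m.real 6 q 0 = augY P y ω d q)
    (hr : ∀ u, m.real (u + 20) = if u = 2 then (start P X y ω d).real 2 else fun _ _ => 0) :
    HaltsWith ω copy m ((P.n + 1) / 2 * ((1 + ((P.p + d) * (1 + 2) + 2)) + 2) + 2) fun m' =>
      ∀ u, m'.real (u + 20) = (start P X y ω d).real u := by
  refine (HaltsWith.loop ((P.n + 1) / 2) _ (fun i m' =>
    (∀ x j, m'.real 20 x j = if x < i then (start P X y ω d).real 0 x j else 0) ∧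
    ∀ x j, m'.real 21 x j = if x < i then (start P X y ω d).real 1 x j else 0) (by decide)
    (fun m' hF => ?_) ?_ (fun i hi m' hF hci hI => ?_)).mono le_rfl fun m' hF h u => ?_
  · simp only [NExpr.eval, hF.nat_eq 2 (by decide), h.half_eq]
  · refine ⟨fun x j => ?_, fun x j => ?_⟩
    · have := hr 0; simp at this; simp [RamState.writeNat, this]
    · have := hr 1; simp at this; simp [RamState.writeNat, this]
  · have hin : i < P.n := hi.trans_le (half_le P)
    have h6' := h6 ⟨i, hin⟩
    rw [← hF.real_eq 6 (by decide)] at h6'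
    refine HaltsWith.seq (Q := fun m₁ =>
      (∀ x j, m₁.real 20 x j = if x < i then (start P X y ω d).real 0 x j else 0) ∧
      ∀ x j, m₁.real 21 x j = if x < i + 1 then (start P X y ω d).real 1 x j else 0)
      (HaltsWith.setReal ⟨hI.1, fun x j => ?_⟩) fun m₁ hF₁ hQ => ?_
    · simp only [RamState.writeReal, NExpr.eval, RExpr.eval, hci, Function.update_self]
      by_cases hx : x = i
      · subst hx
        rw [Function.update_self, if_pos (by omega)]
        by_cases hj : j = 0
        · subst hj; rw [Function.update_self, h6', start_real_one hi]
        · rw [Function.update_of_ne hj, hI.2, if_neg (lt_irrefl _),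
            start_real_one_of_not (by tauto)]
      · rw [Function.update_of_ne hx, hI.2]
        congr 1
        simp only [eq_iff_iff]; omega
    · have h7₁ : m₁.nat 7 0 = i := by rw [hF₁.nat_eq 7 (by decide), hci]
      refine (HaltsWith.loop (P.p + d) 1 (fun k m'' =>
        (∀ x j, m''.real 20 x j =
          if x < i ∨ (x = i ∧ j < k) then (start P X y ω d).real 0 x j else 0) ∧
        ∀ x j, m''.real 21 x j = if x < i + 1 then (start P X y ω d).real 1 x j else 0)
        (by decide) (fun m'' hF' => ?_) ⟨?_, hQ.2⟩ (fun j hj m'' hF' hcj hJ => ?_)).mono le_rfl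
        fun m'' _ h => ⟨fun x j => ?_, h.2⟩
      · simp only [NExpr.eval, hF'.nat_eq 0 (by decide), hF₁.nat_eq 0 (by decide),
          hF.nat_eq 0 (by decide), hF'.nat_eq 3 (by decide), hF₁.nat_eq 3 (by decide),
          hF.nat_eq 3 (by decide), h.p_eq, h3]
      · simpa [RamState.writeNat] using hQ.1
      · have h7 : m''.nat 7 0 = i := by rw [hF'.nat_eq 7 (by decide), h7₁]
        have h5' := h5 ⟨i, hin⟩ j hj
        rw [← hF.real_eq 5 (by decide), ← hF₁.real_eq 5 (by decide),
          ← hF'.real_eq 5 (by decide)] at h5'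
        refine HaltsWith.setReal ⟨fun x l => ?_, hJ.2⟩
        simp only [RamState.writeNat, RamState.writeReal, NExpr.eval, RExpr.eval, h7, hcj,
          Function.update_self]
        by_cases hx : x = i
        · subst hx
          rw [Function.update_self]
          by_cases hl : l = j
          · subst hl
            rw [Function.update_self, h5', if_pos (.inr ⟨rfl, Nat.lt_succ_self _⟩),
              start_real_zero hi hj]
          · rw [Function.update_of_ne hl, hJ.1]
            congr 1
            simp only [lt_irrefl, false_or, true_and, eq_iff_iff]; omega
        · rw [Function.update_of_ne hx, hJ.1]
          congr 1
          simp only [eq_iff_iff]; omega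
      · have := h.1 x j
        simp only [RamState.writeNat, this]
        by_cases hx : x < i
        · rw [if_pos (.inl hx), if_pos (by omega)]
        · by_cases hxi : x = i
          · subst hxi
            rw [if_pos (show x < x + 1 by omega)]
            by_cases hj : j < P.p + d
            · rw [if_pos (.inr ⟨rfl, hj⟩)]
            · rw [if_neg (by tauto), start_real_zero_of_not (by tauto)]
          · rw [if_neg (by tauto), if_neg (by omega)]
  · by_cases h0 : u = 0
    · subst h0
      funext x j
      rw [zero_add, h.1]
      split_ifs with hx
      · rfl
      · rw [start_real_zero_of_not (by tauto)]
    by_cases h1 : u = 1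
    · subst h1
      funext x j
      rw [show 1 + 20 = 21 from rfl, h.2]
      split_ifs with hx
      · rfl
      · rw [start_real_one_of_not (by tauto)]
    rw [hF.real_eq (u + 20) (by
      simp [Prog.loop, Prog.realWrites]; omega), hr]
    split_ifs with h2
    · rw [h2]
    · funext x j
      simp [start, initState, h0, h1, h2]

end Detector

end

noncomputable section

/-! ### The test on the held-out samples -/

namespace Detector

variable {P : Params} {X : Design P.n P.p} {y : Fin P.n → ℝ} {ω : ℕ → ℝ} {d : ℕ} {m : RamState}

/-- The residual for an estimate that is given by a function on the natural numbers. -/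
def partialResidual (P : Params) (X : Design P.n P.p) (y : Fin P.n → ℝ) (ω : ℕ → ℝ) (d : ℕ)
    (b : ℕ → ℝ) (q : Fin P.n) (k : ℕ) : ℝ :=
  augY P y ω d q - ∑ j ∈ Finset.range k, augX P X ω d q j * b j

def testTerm (P : Params) (X : Design P.n P.p) (y : Fin P.n → ℝ) (ω : ℕ → ℝ) (d : ℕ)
    (b b' : ℕ → ℝ) (q : ℕ) : ℝ :=
  if h : q < P.n then min (partialResidual P X y ω d b ⟨q, h⟩ (P.p + d) ^ 2)
    (partialResidual P X y ω d b' ⟨q, h⟩ (P.p + d) ^ 2) else 0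

theorem sum_testTerm (b b' : ℕ → ℝ) :
    ∑ i ∈ Finset.range (P.n - (P.n + 1) / 2), testTerm P X y ω d b b' ((P.n + 1) / 2 + i) =
      loss P X y ω d (fun j => b j, fun j => b' j) := by
  have h1 : loss P X y ω d (fun j => b j, fun j => b' j) = ∑ q : Fin P.n,
      (fun q : ℕ => if (P.n + 1) / 2 ≤ q then testTerm P X y ω d b b' q else 0) q := by
    refine Finset.sum_congr rfl fun q _ => ?_
    simp only [testTerm, q.2, dif_pos, residual, partialResidual]
    rw [Fin.sum_univ_eq_sum_range (fun j => augX P X ω d q j * b j) (guess P d).p,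
      Fin.sum_univ_eq_sum_range (fun j => augX P X ω d q j * b' j) (guess P d).p]
    rfl
  rw [h1, Fin.sum_univ_eq_sum_range
    (fun q : ℕ => if (P.n + 1) / 2 ≤ q then testTerm P X y ω d b b' q else 0) P.n]
  have h2 : Finset.range P.n = Finset.range ((P.n + 1) / 2 + (P.n - (P.n + 1) / 2)) := by
    rw [Nat.add_sub_of_le (half_le P)]
  rw [h2, Finset.sum_range_add]
  -- The training samples contribute nothing to the loss.
  conv_rhs => rw [Finset.sum_eq_zero (s := Finset.range ((P.n + 1) / 2)) fun i hi => by
    rw [if_neg (by have := Finset.mem_range.1 hi; omega)], zero_add]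
  exact Finset.sum_congr rfl fun i _ => by rw [if_pos (by omega)]

theorem residuals_run (h : Data P X y ω m) (h3 : m.nat 3 0 = d)
    (h5 : ∀ q : Fin P.n, ∀ j < P.p + d, m.real 5 q j = augX P X ω d q j)
    (h6 : ∀ q : Fin P.n, m.real 6 q 0 = augY P y ω d q) :
    HaltsWith ω residuals m
      (1 + ((P.n - (P.n + 1) / 2) * (1 + (1 + (((P.p + d) * (1 + 1 + 2) + 2) + (1 + 1))) + 2) + 2))
      fun m' => m'.real 7 0 0 = loss P X y ω d (fun j => m.real 23 0 j, fun j => m.real 23 1 j) := by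
  refine HaltsWith.seq (HaltsWith.setReal (Q := fun m' => m'.real 7 0 0 = 0)
    (by simp [RamState.writeReal, NExpr.eval, RExpr.eval])) fun m₀ hF₀ hQ₀ => ?_
  refine (HaltsWith.loop (P.n - (P.n + 1) / 2) _ (fun i m' => m'.real 7 0 0 =
    ∑ i ∈ Finset.range i, testTerm P X y ω d (m.real 23 0) (m.real 23 1) ((P.n + 1) / 2 + i))
    (by decide) (fun m' hF => ?_) (by simpa [RamState.writeNat] using hQ₀)
    (fun i hi m' hF hci hI => ?_)).mono le_rfl
    fun m' _ h => h.trans (sum_testTerm _ _)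
  · simp only [NExpr.eval, hF.nat_eq 0 (by decide), hF.nat_eq 2 (by decide),
      hF₀.nat_eq 0 (by decide), hF₀.nat_eq 2 (by decide), h.n_eq, h.half_eq]
  have hin : (P.n + 1) / 2 + i < P.n := by omega
  set q : Fin P.n := ⟨(P.n + 1) / 2 + i, hin⟩ with hq
  have h0 : m'.nat 0 = m.nat 0 := by
    rw [hF.nat_eq 0 (by decide), hF₀.nat_eq 0 (by decide)]
  have h2 : m'.nat 2 0 = (P.n + 1) / 2 := by
    rw [hF.nat_eq 2 (by decide), hF₀.nat_eq 2 (by decide), h.half_eq]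
  have h3' : m'.nat 3 0 = d := by
    rw [hF.nat_eq 3 (by decide), hF₀.nat_eq 3 (by decide), h3]
  have h5' : m'.real 5 = m.real 5 := by
    rw [hF.real_eq 5 (by decide), hF₀.real_eq 5 (by decide)]
  have h6' : m'.real 6 q 0 = augY P y ω d q := by
    rw [hF.real_eq 6 (by decide), hF₀.real_eq 6 (by decide), h6]
  have h23 : m'.real 23 = m.real 23 := by
    rw [hF.real_eq 23 (by decide), hF₀.real_eq 23 (by decide)]
  refine HaltsWith.seq (HaltsWith.setReal (Q := fun m₁ => m₁.real 7 0 0 = m'.real 7 0 0 ∧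
    m₁.real 7 0 1 = augY P y ω d q) ?_) fun m₁ hF₁ hQ₁ =>
    HaltsWith.seq (HaltsWith.setReal (Q := fun m₂ => m₂.real 7 0 0 = m'.real 7 0 0 ∧
    m₂.real 7 0 1 = augY P y ω d q ∧ m₂.real 7 0 2 = augY P y ω d q) ?_) fun m₂ hF₂ hQ₂ =>
    HaltsWith.seq (Q := fun m₃ => m₃.real 7 0 0 = m'.real 7 0 0 ∧
      m₃.real 7 0 1 = partialResidual P X y ω d (m.real 23 0) q (P.p + d) ∧
      m₃.real 7 0 2 = partialResidual P X y ω d (m.real 23 1) q (P.p + d))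
      ((HaltsWith.loop (P.p + d) (1 + 1) (fun j m₃ => m₃.real 7 0 0 = m'.real 7 0 0 ∧
        m₃.real 7 0 1 = partialResidual P X y ω d (m.real 23 0) q j ∧
        m₃.real 7 0 2 = partialResidual P X y ω d (m.real 23 1) q j) (by decide)
        (fun m₃ hF₃ => ?_) ?_ fun j hj m₃ hF₃ hc₃ hJ => ?_)) fun m₃ hF₃ hQ₃ => ?_
  · rw [← h6']
    simp [RamState.writeReal, NExpr.eval, RExpr.eval, hci, h2, hq]
  · rw [← h6', ← hF₁.real_eq 6 (by decide)]
    simp [RamState.writeReal, NExpr.eval, RExpr.eval, hF₁.nat_eq 7 (by decide), hci,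
      hF₁.nat_eq 2 (by decide), h2, hq, hQ₁]
    rw [← h6', hF₁.real_eq 6 (by decide)]
  · simp only [NExpr.eval, hF₃.nat_eq 0 (by decide), hF₂.nat_eq 0 (by decide),
      hF₁.nat_eq 0 (by decide), h0, hF₃.nat_eq 3 (by decide), hF₂.nat_eq 3 (by decide),
      hF₁.nat_eq 3 (by decide), h3', h.p_eq]
  · simpa [partialResidual, RamState.writeNat] using hQ₂
  · have e2 : m₃.nat 2 0 = (P.n + 1) / 2 := by
      rw [hF₃.nat_eq 2 (by decide), hF₂.nat_eq 2 (by decide), hF₁.nat_eq 2 (by decide), h2]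
    have e7 : m₃.nat 7 0 = i := by
      rw [hF₃.nat_eq 7 (by decide), hF₂.nat_eq 7 (by decide), hF₁.nat_eq 7 (by decide), hci]
    have e5 : m₃.real 5 q j = augX P X ω d q j := by
      rw [hF₃.real_eq 5 (by decide), hF₂.real_eq 5 (by decide), hF₁.real_eq 5 (by decide), h5',
        h5 q j hj]
    have e23 : m₃.real 23 = m.real 23 := by
      rw [hF₃.real_eq 23 (by decide), hF₂.real_eq 23 (by decide), hF₁.real_eq 23 (by decide), h23]
    rw [hq] at e5
    refine HaltsWith.seq (HaltsWith.setReal (Q := fun m₄ => m₄.real 7 0 0 = m'.real 7 0 0 ∧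
      m₄.real 7 0 1 = partialResidual P X y ω d (m.real 23 0) q (j + 1) ∧
      m₄.real 7 0 2 = partialResidual P X y ω d (m.real 23 1) q j) ?_) fun m₄ hF₄ hQ₄ =>
      HaltsWith.setReal ?_
    · simp [RamState.writeReal, NExpr.eval, RExpr.eval, e2, e7, hc₃, hJ, e5, e23]
      simp only [partialResidual, Finset.sum_range_succ]
      ring
    · simp [RamState.writeReal, RamState.writeNat, NExpr.eval, RExpr.eval,
        hF₄.nat_eq 2 (by decide), hF₄.nat_eq 7 (by decide), hF₄.nat_eq 5 (by decide),
        hF₄.real_eq 5 (by decide), hF₄.real_eq 23 (by decide), e2, e7, hc₃, hQ₄, e5, e23]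
      simp only [partialResidual, Finset.sum_range_succ]
      ring
  · refine HaltsWith.ite (fun hb => HaltsWith.setReal ?_) fun hb => HaltsWith.setReal ?_
    all_goals
      simp [RamState.writeReal, RamState.writeNat, NExpr.eval, RExpr.eval, Test.Holds, hQ₃, hI,
        Finset.sum_range_succ, testTerm, hin, ← pow_two] at hb ⊢
    · exact (min_eq_left hb.le).symm
    · exact (min_eq_right hb).symm

theorem decision_run (h : Data P X y ω m)
    {b : Signal (guess P d).p × Signal (guess P d).p} (h7 : m.real 7 0 0 = loss P X y ω d b) :
    HaltsWith ω decision m (1 + 1) fun m' =>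
      (m'.nat 1 0 ≠ 0 ↔ m.nat 1 0 ≠ 0 ∨ Passes P X y ω d b) := by
  have hb : (Test.realLt (.times (acc 0) (acc 0)) (.times (.times (.times (.ofNat (.var 2))
      (.ofNat (.var 2))) (.ofNat sparsity)) (.times noise noise))).Holds m ↔
      Passes P X y ω d b := by
    simp only [Test.Holds, RExpr.eval, NExpr.eval, h7, h.half_eq, h.k_eq, h.σ_eq, Passes, pow_two]
  refine HaltsWith.ite (fun hb' => HaltsWith.setNat ?_) fun hb' => HaltsWith.skip ?_
  all_goals rw [hb] at hb'
  · simp [RamState.writeNat, NExpr.eval, hb']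
  · simp [hb']

end Detector

end

noncomputable section

/-! ### A whole trial, the whole detector and its polynomial running time -/

namespace Detector

variable {P : Params} {X : Design P.n P.p} {y : Fin P.n → ℝ} {ω : ℕ → ℝ} {d : ℕ} {m : RamState}

/-- A bound for the arrays that a program may modify. -/
def writeBound (A : Prog) : ℕ := (A.natWrites ∪ A.realWrites).sup id + 3

theorem lt_writeBound_of_nat {A : Prog} {u : ℕ} (hu : u ∈ A.natWrites) : u < writeBound A :=
  (Finset.le_sup (f := id) (Finset.mem_union_left _ hu)).trans_lt
    (Nat.lt_add_of_pos_right (by decide))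

theorem lt_writeBound_of_real {A : Prog} {u : ℕ} (hu : u ∈ A.realWrites) : u < writeBound A :=
  (Finset.le_sup (f := id) (Finset.mem_union_right _ hu)).trans_lt
    (Nat.lt_add_of_pos_right (by decide))

/-- What the trials rely on and preserve; `N` bounds the arrays that the recovery algorithm
modifies. -/
structure Ready (P : Params) (X : Design P.n P.p) (y : Fin P.n → ℝ) (ω : ℕ → ℝ) (N : ℕ)
    (m : RamState) : Prop where
  data : Data P X y ω m
  drawn_eq : m.drawn = (P.n + 2) * (P.p + P.p + 1) + m.nat 11 0
  tape_eq : ∀ j < m.nat 11 0, m.real 10 0 j = tail P ω j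
  nat_eq : ∀ u, N ≤ u → m.nat (u + 20) = fun _ => 0
  real_eq : ∀ u, N ≤ u → m.real (u + 20) = fun _ _ => 0

theorem Ready.of_counter {N i : ℕ} (h : Ready P X y ω N m) :
    Ready P X y ω N (m.writeNat 3 0 i) := by
  have e : ∀ u, u ≠ 3 → (m.writeNat 3 0 i).nat u = m.nat u := fun u hu =>
    Function.update_of_ne hu _ _
  refine ⟨⟨?_, ?_, ?_, h.data.X_eq, h.data.y_eq, h.data.σ_eq, ?_, h.data.pre_eq⟩, ?_, ?_, ?_,
    h.real_eq⟩
  · rw [e 0 (by decide)]; exact h.data.p_eq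
  · rw [e 0 (by decide)]; exact h.data.n_eq
  · rw [e 0 (by decide)]; exact h.data.k_eq
  · rw [e 2 (by decide)]; exact h.data.half_eq
  · rw [e 11 (by decide)]; exact h.drawn_eq
  · rw [e 11 (by decide)]; exact h.tape_eq
  · intro u hu
    rw [e _ (by omega)]; exact h.nat_eq u hu

/-- The time of the preparation of a trial. -/
def prepareTime (p n N : ℕ) : ℕ :=
  ((p + p) * ((1 + ((p + p) * (2 + 2) + 2)) + 2) + 2) + ((n * ((1 + (p * (1 + 2) + 2)) + 2) + 2) +
  ((n * (((p + p) * (2 + 2 + 2) + 2) + 2) + 2) + ((2 * N + 1) + (5 +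
  (n * ((1 + ((p + p) * (1 + 2) + 2)) + 2) + 2)))))

/-- The time of one trial if the recovery algorithm takes time `T`. -/
def trialTime (p n N T : ℕ) : ℕ :=
  prepareTime p n N + (5 * T +
  ((1 + (n * (1 + (1 + (((p + p) * (1 + 1 + 2) + 2) + (1 + 1))) + 2) + 2)) + (1 + 1)))

/-- Some run of the recovery algorithm on the augmented data leads to an estimate that is
accepted. -/
def Accepts (A : Prog) (P : Params) (X : Design P.n P.p) (y : Fin P.n → ℝ) (ω : ℕ → ℝ)
    (d : ℕ) : Prop :=
  ∃ t m, Run (tail P ω) A (start P X y ω d) t m ∧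
    Passes P X y ω d (outputPair (guess P d).p m)

theorem notMem_natWrites_memo {A : Prog} {u : ℕ} (h : u < 10 ∨ writeBound A + 20 ≤ u) :
    u ∉ (A.memo 20 10 10 11).natWrites := by
  intro hu
  rcases A.natWrites_memo hu with rfl | rfl | ⟨v, hv, rfl⟩
  · omega
  · omega
  · have := lt_writeBound_of_nat hv; omega

theorem notMem_realWrites_memo {A : Prog} {u : ℕ} (h : u < 10 ∨ writeBound A + 20 ≤ u) :
    u ∉ (A.memo 20 10 10 11).realWrites := by
  intro hu
  rcases A.realWrites_memo hu with rfl | ⟨v, hv, rfl⟩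
  · omega
  · have := lt_writeBound_of_real hv; omega

theorem notMem_natWrites_clear {N u : ℕ} (h : u < 20 ∨ N + 20 ≤ u) : u ∉ (clear N).natWrites :=
  fun hu => by have := mem_natWrites_clear hu; omega

theorem notMem_realWrites_clear {N u : ℕ} (h : u < 20 ∨ N + 20 ≤ u) : u ∉ (clear N).realWrites :=
  fun hu => by have := mem_realWrites_clear hu; omega

theorem notMem_natWrites_prepare {N u : ℕ} (h : u < 5 ∨ u = 11 ∨ 20 < u)
    (hu : u < 20 ∨ N + 20 ≤ u) :
    u ∉ (prepare N).natWrites := by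
  have h1 : ∀ S ∈ [ranks, responses, design, scalars, copy], u ∉ S.natWrites := by
    have : ∀ S ∈ [ranks, responses, design, scalars, copy], ∀ v ∈ S.natWrites,
        (5 ≤ v ∧ v ≤ 10) ∨ v = 20 := by
      simp only [List.forall_mem_cons]
      exact ⟨by decide, by decide, by decide, by decide, by decide, by simp⟩
    intro S hS hu
    have := this S hS u hu
    omega
  simp only [List.forall_mem_cons] at h1
  simp [prepare, Prog.natWrites, h1, notMem_natWrites_clear hu]

theorem notMem_realWrites_prepare {N u : ℕ} (h : u < 5 ∨ u = 10 ∨ 22 < u)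
    (hu : u < 20 ∨ N + 20 ≤ u) : u ∉ (prepare N).realWrites := by
  have h1 : ∀ S ∈ [ranks, responses, design, scalars, copy], u ∉ S.realWrites := by
    have : ∀ S ∈ [ranks, responses, design, scalars, copy], ∀ v ∈ S.realWrites,
        (5 ≤ v ∧ v < 10) ∨ (20 ≤ v ∧ v ≤ 22) := by
      simp only [List.forall_mem_cons]
      exact ⟨by decide, by decide, by decide, by decide, by decide, by simp⟩
    intro S hS hu
    have := this S hS u hu
    omega
  simp only [List.forall_mem_cons] at h1
  simp [prepare, Prog.realWrites, h1, notMem_realWrites_clear hu]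

theorem drawFree_prepare (N : ℕ) : (prepare N).drawFree = true := by
  have h : ranks.drawFree = true ∧ responses.drawFree = true ∧ design.drawFree = true ∧
    scalars.drawFree = true ∧ copy.drawFree = true := by decide
  simp [prepare, Prog.drawFree, h, drawFree_clear]

theorem prepare_run {N : ℕ} (h : Ready P X y ω N m) (h3 : m.nat 3 0 = d) (hd : d ≤ P.p) :
    HaltsWith ω (prepare N) m (prepareTime P.p P.n N) fun m' =>
      MemoSim 20 10 10 11 ω ((P.n + 2) * (P.p + P.p + 1)) (start P X y ω d) m' ∧
      (∀ q : Fin P.n, ∀ j < P.p + d, m'.real 5 q j = augX P X ω d q j) ∧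
      ∀ q : Fin P.n, m'.real 6 q 0 = augY P y ω d q := by
  have hhalf := half_le P
  suffices HaltsWith ω (prepare N) m (prepareTime P.p P.n N) fun m' =>
      ((∀ u, m'.nat (u + 20) = (start P X y ω d).nat u) ∧
      (∀ u, m'.real (u + 20) = (start P X y ω d).real u) ∧ m'.nat 10 0 = 0) ∧
      (∀ q : Fin P.n, ∀ j < P.p + d, m'.real 5 q j = augX P X ω d q j) ∧
      ∀ q : Fin P.n, m'.real 6 q 0 = augY P y ω d q by
    -- The preparation neither draws nor touches the memoised tape, so the tape clauses of the
    -- simulation are inherited; the rewound count is 0 and thus at most the length.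
    refine this.mono le_rfl fun m' hF hQ => ⟨⟨hQ.1.1, hQ.1.2.1, hQ.1.2.2, Nat.zero_le _, ?_, ?_⟩,
      hQ.2⟩
    · rw [hF.drawn_eq (drawFree_prepare N), h.drawn_eq,
        hF.nat_eq 11 (notMem_natWrites_prepare (by omega) (by omega))]
    · rw [hF.nat_eq 11 (notMem_natWrites_prepare (by omega) (by omega)),
        hF.real_eq 10 (notMem_realWrites_prepare (by omega) (by omega))]
      exact h.tape_eq
  refine HaltsWith.seq ((ranks_run h.data h3 hd).of_le (by gcongr)) fun m₁ hF₁ h8₁ => ?_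
  have D₁ := h.data.of_frame hF₁ (by decide) (by decide) (by decide) (by decide) (by decide)
    (by decide)
  have h3₁ : m₁.nat 3 0 = d := by rw [hF₁.nat_eq 3 (by decide), h3]
  refine HaltsWith.seq ((responses_run D₁ h3₁ hd).of_le (by gcongr)) fun m₂ hF₂ h6₂ => ?_
  have D₂ := D₁.of_frame hF₂ (by decide) (by decide) (by decide) (by decide) (by decide)
    (by decide)
  have h3₂ : m₂.nat 3 0 = d := by rw [hF₂.nat_eq 3 (by decide), h3₁]
  refine HaltsWith.seq ((design_run D₂ h3₂ hd (hF₂.nat_eq 8 (by decide) ▸ h8₁)).of_le (by gcongr))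
    fun m₃ hF₃ h5₃ => ?_
  have D₃ := D₂.of_frame hF₃ (by decide) (by decide) (by decide) (by decide) (by decide)
    (by decide)
  have h3₃ : m₃.nat 3 0 = d := by rw [hF₃.nat_eq 3 (by decide), h3₂]
  refine HaltsWith.seq (clear_run N m₃) fun m₄ hF₄ hQ₄ => ?_
  have D₄ := D₃.of_frame hF₄ (notMem_natWrites_clear (by omega))
    (notMem_natWrites_clear (by omega)) (notMem_realWrites_clear (by omega))
    (notMem_realWrites_clear (by omega)) (notMem_realWrites_clear (by omega))
    (notMem_realWrites_clear (by omega))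
  have h3₄ : m₄.nat 3 0 = d := by rw [hF₄.nat_eq 3 (notMem_natWrites_clear (by omega)), h3₃]
  have hnat : ∀ u, m₄.nat (u + 20) = fun _ => 0 := by
    intro u
    by_cases hu : u < N
    · exact hQ₄.1 u hu
    · have h1 : ∀ S ∈ [ranks, responses, design], ∀ v ∈ S.natWrites, v < 20 := by
        simp only [List.forall_mem_cons]
        exact ⟨by decide, by decide, by decide, by simp⟩
      rw [hF₄.nat_eq _ (notMem_natWrites_clear (by omega)),
        hF₃.nat_eq _ fun hw => by have := h1 design (by simp) _ hw; omega,
        hF₂.nat_eq _ fun hw => by have := h1 responses (by simp) _ hw; omega,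
        hF₁.nat_eq _ fun hw => by have := h1 ranks (by simp) _ hw; omega, h.nat_eq u (by omega)]
  have hreal : ∀ u, m₄.real (u + 20) = fun _ _ => 0 := by
    intro u
    by_cases hu : u < N
    · exact hQ₄.2 u hu
    · have h1 : ∀ S ∈ [ranks, responses, design], ∀ v ∈ S.realWrites, v < 20 := by
        simp only [List.forall_mem_cons]
        exact ⟨by decide, by decide, by decide, by simp⟩
      rw [hF₄.real_eq _ (notMem_realWrites_clear (by omega)),
        hF₃.real_eq _ fun hw => by have := h1 design (by simp) _ hw; omega,
        hF₂.real_eq _ fun hw => by have := h1 responses (by simp) _ hw; omega,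
        hF₁.real_eq _ fun hw => by have := h1 ranks (by simp) _ hw; omega, h.real_eq u (by omega)]
  refine HaltsWith.seq (scalars_run D₄ h3₄ hnat hreal) fun m₅ hF₅ hQ₅ => ?_
  have D₅ : Data P X y ω m₅ := D₄.of_frame hF₅ (by decide) (by decide) (by decide) (by decide)
    (by decide) (by decide)
  have h3₅ : m₅.nat 3 0 = d := by rw [hF₅.nat_eq 3 (by decide), h3₄]
  have h5₅ : ∀ q : Fin P.n, ∀ j < P.p + d, m₅.real 5 q j = augX P X ω d q j := by
    rw [hF₅.real_eq 5 (by decide), hF₄.real_eq 5 (notMem_realWrites_clear (by omega))]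
    exact h5₃
  have h6₅ : ∀ q : Fin P.n, m₅.real 6 q 0 = augY P y ω d q := by
    rw [hF₅.real_eq 6 (by decide), hF₄.real_eq 6 (notMem_realWrites_clear (by omega)),
      hF₃.real_eq 6 (by decide)]
    exact h6₂
  refine ((copy_run D₅ h3₅ h5₅ h6₅ hQ₅.2.1).of_le (by gcongr)).mono le_rfl fun m₆ hF₆ hQ₆ => ?_
  have hc : ∀ v ∈ copy.natWrites, v < 10 := by decide
  refine ⟨⟨fun u => ?_, hQ₆, ?_⟩, ?_, ?_⟩
  · rw [hF₆.nat_eq _ fun hw => by have := hc _ hw; omega, hQ₅.1]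
  · rw [hF₆.nat_eq _ fun hw => by have := hc _ hw; omega, hQ₅.2.2]
  · rw [hF₆.real_eq 5 (by decide)]; exact h5₅
  · rw [hF₆.real_eq 6 (by decide)]; exact h6₅

theorem trial_run {A : Prog} {T : ℕ} {mA : RamState} {t : ℕ} (ht : t ≤ T)
    (h : Ready P X y ω (writeBound A) m) (h3 : m.nat 3 0 = d) (hd : d ≤ P.p)
    (hA : Run (tail P ω) A (start P X y ω d) t mA) :
    HaltsWith ω (trial A (writeBound A)) m (trialTime P.p P.n (writeBound A) T) fun m' =>
      Ready P X y ω (writeBound A) m' ∧ (m'.nat 1 0 ≠ 0 ↔ m.nat 1 0 ≠ 0 ∨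
        Passes P X y ω d (outputPair (guess P d).p mA)) := by
  set N := writeBound A with hN
  have hhalf : P.n - (P.n + 1) / 2 ≤ P.n := by omega
  -- Each trial fills the input arrays `20, 21, 22` whether or not `A` writes to its inputs. The
  -- summand 3 in `writeBound` puts them among the cleared arrays.
  have hN3 : 3 ≤ N := Nat.le_add_left _ _
  refine HaltsWith.seq (prepare_run h h3 hd) fun m₁ hF₁ hQ₁ => ?_
  have D₁ : Data P X y ω m₁ := h.data.of_frame hF₁ (notMem_natWrites_prepare (by omega) (by omega))
    (notMem_natWrites_prepare (by omega) (by omega))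
    (notMem_realWrites_prepare (by omega) (by omega))
    (notMem_realWrites_prepare (by omega) (by omega))
    (notMem_realWrites_prepare (by omega) (by omega))
    (notMem_realWrites_prepare (by omega) (by omega))
  have h3₁ : m₁.nat 3 0 = d := by
    rw [hF₁.nat_eq 3 (notMem_natWrites_prepare (by omega) (by omega)), h3]
  obtain ⟨t', m₂, ht', hr₂, hM₂⟩ := Run.memo (by omega) (by omega) (by omega) (by omega) hA hQ₁.1
  refine HaltsWith.seq (Q := fun m₂ => MemoSim 20 10 10 11 ω ((P.n + 2) * (P.p + P.p + 1)) mA m₂)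
    ⟨t', m₂, ht'.trans (by omega), hr₂, hM₂⟩ fun m₂ hF₂ hM₂ => ?_
  have D₂ : Data P X y ω m₂ := D₁.of_frame hF₂ (notMem_natWrites_memo (by omega))
    (notMem_natWrites_memo (by omega)) (notMem_realWrites_memo (by omega))
    (notMem_realWrites_memo (by omega)) (notMem_realWrites_memo (by omega))
    (notMem_realWrites_memo (by omega))
  have h3₂ : m₂.nat 3 0 = d := by rw [hF₂.nat_eq 3 (notMem_natWrites_memo (by omega)), h3₁]
  have h5₂ : ∀ q : Fin P.n, ∀ j < P.p + d, m₂.real 5 q j = augX P X ω d q j := by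
    rw [hF₂.real_eq 5 (notMem_realWrites_memo (by omega))]; exact hQ₁.2.1
  have h6₂ : ∀ q : Fin P.n, m₂.real 6 q 0 = augY P y ω d q := by
    rw [hF₂.real_eq 6 (notMem_realWrites_memo (by omega))]; exact hQ₁.2.2
  refine HaltsWith.seq ((residuals_run D₂ h3₂ h5₂ h6₂).of_le (by gcongr)) fun m₃ hF₃ hQ₃ => ?_
  have D₃ : Data P X y ω m₃ := D₂.of_frame hF₃ (by decide) (by decide) (by decide) (by decide)
    (by decide) (by decide)
  have hout : (fun j : Fin (guess P d).p => m₂.real 23 0 j, fun j : Fin (guess P d).p =>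
      m₂.real 23 1 j) = outputPair (guess P d).p mA := by
    have : m₂.real 23 = mA.real 3 := hM₂.real_eq 3
    simp [outputPair, this]
  rw [hout] at hQ₃
  refine (decision_run D₃ hQ₃).mono le_rfl fun m₄ hF₄ hQ₄ => ⟨⟨?_, ?_, ?_, ?_, ?_⟩, ?_⟩
  · exact D₃.of_frame hF₄ (by decide) (by decide) (by decide) (by decide) (by decide) (by decide)
  · rw [hF₄.drawn_eq (by decide), hF₃.drawn_eq (by decide), hF₄.nat_eq 11 (by decide),
      hF₃.nat_eq 11 (by decide)]
    exact hM₂.drawn_eq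
  · rw [hF₄.nat_eq 11 (by decide), hF₃.nat_eq 11 (by decide), hF₄.real_eq 10 (by decide),
      hF₃.real_eq 10 (by decide)]
    exact hM₂.tape_eq
  · intro u hu
    have h1 : ∀ v ∈ residuals.natWrites ∪ decision.natWrites, v < 10 := by decide
    rw [hF₄.nat_eq _ fun hw => by have := h1 _ (Finset.mem_union_right _ hw); omega,
      hF₃.nat_eq _ fun hw => by have := h1 _ (Finset.mem_union_left _ hw); omega,
      hF₂.nat_eq _ (notMem_natWrites_memo (by omega))]
    rw [hF₁.nat_eq _ (notMem_natWrites_prepare (by omega) (by omega)), h.nat_eq u hu]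
  · intro u hu
    have h1 : ∀ v ∈ residuals.realWrites ∪ decision.realWrites, v < 10 := by decide
    rw [hF₄.real_eq _ fun hw => by have := h1 _ (Finset.mem_union_right _ hw); omega,
      hF₃.real_eq _ fun hw => by have := h1 _ (Finset.mem_union_left _ hw); omega,
      hF₂.real_eq _ (notMem_realWrites_memo (by omega))]
    rw [hF₁.real_eq _ (notMem_realWrites_prepare (by omega) (by omega)), h.real_eq u hu]
  · rw [hQ₄, hF₃.nat_eq 1 (by decide), hF₂.nat_eq 1 (notMem_natWrites_memo (by omega)),
      hF₁.nat_eq 1 (notMem_natWrites_prepare (by omega) (by omega))]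

def detectorTime (p n N T : ℕ) : ℕ :=
  (n * (2 + 2) + 2) + (((n + 2) * (((p + p + 1) * (1 + 2) + 2) + 2) + 2) +
    ((p + 1) * (trialTime p n N T + 2) + 2))

theorem detector_run {A : Prog} {T : ℕ}
    (hA : ∀ d ≤ P.p, ∃ t ≤ T, ∃ mA, Run (tail P ω) A (start P X y ω d) t mA) :
    HaltsWith ω (detector A (writeBound A)) (initState P X y)
      (detectorTime P.p P.n (writeBound A) T) fun m' =>
      m'.nat 1 0 ≠ 0 ↔ ∃ d ≤ P.p, Accepts A P X y ω d := by
  set N := writeBound A with hN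
  have hN3 : 3 ≤ N := Nat.le_add_left _ _
  refine HaltsWith.seq (half_run (P := P) rfl rfl) fun m₁ hF₁ hQ₁ => ?_
  refine HaltsWith.seq (predraw_run (P := P) (by rw [hF₁.nat_eq 0 (by decide)]; rfl)
    (by rw [hF₁.nat_eq 0 (by decide)]; rfl) (by rw [hF₁.drawn_eq (by decide)]; rfl))
    fun m₂ hF₂ hQ₂ => ?_
  have hnat : ∀ u, u ≠ 2 → u ≠ 6 → u ≠ 7 → m₂.nat u = (initState P X y).nat u := by
    intro u h2 h6 h7
    rw [hF₂.nat_eq u (by simp [predraw, Prog.loop, Prog.natWrites, h6, h7]),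
      hF₁.nat_eq u (by simp [half, Prog.loop, Prog.natWrites, h2, h7])]
  have hreal : ∀ u, u ≠ 4 → m₂.real u = (initState P X y).real u := by
    intro u h4
    rw [hF₂.real_eq u (by simp [predraw, Prog.loop, Prog.realWrites, h4]),
      hF₁.real_eq u (by simp [half, Prog.loop, Prog.realWrites])]
  have hR : Ready P X y ω N m₂ := by
    refine ⟨⟨?_, ?_, ?_, fun q l => ?_, fun q => ?_, ?_, ?_, hQ₂.1⟩, ?_, ?_, fun u hu => ?_,
      fun u hu => ?_⟩
    · rw [hnat 0 (by decide) (by decide) (by decide)]; rfl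
    · rw [hnat 0 (by decide) (by decide) (by decide)]; rfl
    · rw [hnat 0 (by decide) (by decide) (by decide)]; rfl
    · rw [hreal 0 (by decide)]; simp [initState]
    · rw [hreal 1 (by decide)]; simp [initState]
    · rw [hreal 2 (by decide)]; simp [initState]
    · rw [hF₂.nat_eq 2 (by decide), hQ₁]
    · rw [hnat 11 (by decide) (by decide) (by decide), hQ₂.2]; rfl
    · rw [hnat 11 (by decide) (by decide) (by decide)]
      intro j hj
      exact absurd hj (Nat.not_lt_zero _)
    · rw [hnat _ (by omega) (by omega) (by omega)]
      simp [initState]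
    · rw [hreal _ (by omega)]
      funext x j
      simp only [initState]
      rw [if_neg (by omega), if_neg (by omega), if_neg (by omega)]
  have h3 : 3 ∉ (trial A N).natWrites := by
    simp only [trial, Prog.natWrites, Finset.mem_union, not_or]
    exact ⟨notMem_natWrites_prepare (by omega) (by omega), notMem_natWrites_memo (by omega),
      by decide, by decide⟩
  have h0 : 0 ∉ (Prog.loop 3 (.plus (.var 0) (.const 1)) (trial A N)).natWrites := by
    simp only [Prog.loop, trial, Prog.natWrites, Finset.mem_union, not_or]
    exact ⟨by decide, ⟨notMem_natWrites_prepare (by omega) (by omega),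
      notMem_natWrites_memo (by omega), by decide, by decide⟩, by decide⟩
  refine (HaltsWith.loop (P.p + 1) (trialTime P.p P.n N T) (fun i m' => Ready P X y ω N m' ∧
    (m'.nat 1 0 ≠ 0 ↔ ∃ d < i, Accepts A P X y ω d)) h3 (fun m' hF => ?_) ?_
    fun d hd m' hF hcd hI => ?_).mono le_rfl fun m' _ h => ?_
  · simp only [NExpr.eval, hF.nat_eq 0 h0, hR.data.p_eq]
  · refine ⟨?_, ?_⟩
    · exact hR.of_counter
    · simp only [RamState.writeNat]
      rw [Function.update_of_ne (by decide), hnat 1 (by decide) (by decide) (by decide)]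
      simp [initState]
  · obtain ⟨t, ht, mA, hA⟩ := hA d (by omega)
    refine (trial_run ht hI.1 hcd (by omega) hA).mono le_rfl fun m'' _ hQ => ⟨hQ.1.of_counter, ?_⟩
    simp only [RamState.writeNat]
    rw [Function.update_of_ne (by decide), hQ.2, hI.2]
    -- `Accepts` speaks of some run; by determinism it is the one just executed.
    have : Accepts A P X y ω d ↔ Passes P X y ω d (outputPair (guess P d).p mA) :=
      ⟨fun ⟨_, _, hr, hp⟩ => (hr.deterministic hA).2 ▸ hp, fun hp => ⟨_, _, hA, hp⟩⟩
    rw [← this]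
    constructor
    · rintro (⟨e, he, h⟩ | h)
      · exact ⟨e, by omega, h⟩
      · exact ⟨d, by omega, h⟩
    · rintro ⟨e, he, h⟩
      rcases Nat.lt_succ_iff_lt_or_eq.1 he with he | rfl
      · exact .inl ⟨e, he, h⟩
      · exact .inr h
  · simp only [h.2, Nat.lt_succ_iff]

/-- A guess at most doubles the dimension and does not increase the sample size, and `k + d ≤ p + d`
keeps the input admissible; hence one time bound serves all trials. -/
theorem exists_run_tail {A : Prog} {C η : ℕ} (hA : ∀ (P : Params), P.k ≤ P.p →
    ∀ (X : Design P.n P.p) (y : Fin P.n → ℝ) (ω : ℕ → ℝ),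
    ∃ t m, Run ω A (initState P X y) t m ∧ t ≤ C * (P.p + P.n + 1) ^ η) (hk : P.k ≤ P.p) :
    ∀ d ≤ P.p, ∃ t ≤ C * (2 * (P.p + P.n + 1)) ^ η, ∃ mA,
      Run (tail P ω) A (start P X y ω d) t mA := by
  intro d hd
  obtain ⟨t, mA, hr, ht⟩ := hA (guess P d) (Nat.add_le_add_right hk d) _ _ (tail P ω)
  refine ⟨t, ht.trans ?_, mA, hr⟩
  have : (guess P d).p + (guess P d).n + 1 ≤ 2 * (P.p + P.n + 1) := by
    simp only [guess]; omega
  gcongr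

/-- The time is monotone in `p` and `n`, so both may be replaced by `p + n + 1`. The difference of
the two sides is then a polynomial with nonnegative coefficients. -/
theorem detectorTime_le (p n N T : ℕ) :
    detectorTime p n N T ≤ 1000 * (N + 1) * (T + 1) * (p + n + 1) ^ 4 := by
  obtain ⟨u, hu⟩ : ∃ u, p + n = u := ⟨_, rfl⟩
  have hp : p ≤ u + 1 := by omega
  have hn : n ≤ u + 1 := by omega
  have h1 : detectorTime p n N T ≤ detectorTime (u + 1) (u + 1) N T := by
    unfold detectorTime trialTime prepareTime
    gcongr
  rw [hu]
  refine h1.trans ?_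
  unfold detectorTime trialTime prepareTime
  zify
  rw [← sub_nonneg]
  ring_nf
  positivity

theorem polyTime_detector {A : Prog} (hA : PolyTime A) :
    PolyTime (detector A (writeBound A)) := by
  obtain ⟨C, η, hA⟩ := hA
  refine ⟨1000 * (writeBound A + 1) * (C * 2 ^ η + 1), η + 4, fun P hk X y ω => ?_⟩
  obtain ⟨t, m, ht, hr, -⟩ := detector_run (exists_run_tail (X := X) (y := y) (ω := ω) hA hk)
  refine ⟨t, m, hr, ht.trans ((detectorTime_le _ _ _ _).trans ?_)⟩
  have h1 : C * (2 * (P.p + P.n + 1)) ^ η + 1 ≤ (C * 2 ^ η + 1) * (P.p + P.n + 1) ^ η := by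
    have : 1 ≤ (P.p + P.n + 1) ^ η := Nat.one_le_pow _ _ (by omega)
    rw [mul_pow]
    nlinarith
  calc _ ≤ 1000 * (writeBound A + 1) * ((C * 2 ^ η + 1) * (P.p + P.n + 1) ^ η) *
        (P.p + P.n + 1) ^ 4 := by gcongr
    _ = _ := by ring

/-- The detector declares the data to be planted if and only if some guess is accepted. -/
theorem declaresPlanted_detector {A : Prog} (hA : PolyTime A) (hk : P.k ≤ P.p) :
    DeclaresPlanted (detector A (writeBound A)) P X y ω ↔ ∃ d ≤ P.p, Accepts A P X y ω d := by
  obtain ⟨C, η, hA⟩ := hA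
  obtain ⟨t, m, ht, hr, hm⟩ := detector_run (exists_run_tail (X := X) (y := y) (ω := ω) hA hk)
  rw [← hm]
  exact ⟨fun ⟨_, _, hr', h⟩ => (hr'.deterministic hr).2 ▸ h, fun h => ⟨t, m, hr, h⟩⟩

end Detector

end

noncomputable section

/-! ### Families of independent standard Gaussians -/

/-- The law of a family of independent standard Gaussians. -/
def iidGaussian (ι : Type*) : Measure (ι → ℝ) := Measure.infinitePi fun _ => gaussianReal 0 1

instance iidGaussian.instIsProbabilityMeasure (ι : Type*) : IsProbabilityMeasure (iidGaussian ι) :=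
  inferInstanceAs (IsProbabilityMeasure (Measure.infinitePi _))

theorem iidGaussian_eq_pi (ι : Type*) [Fintype ι] :
    iidGaussian ι = Measure.pi fun _ => gaussianReal 0 1 :=
  Measure.infinitePi_eq_pi _

instance tapeLaw.instIsProbabilityMeasure : IsProbabilityMeasure tapeLaw :=
  inferInstanceAs (IsProbabilityMeasure (iidGaussian ℕ))

theorem designLaw_eq (n p : ℕ) :
    designLaw n p = Measure.pi fun _ : Fin n => iidGaussian (Fin p) := by
  simp only [iidGaussian_eq_pi, designLaw]

instance designLaw.instIsProbabilityMeasure (n p : ℕ) : IsProbabilityMeasure (designLaw n p) := by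
  unfold designLaw; infer_instance

instance noiseLaw.instIsProbabilityMeasure (n : ℕ) (v : ℝ≥0) :
    IsProbabilityMeasure (noiseLaw n v) := by
  unfold noiseLaw; infer_instance

instance labelLaw.instIsProbabilityMeasure (n : ℕ) (φ : unitInterval) :
    IsProbabilityMeasure (labelLaw n φ) := by
  unfold labelLaw; infer_instance

section
variable {ι κ : Type*}

theorem measurePreserving_iidGaussian_comp {f : κ → ι} (hf : f.Injective) :
    MeasurePreserving (fun (x : ι → ℝ) k => x (f k)) (iidGaussian ι) (iidGaussian κ) :=
  ⟨by fun_prop, Measure.map_infinitePi_infinitePi_of_inj hf⟩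

theorem measurePreserving_sumElim :
    MeasurePreserving (fun x : (ι → ℝ) × (κ → ℝ) => Sum.elim x.1 x.2)
      ((iidGaussian ι).prod (iidGaussian κ)) (iidGaussian (ι ⊕ κ)) := by
  have hm : Measurable (fun x : (ι → ℝ) × (κ → ℝ) => Sum.elim x.1 x.2) := by
    refine measurable_pi_lambda _ fun i => ?_
    rcases i with i | i
    · exact (measurable_pi_apply i).comp measurable_fst
    · exact (measurable_pi_apply i).comp measurable_snd
  refine ⟨hm, Measure.eq_infinitePi _ fun s t ht => ?_⟩
  have hs : MeasurableSet (Set.pi (s : Set (ι ⊕ κ)) t) :=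
    .pi s.countable_toSet fun i _ => ht i
  rw [Measure.map_apply hm hs]
  have : (fun x : (ι → ℝ) × (κ → ℝ) => (Sum.elim x.1 x.2 : ι ⊕ κ → ℝ)) ⁻¹' Set.pi (s : Set (ι ⊕ κ)) t =
      (Set.pi (s.toLeft : Set ι) fun i => t (.inl i)) ×ˢ
        (Set.pi (s.toRight : Set κ) fun i => t (.inr i)) := by
    ext x
    simp [Set.mem_pi]
  rw [this, Measure.prod_prod, iidGaussian, iidGaussian, Measure.infinitePi_pi _ fun i _ => ht _,
    Measure.infinitePi_pi _ fun i _ => ht _, Finset.prod_sum_eq_prod_toLeft_mul_prod_toRight]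

theorem measurePreserving_sumSplit :
    MeasurePreserving (fun x : ι ⊕ κ → ℝ => ((fun i => x (.inl i), fun k => x (.inr k)) :
      (ι → ℝ) × (κ → ℝ))) (iidGaussian (ι ⊕ κ)) ((iidGaussian ι).prod (iidGaussian κ)) := by
  refine ⟨by fun_prop, ?_⟩
  rw [← measurePreserving_sumElim.map_eq, Measure.map_map (by fun_prop)
    measurePreserving_sumElim.measurable]
  exact Measure.map_id

theorem measurePreserving_rows {n d : ℕ} :
    MeasurePreserving (fun (x : Fin n × Fin d → ℝ) q j => x (q, j)) (iidGaussian (Fin n × Fin d))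
      (designLaw n d) := by
  refine ⟨by fun_prop, ?_⟩
  rw [designLaw_eq, ← Measure.infinitePi_eq_pi]
  exact Measure.infinitePi_map_curry (fun (_ : Fin n) (_ : Fin d) => gaussianReal 0 1)

theorem iidGaussian_ae_injective [Countable ι] :
    ∀ᵐ g ∂iidGaussian ι, Function.Injective g := by
  have h : ∀ i j : ι, i ≠ j → ∀ᵐ g ∂iidGaussian ι, g i ≠ g j := by
    intro i j hij
    have hmap := Measure.infinitePi_map_eval_prod (P := fun _ : ι => gaussianReal 0 1) hij
    have hd : MeasurableSet {x : ℝ × ℝ | x.1 = x.2} :=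
      measurableSet_eq_fun measurable_fst measurable_snd
    have : NullSingletonClass (gaussianReal 0 1) := nullSingletonClass_gaussianReal one_ne_zero
    have h0 : (gaussianReal 0 1).prod (gaussianReal 0 1) {x : ℝ × ℝ | x.1 = x.2} = 0 := by
      rw [Measure.measure_prod_null hd]
      refine .of_forall fun x => ?_
      have : Prod.mk x ⁻¹' {x : ℝ × ℝ | x.1 = x.2} = {x} := by
        ext y; simp [eq_comm]
      change gaussianReal 0 1 (Prod.mk x ⁻¹' {x : ℝ × ℝ | x.1 = x.2}) = 0
      rw [this]
      simp
    rw [← hmap, Measure.map_apply (by fun_prop) hd] at h0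
    rw [ae_iff]
    simpa [iidGaussian] using h0
  have h' : ∀ᵐ g ∂iidGaussian ι, ∀ i j : ι, i ≠ j → g i ≠ g j :=
    ae_all_iff.2 fun i => ae_all_iff.2 fun j => by
      by_cases hij : i = j
      · simp [hij]
      · filter_upwards [h i j hij] with g hg _ using hg
  filter_upwards [h'] with g hg i j hij
  by_contra hne
  exact hg i j hne hij

theorem iidGaussian_ae_ne_zero [Countable ι] : ∀ᵐ g ∂iidGaussian ι, ∀ i, g i ≠ 0 := by
  refine ae_all_iff.2 fun i => ?_
  have : NullSingletonClass (gaussianReal 0 1) := nullSingletonClass_gaussianReal one_ne_zero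
  have h : ∀ᵐ x ∂gaussianReal 0 1, x ≠ (0 : ℝ) := by simp [ae_iff]
  exact (measurePreserving_eval_infinitePi (fun _ : ι => gaussianReal 0 1)
    i).quasiMeasurePreserving.ae h

theorem measurePreserving_iidGaussian_mul {ι : Type*} [Fintype ι] {ε : ι → ℝ}
    (hε : ∀ i, ε i ^ 2 = 1) :
    MeasurePreserving (fun (x : ι → ℝ) i => ε i * x i) (iidGaussian ι) (iidGaussian ι) := by
  rw [iidGaussian_eq_pi]
  refine measurePreserving_pi _ _ fun i => ⟨by fun_prop, ?_⟩
  rw [gaussianReal_map_const_mul]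
  congr 1
  · simp
  · ext; simp [hε]

end

/-! ### Random ranks and signs -/

section
variable {m : ℕ}

/-- The number of entries of `g` below `g j`. -/
def rankOf (g : Fin m → ℝ) (j : Fin m) : Fin m :=
  ⟨(Finset.univ.filter fun l => g l < g j).card, by
    have : Finset.univ.filter (fun l => g l < g j) ⊂ Finset.univ :=
      Finset.filter_ssubset.2 ⟨j, Finset.mem_univ j, lt_irrefl _⟩
    simpa using Finset.card_lt_card this⟩

theorem rankOf_injective {g : Fin m → ℝ} (hg : g.Injective) : Function.Injective (rankOf g) := by
  have key : ∀ i j, g i < g j → rankOf g i < rankOf g j := by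
    intro i j hij
    simp only [Fin.lt_def, rankOf]
    refine Finset.card_lt_card (Finset.ssubset_iff_of_subset ?_ |>.2 ⟨i, ?_, ?_⟩)
    · intro l; simp only [Finset.mem_filter, Finset.mem_univ, true_and]
      exact fun h => h.trans hij
    · simpa using hij
    · simp
  intro i j hij
  by_contra hne
  rcases lt_or_gt_of_ne (fun h => hne (hg h) : g i ≠ g j) with h | h
  · exact (key i j h).ne hij
  · exact (key j i h).ne hij.symm

theorem rankOf_bijective {g : Fin m → ℝ} (hg : g.Injective) : Function.Bijective (rankOf g) :=
  Finite.injective_iff_bijective.1 (rankOf_injective hg)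

/-- Equivariance of ranks, which transfers the exchangeability of the Gaussians to the random
permutation. -/
theorem rankOf_comp (g : Fin m → ℝ) (π : Equiv.Perm (Fin m)) (j : Fin m) :
    rankOf (fun l => g (π l)) j = rankOf g (π j) := by
  apply Fin.ext
  simp only [rankOf]
  refine Finset.card_bij (fun l _ => π l) ?_ (fun _ _ _ _ h => π.injective h) ?_
  · simp
  · intro b hb
    exact ⟨π.symm b, by simpa using hb, by simp⟩

theorem measurable_rankOf (j : Fin m) : Measurable fun g : Fin m → ℝ => rankOf g j := by
  have h : Measurable fun g : Fin m → ℝ => ((rankOf g j : Fin m) : ℕ) := by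
    simp only [rankOf, Finset.card_filter]
    exact Finset.measurable_sum _ fun l _ => Measurable.ite
      (measurableSet_lt (measurable_pi_apply l) (measurable_pi_apply j))
      measurable_const measurable_const
  refine measurable_to_countable' fun c => ?_
  have : (fun g : Fin m → ℝ => rankOf g j) ⁻¹' {c} =
      (fun g : Fin m → ℝ => ((rankOf g j : Fin m) : ℕ)) ⁻¹' {(c : ℕ)} := by
    ext g; simp [Fin.ext_iff]
  rw [this]
  exact h (measurableSet_singleton _)

/-- A random sign. -/
def coin (x : ℝ) : ℝ := if x < 0 then -1 else 1

theorem coin_sq (x : ℝ) : coin x ^ 2 = 1 := by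
  unfold coin; split_ifs <;> norm_num

theorem coin_mul_self (x : ℝ) : coin x * coin x = 1 := by
  rw [← sq, coin_sq]

theorem measurable_coin : Measurable coin :=
  Measurable.ite measurableSet_Iio measurable_const measurable_const

/-- At `x = 0` and `ε = -1` this fails, since `coin 0 = 1`; Gaussians avoid 0 almost surely. -/
theorem coin_mul {ε x : ℝ} (hε : ε = 1 ∨ ε = -1) (hx : x ≠ 0) : coin (ε * x) = ε * coin x := by
  rcases hε with rfl | rfl
  · simp
  · unfold coin
    rcases lt_or_gt_of_ne hx with h | h
    · rw [if_neg (by linarith), if_pos h]; norm_num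
    · rw [if_pos (by linarith), if_neg (by linarith)]; norm_num

/-- Permute the entries of `u` by the ranks of `g`, and multiply them with the signs of `h`. -/
def shuffle (u g h : Fin m → ℝ) : Signal m := fun j => coin (h j) * u (rankOf g j)

theorem measurable_shuffle :
    Measurable fun x : (Fin m → ℝ) × (Fin m → ℝ) × (Fin m → ℝ) => shuffle x.1 x.2.1 x.2.2 := by
  refine measurable_pi_lambda _ fun j => Measurable.mul ?_ ?_
  · exact measurable_coin.comp ((measurable_pi_apply j).comp measurable_snd.snd)
  · have : Measurable fun q : (Fin m → ℝ) × Fin m => q.1 q.2 :=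
      measurable_from_prod_countable_left fun l => measurable_pi_apply l
    exact this.comp (measurable_fst.prodMk ((measurable_rankOf j).comp measurable_snd.fst))

/-- A signed permutation of the coordinates. -/
def signedPerm (ε : Fin m → ℝ) (π : Equiv.Perm (Fin m)) (β : Signal m) : Signal m :=
  fun j => ε j * β (π j)

theorem measurable_signedPerm (ε : Fin m → ℝ) (π : Equiv.Perm (Fin m)) :
    Measurable (signedPerm ε π) := by
  unfold signedPerm; fun_prop

theorem signedPerm_injective {ε : Fin m → ℝ} (hε : ∀ j, ε j = 1 ∨ ε j = -1)
    (π : Equiv.Perm (Fin m)) : Function.Injective (signedPerm ε π) := by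
  intro β β' h
  funext j
  have := congrFun h (π.symm j)
  have h0 : ε (π.symm j) ≠ 0 := by rcases hε (π.symm j) with h | h <;> rw [h] <;> norm_num
  simpa [signedPerm, h0] using this

/-- The law of a pair of shuffled vectors. -/
def shuffleLaw (u u' : Fin m → ℝ) : Measure (Signal m × Signal m) :=
  ((iidGaussian (Fin m)).prod (iidGaussian (Fin m))).map
    fun x => (shuffle u x.1 x.2, shuffle u' x.1 x.2)

theorem measurable_shuffle_pair (u u' : Fin m → ℝ) :
    Measurable fun x : (Fin m → ℝ) × (Fin m → ℝ) => (shuffle u x.1 x.2, shuffle u' x.1 x.2) :=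
  (measurable_shuffle.comp (measurable_const.prodMk measurable_id)).prodMk
    (measurable_shuffle.comp (measurable_const.prodMk measurable_id))

instance shuffleLaw.instIsProbabilityMeasure (u u' : Fin m → ℝ) :
    IsProbabilityMeasure (shuffleLaw u u') :=
  Measure.isProbabilityMeasure_map (measurable_shuffle_pair u u').aemeasurable

/-- A signed permutation of a shuffle by `g`, `h` is almost surely the shuffle by `g ∘ π` and `ε ·
(h ∘ π)`, and the law of the two Gaussian vectors is invariant under this change. -/
theorem shuffleLaw_map_signedPerm (u u' : Fin m → ℝ) {ε : Fin m → ℝ}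
    (hε : ∀ j, ε j = 1 ∨ ε j = -1) (π : Equiv.Perm (Fin m)) :
    (shuffleLaw u u').map (Prod.map (signedPerm ε π) (signedPerm ε π)) = shuffleLaw u u' := by
  have hT := (measurable_signedPerm ε π).prodMap (measurable_signedPerm ε π)
  have hmp : MeasurePreserving (fun x : (Fin m → ℝ) × (Fin m → ℝ) =>
      ((fun j => x.1 (π j)), fun j => ε j * x.2 (π j)))
      ((iidGaussian (Fin m)).prod (iidGaussian (Fin m)))
      ((iidGaussian (Fin m)).prod (iidGaussian (Fin m))) :=
    (measurePreserving_iidGaussian_comp π.injective).prod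
      ((measurePreserving_iidGaussian_mul (fun i => by rcases hε i with h | h <;> simp [h])).comp
        (measurePreserving_iidGaussian_comp π.injective))
  conv_rhs => rw [shuffleLaw, ← hmp.map_eq, Measure.map_map (measurable_shuffle_pair u u')
    hmp.measurable]
  rw [shuffleLaw, Measure.map_map hT (measurable_shuffle_pair u u')]
  refine Measure.map_congr ?_
  have hz : ∀ᵐ x ∂((iidGaussian (Fin m)).prod (iidGaussian (Fin m))), ∀ i, x.2 i ≠ 0 :=
    measurePreserving_snd.quasiMeasurePreserving.ae iidGaussian_ae_ne_zero
  filter_upwards [hz] with x hx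
  simp only [Function.comp, Prod.map, Prod.mk.injEq]
  constructor <;>
  · funext j
    simp only [signedPerm, shuffle, rankOf_comp, coin_mul (hε j) (hx _)]
    ring

end

/-- Injectivity makes {x} the preimage of {T x}, so invariance gives all points of `E` the same
mass; as `E` is finite and carries the whole mass, the law is determined. -/
theorem eq_uniformOn_of_transitive {Ω : Type*} [MeasurableSpace Ω] [MeasurableSingletonClass Ω]
    {ν : Measure Ω} [IsProbabilityMeasure ν] {E : Set Ω} (hE : E.Finite) (hν : ∀ᵐ x ∂ν, x ∈ E)
    (h : ∀ x ∈ E, ∀ y ∈ E, ∃ T : Ω → Ω, Measurable T ∧ T.Injective ∧ ν.map T = ν ∧ T x = y) :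
    ν = uniformOn E := by
  have hsing : ∀ x ∈ E, ∀ y ∈ E, ν {x} = ν {y} := by
    intro x hx y hy
    obtain ⟨T, hT, hinj, hmap, rfl⟩ := h x hx y hy
    conv_rhs => rw [← hmap, Measure.map_apply hT (measurableSet_singleton _)]
    congr 1
    ext z
    simpa using (hinj.eq_iff (a := z) (b := x)).symm
  have hνE : ν E = 1 := prob_compl_eq_zero_iff hE.measurableSet |>.1 hν
  have hne : E.Nonempty := by
    by_contra h
    rw [Set.not_nonempty_iff_eq_empty.1 h] at hνE
    simp at hνE
  obtain ⟨x₀, hx₀⟩ := hne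
  have hfin : ∀ F ⊆ E, ν F = F.ncard * ν {x₀} := by
    intro F hF
    have hF' := hE.subset hF
    have : ν F = ∑ x ∈ hF'.toFinset, ν {x} := by
      rw [sum_measure_singleton, Set.Finite.coe_toFinset]
    rw [this, Finset.sum_congr rfl fun x hx => hsing x (hF (hF'.mem_toFinset.1 hx)) x₀ hx₀,
      Finset.sum_const, nsmul_eq_mul, Set.ncard_eq_toFinset_card F hF']
  have hc : (E.ncard : ℝ≥0∞) ≠ 0 := by
    simpa using (Set.ncard_ne_zero_of_mem hx₀ hE)
  have hx0 : ν {x₀} = (E.ncard : ℝ≥0∞)⁻¹ := by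
    have := hfin E le_rfl
    rw [hνE] at this
    exact ENNReal.eq_inv_of_mul_eq_one_left (by rw [mul_comm]; exact this.symm)
  ext s hs
  have h1 : ν s = ν (E ∩ s) := by
    rw [Set.inter_comm]
    exact (measure_inter_conull hν).symm
  rw [h1, hfin _ Set.inter_subset_left, hx0, uniformOn, cond_apply hE.measurableSet]
  have hcount : ∀ F ⊆ E, (Measure.count F : ℝ≥0∞) = F.ncard := by
    intro F hF
    rw [Measure.count_apply_finite F (hE.subset hF), Set.ncard_eq_toFinset_card F (hE.subset hF)]
  rw [hcount E le_rfl, hcount _ Set.inter_subset_left, mul_comm]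

end

noncomputable section

/-! ### Pairs of sparse sign vectors with common support -/

section
variable {m K : ℕ}

theorem sum_sq_eq_ncard_support {β : Signal m} (h : ∀ j, β j = -1 ∨ β j = 0 ∨ β j = 1) :
    ∑ j, β j ^ 2 = ((Function.support β).ncard : ℝ) := by
  classical
  have : Function.support β = ((Finset.univ.filter fun j => β j ≠ 0 : Finset (Fin m)) : Set _) := by
    ext; simp
  rw [this, Set.ncard_coe_finset, Finset.card_filter, Nat.cast_sum]
  refine Finset.sum_congr rfl fun j _ => ?_
  rcases h j with h | h | h <;> simp [h]

theorem mem_sparseSigns_iff {β : Signal m} :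
    β ∈ sparseSigns m K ↔ (∀ j, β j = -1 ∨ β j = 0 ∨ β j = 1) ∧ ∑ j, β j ^ 2 = K := by
  refine and_congr_right fun h => ?_
  rw [sum_sq_eq_ncard_support h, Nat.cast_inj]

theorem sparseSigns_finite (m K : ℕ) : (sparseSigns m K).Finite := by
  refine Set.Finite.subset (Set.Finite.pi' fun _ : Fin m => ({-1, 0, 1} : Set ℝ).toFinite) ?_
  intro β hβ j
  simpa using hβ.1 j

theorem sparseSigns_nonempty (h : K ≤ m) : (sparseSigns m K).Nonempty := by
  refine ⟨fun j => if (j : ℕ) < K then 1 else 0, mem_sparseSigns_iff.2 ⟨fun j => ?_, ?_⟩⟩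
  · split_ifs <;> simp
  · have : ∀ j : Fin m, (if (j : ℕ) < K then (1 : ℝ) else 0) ^ 2 =
        if (j : ℕ) < K then (1 : ℝ) else 0 := fun j => by split_ifs <;> simp
    rw [Finset.sum_congr rfl fun j _ => this j,
      Fin.sum_univ_eq_sum_range (fun j => if j < K then (1 : ℝ) else 0) m, Finset.sum_ite,
      Finset.sum_const_zero, add_zero, Finset.sum_const, nsmul_eq_mul, mul_one]
    have : (Finset.range m).filter (· < K) = Finset.range K := by
      ext; simp; omega
    rw [this, Finset.card_range]

/-- The pairs of `K`-sparse sign vectors with equal supports and `a` opposite entries. -/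
def oppositePairs (m K a : ℕ) : Set (Signal m × Signal m) :=
  {b | b.1 ∈ sparseSigns m K ∧ b.2 ∈ sparseSigns m K ∧
    Function.support b.1 = Function.support b.2 ∧ ∑ j, b.1 j * b.2 j = K - 2 * a}

/-- An intersection as large as each support forces equal supports; the signed overlap then says
that the inner product is (K - a) - a. -/
theorem overlapPrior_eq (hK : 0 < K) (a : ℕ) :
    overlapPrior m K 1 (1 - 2 * (a : ℝ) / K) = uniformOn (oppositePairs m K a) := by
  unfold overlapPrior
  congr 1
  ext b
  have hK' : (K : ℝ) ≠ 0 := by positivity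
  simp only [oppositePairs, Set.mem_ofPred_eq, dotProduct]
  refine and_congr_right fun h1 => and_congr_right fun h2 => ?_
  have key : ((Function.support b.1 ∩ Function.support b.2).ncard : ℝ) = 1 * K ↔
      Function.support b.1 = Function.support b.2 := by
    rw [one_mul, Nat.cast_inj]
    constructor
    · intro h
      have e1 := Set.eq_of_subset_of_ncard_le (Set.inter_subset_left (s := Function.support b.1)
        (t := Function.support b.2)) (by rw [h, h1.2]) (Set.toFinite _)
      have e2 := Set.eq_of_subset_of_ncard_le (Set.inter_subset_right (s := Function.support b.1)
        (t := Function.support b.2)) (by rw [h, h2.2]) (Set.toFinite _)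
      rw [← e1, e2]
    · intro h
      rw [h, Set.inter_self, h2.2]
  rw [key]
  refine and_congr_right fun h => ?_
  rw [h, Set.inter_self, h2.2]
  have : (1 - 2 * (a : ℝ) / K) * K = K - 2 * a := by field_simp
  rw [this]

theorem oppositePairs_finite (m K a : ℕ) : (oppositePairs m K a).Finite :=
  ((sparseSigns_finite m K).prod (sparseSigns_finite m K)).subset fun _ h => ⟨h.1, h.2.1⟩

theorem signedPerm_mem_sparseSigns {ε : Fin m → ℝ} (hε : ∀ j, ε j = 1 ∨ ε j = -1)
    (π : Equiv.Perm (Fin m)) {β : Signal m} (h : β ∈ sparseSigns m K) :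
    signedPerm ε π β ∈ sparseSigns m K := by
  rw [mem_sparseSigns_iff] at h ⊢
  refine ⟨fun j => ?_, ?_⟩
  · rcases hε j with e | e <;> rcases h.1 (π j) with b | b | b <;> simp [signedPerm, e, b]
  · rw [← h.2, ← Equiv.sum_comp π fun j => β j ^ 2]
    refine Finset.sum_congr rfl fun j _ => ?_
    rcases hε j with e | e <;> simp [signedPerm, e]

theorem signedPerm_mem_oppositePairs {ε : Fin m → ℝ} (hε : ∀ j, ε j = 1 ∨ ε j = -1)
    (π : Equiv.Perm (Fin m)) {a : ℕ} {b : Signal m × Signal m} (h : b ∈ oppositePairs m K a) :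
    Prod.map (signedPerm ε π) (signedPerm ε π) b ∈ oppositePairs m K a := by
  refine ⟨signedPerm_mem_sparseSigns hε π h.1, signedPerm_mem_sparseSigns hε π h.2.1, ?_, ?_⟩
  · ext j
    have := Set.ext_iff.1 h.2.2.1 (π j)
    have h0 : ε j ≠ 0 := by rcases hε j with h | h <;> rw [h] <;> norm_num
    simpa [signedPerm, h0] using this
  · rw [← h.2.2.2, ← Equiv.sum_comp π fun j => b.1 j * b.2 j]
    refine Finset.sum_congr rfl fun j _ => ?_
    rcases hε j with e | e <;> simp [signedPerm, e]

/-- With equal supports the products β₁β₂ lie in {-1, 0, 1}, and the indicators of these values are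
affine combinations of β₁² and β₁β₂, whose sums are K and K - 2a. -/
theorem card_filter_mul {a : ℕ} {b : Signal m × Signal m} (h : b ∈ oppositePairs m K a) (c : ℝ) :
    ((Finset.univ.filter fun j => b.1 j * b.2 j = c).card : ℝ) =
      if c = 0 then (m : ℝ) - K else if c = 1 then (K : ℝ) - a else if c = -1 then (a : ℝ)
      else 0 := by
  have hk : ∀ j, (b.1 j * b.2 j = 0 ∧ b.1 j ^ 2 = 0) ∨
      (b.1 j * b.2 j = 1 ∧ b.1 j ^ 2 = 1) ∨ (b.1 j * b.2 j = -1 ∧ b.1 j ^ 2 = 1) := by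
    intro j
    have hs := Set.ext_iff.1 h.2.2.1 j
    simp only [Function.mem_support] at hs
    rcases h.1.1 j with e | e | e <;> rcases h.2.1.1 j with f | f | f <;> simp_all
  have h1 := (mem_sparseSigns_iff.1 h.1).2
  have h2 := h.2.2.2
  rw [Finset.card_filter, Nat.cast_sum]
  split_ifs with c0 c1 c2
  · subst c0
    have : ∑ j : Fin m, ((if b.1 j * b.2 j = 0 then 1 else 0 : ℕ) : ℝ) =
        ∑ j : Fin m, (1 - b.1 j ^ 2) := Finset.sum_congr rfl fun j _ => by
      rcases hk j with ⟨e, f⟩ | ⟨e, f⟩ | ⟨e, f⟩ <;> norm_num [e, f]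
    rw [this, Finset.sum_sub_distrib, h1]; simp
  · subst c1
    have : ∑ j : Fin m, ((if b.1 j * b.2 j = 1 then 1 else 0 : ℕ) : ℝ) =
        ∑ j : Fin m, ((1 / 2) * b.1 j ^ 2 + (1 / 2) * (b.1 j * b.2 j)) :=
      Finset.sum_congr rfl fun j _ => by
        rcases hk j with ⟨e, f⟩ | ⟨e, f⟩ | ⟨e, f⟩ <;> norm_num [e, f]
    rw [this, Finset.sum_add_distrib, ← Finset.mul_sum, ← Finset.mul_sum, h1, h2]; ring
  · subst c2
    have : ∑ j : Fin m, ((if b.1 j * b.2 j = -1 then 1 else 0 : ℕ) : ℝ) =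
        ∑ j : Fin m, ((1 / 2) * b.1 j ^ 2 - (1 / 2) * (b.1 j * b.2 j)) :=
      Finset.sum_congr rfl fun j _ => by
        rcases hk j with ⟨e, f⟩ | ⟨e, f⟩ | ⟨e, f⟩ <;> norm_num [e, f]
    rw [this, Finset.sum_sub_distrib, ← Finset.mul_sum, ← Finset.mul_sum, h1, h2]; ring
  · refine Finset.sum_eq_zero fun j _ => ?_
    rw [if_neg]
    · simp
    · rcases hk j with ⟨e, f⟩ | ⟨e, f⟩ | ⟨e, f⟩ <;> rw [e] <;> tauto

theorem card_filter_mul_eq {a : ℕ} {b b' : Signal m × Signal m} (h : b ∈ oppositePairs m K a)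
    (h' : b' ∈ oppositePairs m K a) (c : ℝ) :
    (Finset.univ.filter fun j => b.1 j * b.2 j = c).card =
      (Finset.univ.filter fun j => b'.1 j * b'.2 j = c).card := by
  exact_mod_cast (card_filter_mul h c).trans (card_filter_mul h' c).symm

/-- The signed permutations act transitively: match coordinates with equal products β₁β₂, fibre by
fibre. Matched pairs of entries then differ by a common sign, which `ε` corrects. -/
theorem exists_signedPerm {a : ℕ} {b b' : Signal m × Signal m} (h : b ∈ oppositePairs m K a)
    (h' : b' ∈ oppositePairs m K a) : ∃ (ε : Fin m → ℝ) (π : Equiv.Perm (Fin m)),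
      (∀ j, ε j = 1 ∨ ε j = -1) ∧ Prod.map (signedPerm ε π) (signedPerm ε π) b = b' := by
  have hcard : ∀ c : ℝ, Nonempty ({j // b'.1 j * b'.2 j = c} ≃ {j // b.1 j * b.2 j = c}) := by
    intro c
    refine ⟨Fintype.equivOfCardEq ?_⟩
    rw [Fintype.card_subtype, Fintype.card_subtype, card_filter_mul_eq h' h]
  let π : Equiv.Perm (Fin m) := Equiv.ofFiberEquiv fun c => (hcard c).some
  have hπ : ∀ j, b.1 (π j) * b.2 (π j) = b'.1 j * b'.2 j :=
    fun j => Equiv.ofFiberEquiv_map (f := fun j => b'.1 j * b'.2 j)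
      (g := fun j => b.1 j * b.2 j) (fun c => (hcard c).some) j
  have key : ∀ j, ((if b'.1 j = 0 then 1 else b'.1 j * b.1 (π j)) = 1 ∨
      (if b'.1 j = 0 then 1 else b'.1 j * b.1 (π j)) = -1) ∧
      (if b'.1 j = 0 then 1 else b'.1 j * b.1 (π j)) * b.1 (π j) = b'.1 j ∧
      (if b'.1 j = 0 then 1 else b'.1 j * b.1 (π j)) * b.2 (π j) = b'.2 j := by
    intro j
    have hs := Set.ext_iff.1 h.2.2.1 (π j)
    have hs' := Set.ext_iff.1 h'.2.2.1 j
    have hp := hπ j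
    simp only [Function.mem_support] at hs hs'
    rcases h.1.1 (π j) with e | e | e <;> rcases h.2.1.1 (π j) with f | f | f <;>
      rcases h'.1.1 j with e' | e' | e' <;> rcases h'.2.1.1 j with f' | f' | f' <;>
      simp only [e, f, e', f'] at hs hs' hp ⊢ <;> norm_num at *
  exact ⟨fun j => if b'.1 j = 0 then 1 else b'.1 j * b.1 (π j), π, fun j => (key j).1,
    Prod.ext (funext fun j => (key j).2.1) (funext fun j => (key j).2.2)⟩

theorem shuffle_eq_signedPerm (u : Fin m → ℝ) {g : Fin m → ℝ} (hg : g.Injective)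
    (h : Fin m → ℝ) : shuffle u g h =
      signedPerm (fun j => coin (h j)) (Equiv.ofBijective _ (rankOf_bijective hg)) u := rfl

theorem coin_eq (x : ℝ) : coin x = 1 ∨ coin x = -1 := by
  unfold coin; split_ifs <;> simp

theorem ae_map_mem {α β : Type*} [MeasurableSpace α] [MeasurableSpace β] {μ : Measure α} {f : α → β}
    (hf : Measurable f) {s : Set β} (hs : MeasurableSet s) (h : ∀ᵐ x ∂μ, f x ∈ s) :
    ∀ᵐ y ∂μ.map f, y ∈ s :=
  (ae_map_iff hf.aemeasurable hs).2 h

/-- Shuffling turns any pair into a uniformly distributed one. -/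
theorem shuffleLaw_eq_uniformOn {a : ℕ} {u u' : Fin m → ℝ} (hu : (u, u') ∈ oppositePairs m K a) :
    shuffleLaw u u' = uniformOn (oppositePairs m K a) := by
  refine eq_uniformOn_of_transitive (oppositePairs_finite m K a) ?_ fun b h b' h' => ?_
  · refine ae_map_mem (measurable_shuffle_pair u u') (oppositePairs_finite m K a).measurableSet ?_
    have hi : ∀ᵐ x ∂((iidGaussian (Fin m)).prod (iidGaussian (Fin m))), x.1.Injective :=
      measurePreserving_fst.quasiMeasurePreserving.ae iidGaussian_ae_injective
    filter_upwards [hi] with x hx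
    rw [shuffle_eq_signedPerm u hx, shuffle_eq_signedPerm u' hx]
    exact signedPerm_mem_oppositePairs (fun j => coin_eq _) _ hu
  · obtain ⟨ε, π, hε, hT⟩ := exists_signedPerm h h'
    exact ⟨_, (measurable_signedPerm ε π).prodMap (measurable_signedPerm ε π),
      (signedPerm_injective hε π).prodMap (signedPerm_injective hε π),
      shuffleLaw_map_signedPerm u u' hε π, hT⟩

theorem exists_signedPerm_single {β β' : Signal m} (h : β ∈ sparseSigns m K)
    (h' : β' ∈ sparseSigns m K) : ∃ (ε : Fin m → ℝ) (π : Equiv.Perm (Fin m)),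
      (∀ j, ε j = 1 ∨ ε j = -1) ∧ signedPerm ε π β = β' := by
  -- A single vector is treated as a pair without opposite entries.
  have key : ∀ β ∈ sparseSigns m K, (β, β) ∈ oppositePairs m K 0 := by
    intro β h
    refine ⟨h, h, rfl, ?_⟩
    have := (mem_sparseSigns_iff.1 h).2
    simpa [sq] using this
  obtain ⟨ε, π, hε, hT⟩ := exists_signedPerm (key β h) (key β' h')
  exact ⟨ε, π, hε, congrArg Prod.fst hT⟩

theorem append_mem_sparseSigns {p d k : ℕ} {β : Signal p} (h : β ∈ sparseSigns p k) :
    (Fin.append β fun _ : Fin d => (1 : ℝ)) ∈ sparseSigns (p + d) (k + d) := by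
  rw [mem_sparseSigns_iff] at h ⊢
  refine ⟨fun j => ?_, ?_⟩
  · refine Fin.addCases (fun i => ?_) (fun i => ?_) j
    · simpa using h.1 i
    · simp
  · rw [Fin.sum_univ_add]
    simp [h.2]

theorem neg_mem_sparseSigns {p k : ℕ} {β : Signal p} (h : β ∈ sparseSigns p k) :
    -β ∈ sparseSigns p k := by
  rw [mem_sparseSigns_iff] at h ⊢
  refine ⟨fun j => ?_, by simpa using h.2⟩
  rcases h.1 j with e | e | e <;> simp [e]

theorem append_mem_oppositePairs {p d k : ℕ} {β : Signal p} (h : β ∈ sparseSigns p k) :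
    ((Fin.append β fun _ : Fin d => (1 : ℝ)), (Fin.append (-β) fun _ : Fin d => (1 : ℝ))) ∈
      oppositePairs (p + d) (k + d) k := by
  refine ⟨append_mem_sparseSigns h, append_mem_sparseSigns (neg_mem_sparseSigns h), ?_, ?_⟩
  · ext j
    refine Fin.addCases (fun i => ?_) (fun i => ?_) j <;> simp
  · have := (mem_sparseSigns_iff.1 h).2
    rw [Fin.sum_univ_add]
    simp only [Fin.append_left, Fin.append_right, Pi.neg_apply, mul_neg, ← sq,
      Finset.sum_neg_distrib, this]
    simp
    ring

/-- The uniform prior on pairs with equal supports and `k` opposite entries is partially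
symmetric. -/
theorem isPartiallySymmetricPrior_uniformOn {p d k : ℕ} (hk : k ≤ p) :
    IsPartiallySymmetricPrior (p + d) (k + d) k (uniformOn (oppositePairs (p + d) (k + d) k)) := by
  obtain ⟨β, hβ⟩ := sparseSigns_nonempty hk
  have hu := append_mem_oppositePairs (d := d) hβ
  have hlaw := shuffleLaw_eq_uniformOn hu
  set u := Fin.append β fun _ : Fin d => (1 : ℝ)
  set u' := Fin.append (-β) fun _ : Fin d => (1 : ℝ)
  have hprob : IsProbabilityMeasure (uniformOn (oppositePairs (p + d) (k + d) k)) :=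
    hlaw ▸ inferInstance
  have hae : ∀ᵐ b ∂uniformOn (oppositePairs (p + d) (k + d) k),
      b ∈ oppositePairs (p + d) (k + d) k := by
    have h1 : uniformOn (oppositePairs (p + d) (k + d) k) (oppositePairs (p + d) (k + d) k) = 1 :=
      uniformOn_self (oppositePairs_finite _ _ _) ⟨_, hu⟩
    exact (prob_compl_eq_zero_iff (oppositePairs_finite _ _ _).measurableSet).2 h1
  -- A marginal inherits the invariance under signed permutations, which are transitive on single
  -- sparse vectors as well.
  have hmarg : ∀ f : Signal (p + d) × Signal (p + d) → Signal (p + d), Measurable f →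
      (∀ b ∈ oppositePairs (p + d) (k + d) k, f b ∈ sparseSigns (p + d) (k + d)) →
      (∀ ε π, f ∘ Prod.map (signedPerm ε π) (signedPerm ε π) = signedPerm ε π ∘ f) →
      (uniformOn (oppositePairs (p + d) (k + d) k)).map f =
        uniformOn (sparseSigns (p + d) (k + d)) := by
    intro f hf hfE hfT
    have : IsProbabilityMeasure ((uniformOn (oppositePairs (p + d) (k + d) k)).map f) :=
      Measure.isProbabilityMeasure_map hf.aemeasurable
    refine eq_uniformOn_of_transitive (sparseSigns_finite _ _) ?_ fun x hx y hy => ?_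
    · refine ae_map_mem hf (sparseSigns_finite _ _).measurableSet ?_
      filter_upwards [hae] with b hb using hfE b hb
    · obtain ⟨ε, π, hε, hT⟩ := exists_signedPerm_single hx hy
      refine ⟨_, measurable_signedPerm ε π, signedPerm_injective hε π, ?_, hT⟩
      rw [Measure.map_map (measurable_signedPerm ε π) hf, ← hfT ε π,
        ← Measure.map_map hf ((measurable_signedPerm ε π).prodMap (measurable_signedPerm ε π)),
        ← hlaw, shuffleLaw_map_signedPerm u u' hε π]
  refine ⟨⟨hprob, hmarg _ measurable_fst (fun b hb => hb.1) fun _ _ => rfl,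
    hmarg _ measurable_snd (fun b hb => hb.2.1) fun _ _ => rfl⟩, ?_⟩
  filter_upwards [hae] with b hb
  have hset : oppositeSet b.1 b.2 = (({j | b.1 j * b.2 j = -1} : Finset _) : Set (Fin (p + d))) := by
    ext j
    have hs := Set.ext_iff.1 hb.2.2.1 j
    simp only [oppositeSet, Set.mem_ofPred_eq, Set.mem_inter_iff, Function.mem_support] at hs ⊢
    rcases hb.1.1 j with e | e | e <;> rcases hb.2.1.1 j with f | f | f <;>
      norm_num [e, f]
  rw [hset, Set.ncard_coe_finset]
  have h1 := card_filter_mul hb (-1)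
  norm_num at h1
  exact h1

end

end

noncomputable section

/-! ### The law of the augmented data -/

section
variable {α β γ δ : Type*} [MeasurableSpace α] [MeasurableSpace β] [MeasurableSpace γ]
  [MeasurableSpace δ]

theorem measurePreserving_prodProdProdComm (μa : Measure α) (μb : Measure β) (μc : Measure γ)
    (μd : Measure δ) [SFinite μa] [SFinite μb] [SFinite μc] [SFinite μd] :
    MeasurePreserving (fun x : (α × β) × (γ × δ) => ((x.1.1, x.2.1), (x.1.2, x.2.2)))
      ((μa.prod μb).prod (μc.prod μd)) ((μa.prod μc).prod (μb.prod μd)) := by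
  have h1 := measurePreserving_prodAssoc μa μb (μc.prod μd)
  have h2 := (measurePreserving_prodAssoc μb μc μd).symm
  have h3 := (Measure.measurePreserving_swap (μ := μb) (ν := μc)).prod (MeasurePreserving.id μd)
  have h4 := measurePreserving_prodAssoc μc μb μd
  have h5 := (MeasurePreserving.id μa).prod (h4.comp (h3.comp h2))
  exact (measurePreserving_prodAssoc μa μc (μb.prod μd)).symm.comp (h5.comp h1)

end

theorem measurePreserving_append (p d : ℕ) :
    MeasurePreserving (fun x : (Fin p → ℝ) × (Fin d → ℝ) => Fin.append x.1 x.2)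
      ((iidGaussian (Fin p)).prod (iidGaussian (Fin d))) (iidGaussian (Fin (p + d))) := by
  have h := (measurePreserving_iidGaussian_comp (finSumFinEquiv (m := p) (n := d)).symm.injective).comp
    (measurePreserving_sumElim (ι := Fin p) (κ := Fin d))
  convert h using 1
  funext x j
  refine Fin.addCases (fun i => ?_) (fun i => ?_) j <;> simp

/-- With ranks and signs fixed, i.i.d. Gaussian entries stay i.i.d. Gaussian. As the resulting law
does not depend on the ranks and signs, the shuffled design is independent of the shuffled signals.
-/
theorem measurePreserving_shuffle {m : ℕ} {g : Fin m → ℝ} (hg : g.Injective) (h : Fin m → ℝ) :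
    MeasurePreserving (fun x => shuffle x g h) (iidGaussian (Fin m)) (iidGaussian (Fin m)) :=
  (measurePreserving_iidGaussian_mul fun j => coin_sq (h j)).comp
    (measurePreserving_iidGaussian_comp (rankOf_injective hg))

theorem measurePreserving_shuffle_design (n : ℕ) {p d : ℕ} {g : Fin (p + d) → ℝ}
    (hg : g.Injective) (h : Fin (p + d) → ℝ) :
    MeasurePreserving (fun (x : Design n p × Design n d) q =>
      shuffle (Fin.append (x.1 q) (x.2 q)) g h)
      ((designLaw n p).prod (designLaw n d)) (designLaw n (p + d)) := by
  simp only [designLaw_eq]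
  exact (measurePreserving_pi _ _ fun _ : Fin n =>
    (measurePreserving_shuffle hg h).comp (measurePreserving_append p d)).comp
    (measurePreserving_arrowProdEquivProdArrow (Fin p → ℝ) (Fin d → ℝ) (Fin n)
      (fun _ => iidGaussian (Fin p)) fun _ => iidGaussian (Fin d)).symm

theorem symmetricPrior.isProbabilityMeasure {p k : ℕ} (h : k ≤ p) :
    IsProbabilityMeasure (symmetricPrior p k) := by
  have := isProbabilityMeasure_uniformOn (sparseSigns_finite p k) (sparseSigns_nonempty h)
  exact Measure.isProbabilityMeasure_map (by fun_prop)

theorem symmetricPrior_ae {p k : ℕ} (h : k ≤ p) :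
    ∀ᵐ b ∂symmetricPrior p k, b.1 ∈ sparseSigns p k ∧ b.2 = -b.1 := by
  have hprob := isProbabilityMeasure_uniformOn (sparseSigns_finite p k) (sparseSigns_nonempty h)
  have hm : Measurable fun β : Signal p => (β, -β) := by fun_prop
  have hs : MeasurableSet {b : Signal p × Signal p | b.1 ∈ sparseSigns p k ∧ b.2 = -b.1} :=
    (measurable_fst (sparseSigns_finite p k).measurableSet).inter
      (measurableSet_eq_fun measurable_snd measurable_fst.neg)
  refine ae_map_mem hm hs ?_
  have h1 : uniformOn (sparseSigns p k) (sparseSigns p k) = 1 :=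
    uniformOn_self (sparseSigns_finite _ _) (sparseSigns_nonempty h)
  have h2 : ∀ᵐ β ∂uniformOn (sparseSigns p k), β ∈ sparseSigns p k :=
    (prob_compl_eq_zero_iff (sparseSigns_finite _ _).measurableSet).2 h1
  filter_upwards [h2] with β hβ using ⟨hβ, rfl⟩

/-- The pair of augmented and shuffled signals. -/
def augPair {p : ℕ} (d : ℕ) (b : Signal p × Signal p) (g h : Fin (p + d) → ℝ) :
    Signal (p + d) × Signal (p + d) :=
  (shuffle (Fin.append b.1 fun _ => 1) g h, shuffle (Fin.append b.2 fun _ => 1) g h)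

theorem measurable_append {α : Type*} [MeasurableSpace α] {p d : ℕ} {f : α → Fin p → ℝ}
    {f' : α → Fin d → ℝ} (hf : Measurable f) (hf' : Measurable f') :
    Measurable fun a => Fin.append (f a) (f' a) :=
  (measurePreserving_append p d).measurable.comp (hf.prodMk hf')

theorem measurable_augPair (p d : ℕ) :
    Measurable fun x : (Signal p × Signal p) × (Fin (p + d) → ℝ) × (Fin (p + d) → ℝ) =>
      augPair d x.1 x.2.1 x.2.2 := by
  have h : ∀ f : (Signal p × Signal p) × (Fin (p + d) → ℝ) × (Fin (p + d) → ℝ) → Signal p,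
      Measurable f → Measurable fun x => shuffle (Fin.append (f x) fun _ : Fin d => (1 : ℝ))
        x.2.1 x.2.2 := fun f hf =>
    measurable_shuffle.comp ((measurable_append (f' := fun _ _ => 1) hf measurable_const).prodMk
      measurable_snd)
  exact (h _ measurable_fst.fst).prodMk (h _ measurable_fst.snd)

/-- The shuffle alone yields the uniform law from every fixed symmetric pair, so averaging over the
prior changes nothing. -/
theorem measurePreserving_augPair {p k : ℕ} (hk : k ≤ p) (d : ℕ) :
    MeasurePreserving (fun x : (Signal p × Signal p) × (Fin (p + d) → ℝ) × (Fin (p + d) → ℝ) =>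
      augPair d x.1 x.2.1 x.2.2)
      ((symmetricPrior p k).prod ((iidGaussian (Fin (p + d))).prod (iidGaussian (Fin (p + d)))))
      (uniformOn (oppositePairs (p + d) (k + d) k)) := by
  have := symmetricPrior.isProbabilityMeasure hk
  refine ⟨measurable_augPair p d, ?_⟩
  ext s hs
  rw [Measure.map_apply (measurable_augPair p d) hs,
    Measure.prod_apply (measurable_augPair p d hs)]
  have h : ∀ᵐ b ∂symmetricPrior p k, ((iidGaussian (Fin (p + d))).prod (iidGaussian (Fin (p + d))))
      (Prod.mk b ⁻¹' ((fun x : (Signal p × Signal p) × (Fin (p + d) → ℝ) × (Fin (p + d) → ℝ) =>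
      augPair d x.1 x.2.1 x.2.2) ⁻¹' s)) = uniformOn (oppositePairs (p + d) (k + d) k) s := by
    filter_upwards [symmetricPrior_ae hk] with b hb
    rw [← shuffleLaw_eq_uniformOn (append_mem_oppositePairs (d := d) hb.1), shuffleLaw,
      Measure.map_apply (measurable_shuffle_pair _ _) hs]
    congr 1
    ext x
    simp [augPair, hb.2]
  rw [lintegral_congr_ae h]
  simp

theorem noiseLaw_scale {n : ℕ} (c : ℝ) :
    MeasurePreserving (fun (w : Fin n → ℝ) q => c * w q) (noiseLaw n 1)
      (noiseLaw n (Real.toNNReal (c ^ 2))) := by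
  refine measurePreserving_pi _ _ fun _ => ⟨by fun_prop, ?_⟩
  rw [gaussianReal_map_const_mul]
  congr 1
  · simp
  · ext
    simp [sq_nonneg]

theorem measurePreserving_pi_comp {ι κ : Type*} [Fintype ι] [Fintype κ] {α : Type*}
    [MeasurableSpace α] (μ : Measure α) [IsProbabilityMeasure μ] {f : κ → ι} (hf : f.Injective) :
    MeasurePreserving (fun (x : ι → α) k => x (f k)) (Measure.pi fun _ => μ)
      (Measure.pi fun _ => μ) := by
  refine ⟨by fun_prop, ?_⟩
  rw [← Measure.infinitePi_eq_pi, ← Measure.infinitePi_eq_pi]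
  exact Measure.map_infinitePi_infinitePi_of_inj hf

namespace Detector

variable {P : Params} {X : Design P.n P.p} {y : Fin P.n → ℝ} {ω : ℕ → ℝ} {d : ℕ}

/-- The Gaussians that determine the ranks. -/
def rankTape (P : Params) (d : ℕ) (ω : ℕ → ℝ) (l : Fin (P.p + d)) : ℝ := pre P ω P.n l

/-- The Gaussians that determine the signs. -/
def signTape (P : Params) (d : ℕ) (ω : ℕ → ℝ) (l : Fin (P.p + d)) : ℝ := pre P ω (P.n + 1) l

/-- The additional columns of the design. -/
def columns (P : Params) (n d : ℕ) (ω : ℕ → ℝ) : Design n d := fun q l => pre P ω q l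

/-- The pieces occupy disjoint positions of the tape: quotient and remainder modulo the width `2p +
1` separate the rows, and the tail starts after row `n + 1` of the predrawn block. Here `n` may be
smaller than the sample size because the recovery algorithm only sees the training rows. -/
theorem measurePreserving_tape (hd : d ≤ P.p) {n : ℕ} (hn : n ≤ P.n) :
    MeasurePreserving (fun ω => (((rankTape P d ω, signTape P d ω), columns P n d ω), tail P ω))
      tapeLaw ((((iidGaussian (Fin (P.p + d))).prod (iidGaussian (Fin (P.p + d)))).prod
        (designLaw n d)).prod tapeLaw) := by
  let f : ((Fin (P.p + d) ⊕ Fin (P.p + d)) ⊕ (Fin n × Fin d)) ⊕ ℕ → ℕ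
    | .inl (.inl (.inl l)) => P.n * (P.p + P.p + 1) + l
    | .inl (.inl (.inr l)) => (P.n + 1) * (P.p + P.p + 1) + l
    | .inl (.inr x) => x.1 * (P.p + P.p + 1) + x.2
    | .inr j => (P.n + 2) * (P.p + P.p + 1) + j
  have hinj : ∀ {q q' l l' : ℕ}, l < P.p + P.p + 1 → l' < P.p + P.p + 1 →
      q * (P.p + P.p + 1) + l = q' * (P.p + P.p + 1) + l' → q = q' ∧ l = l' := by
    intro q q' l l' hl hl' h
    have h1 := congrArg (· / (P.p + P.p + 1)) h
    have h2 := congrArg (· % (P.p + P.p + 1)) h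
    simp only [mul_comm _ (P.p + P.p + 1)] at h1 h2
    rw [Nat.mul_add_div (by omega), Nat.mul_add_div (by omega), Nat.div_eq_of_lt hl,
      Nat.div_eq_of_lt hl'] at h1
    rw [Nat.mul_add_mod, Nat.mul_add_mod, Nat.mod_eq_of_lt hl, Nat.mod_eq_of_lt hl'] at h2
    exact ⟨by simpa using h1, h2⟩
  have hlt : ∀ {q l j : ℕ}, q < P.n + 2 → l < P.p + P.p + 1 →
      q * (P.p + P.p + 1) + l ≠ (P.n + 2) * (P.p + P.p + 1) + j := by
    intro q l j hq hl
    have : (q + 1) * (P.p + P.p + 1) ≤ (P.n + 2) * (P.p + P.p + 1) :=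
      Nat.mul_le_mul_right _ hq
    rw [add_mul] at this
    omega
  have hf : f.Injective := by
    rintro (((l | l) | ⟨q, l⟩) | j) (((l' | l') | ⟨q', l'⟩) | j') h
    all_goals simp only [f] at h
    all_goals first
      | exact absurd h (hlt (by omega) (by omega))
      | exact absurd h.symm (hlt (by omega) (by omega))
      | (have h' := hinj (by omega) (by omega) h
         first
           | (exfalso; omega)
           | (obtain ⟨h1, h2⟩ := h'
              simp only [Fin.ext_iff, Sum.inl.injEq, Sum.inr.injEq, Prod.mk.injEq]
              omega))
      | (simp only [Sum.inr.injEq]; omega)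
  have h1 := measurePreserving_iidGaussian_comp hf
  have h2 := (((measurePreserving_sumSplit (ι := Fin (P.p + d)) (κ := Fin (P.p + d))).prod
    (measurePreserving_rows (n := n) (d := d))).comp measurePreserving_sumSplit).prod
    (MeasurePreserving.id (iidGaussian ℕ))
  exact (h2.comp measurePreserving_sumSplit).comp h1

/-- The augmented recovery problem as a function of the detection problem and the tape. -/
def augment (P : Params) (d : ℕ)
    (x : ((Signal P.p × Signal P.p) × Design P.n P.p × (Fin P.n → ℝ) × (Fin P.n → ℝ)) ×
      (ℕ → ℝ)) :
    ((Signal (guess P d).p × Signal (guess P d).p) × Design (guess P d).n (guess P d).p ×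
      (Fin (guess P d).n → ℝ) × (Fin (guess P d).n → ℝ)) × (ℕ → ℝ) :=
  ((augPair d x.1.1 (rankTape P d x.2) (signTape P d x.2),
    (fun q => shuffle (Fin.append (x.1.2.1 (train P d q)) (columns P (guess P d).n d x.2 q))
      (rankTape P d x.2) (signTape P d x.2)),
    (fun q => x.1.2.2.1 (train P d q)), fun q => P.σ * x.1.2.2.2 (train P d q)), tail P x.2)

/-- The map is a marginalisation to the training rows, a splitting of the tape, some reorderings of
factors, and one skew product over signals, ranks and signs. The fibres of the latter are shuffles
of a Gaussian design, which is where the probability enters. -/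
theorem measurePreserving_augment (hk : P.k ≤ P.p) (hd : d ≤ P.p) :
    MeasurePreserving (augment P d)
      ((mslrLaw P.n P.p (symmetricPrior P.p P.k) balanced 1).prod tapeLaw)
      ((mslrLaw (guess P d).n (guess P d).p
        (uniformOn (oppositePairs (P.p + d) (P.k + d) P.k)) balanced
        (Real.toNNReal (P.σ ^ 2))).prod tapeLaw) := by
  set n := (guess P d).n with hn
  have htr : Function.Injective (train P d) := Fin.castLE_injective (half_le P)
  have := symmetricPrior.isProbabilityMeasure hk
  have : IsProbabilityMeasure (uniformOn (oppositePairs (P.p + d) (P.k + d) P.k)) :=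
    (isPartiallySymmetricPrior_uniformOn hk).1.1
  set Γ := iidGaussian (Fin (P.p + d)) with hΓ
  set π := symmetricPrior P.p P.k
  have hX : MeasurePreserving (fun (X : Design P.n P.p) q => X (train P d q)) (designLaw P.n P.p)
      (designLaw n P.p) := measurePreserving_pi_comp _ htr
  have hz : MeasurePreserving (fun (z : Fin P.n → ℝ) q => z (train P d q)) (labelLaw P.n balanced)
      (labelLaw n balanced) := measurePreserving_pi_comp _ htr
  have hw : MeasurePreserving (fun (w : Fin P.n → ℝ) q => P.σ * w (train P d q)) (noiseLaw P.n 1)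
      (noiseLaw n (Real.toNNReal (P.σ ^ 2))) :=
    (noiseLaw_scale P.σ).comp (measurePreserving_pi_comp _ htr)
  set L := labelLaw n balanced
  set W := noiseLaw n (Real.toNNReal (P.σ ^ 2))
  -- marginalize and split the tape
  have h1 := ((MeasurePreserving.id π).prod (hX.prod (hz.prod hw))).prod
    (measurePreserving_tape (P := P) (n := n) hd (half_le P))
  -- rearrange
  have h2 := measurePreserving_prodProdProdComm π ((designLaw n P.p).prod (L.prod W))
    ((Γ.prod Γ).prod (designLaw n d)) tapeLaw
  have h3 := (measurePreserving_prodAssoc π (Γ.prod Γ) (designLaw n d)).symm.prod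
    (measurePreserving_prodAssoc (designLaw n P.p) (L.prod W) tapeLaw)
  have h4 := measurePreserving_prodProdProdComm (π.prod (Γ.prod Γ)) (designLaw n d)
    (designLaw n P.p) ((L.prod W).prod tapeLaw)
  have h5 := (measurePreserving_prodAssoc ((π.prod (Γ.prod Γ)).prod (designLaw n P.p))
    (designLaw n d) ((L.prod W).prod tapeLaw)).symm
  have h6 := (measurePreserving_prodAssoc (π.prod (Γ.prod Γ)) (designLaw n P.p)
    (designLaw n d)).prod (MeasurePreserving.id ((L.prod W).prod tapeLaw))
  -- shuffle
  have hgi : ∀ᵐ a ∂π.prod (Γ.prod Γ), a.2.1.Injective :=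
    (measurePreserving_fst.comp measurePreserving_snd).quasiMeasurePreserving.ae
      iidGaussian_ae_injective
  have h7 : MeasurePreserving (fun x : ((Signal P.p × Signal P.p) × (Fin (P.p + d) → ℝ) ×
      (Fin (P.p + d) → ℝ)) × (Design n P.p × Design n d) => (augPair d x.1.1 x.1.2.1 x.1.2.2,
        fun q => shuffle (Fin.append (x.2.1 q) (x.2.2 q)) x.1.2.1 x.1.2.2))
      ((π.prod (Γ.prod Γ)).prod ((designLaw n P.p).prod (designLaw n d)))
      ((uniformOn (oppositePairs (P.p + d) (P.k + d) P.k)).prod (designLaw n (P.p + d))) := by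
    refine (measurePreserving_augPair hk d).skew_product (g := fun a
      (x : Design n P.p × Design n d) q => shuffle (Fin.append (x.1 q) (x.2 q)) a.2.1 a.2.2) ?_ ?_
    · refine measurable_pi_lambda _ fun q => measurable_shuffle.comp (Measurable.prodMk ?_ ?_)
      · exact measurable_append ((measurable_pi_apply q).comp measurable_snd.fst)
          ((measurable_pi_apply q).comp measurable_snd.snd)
      · exact measurable_fst.snd
    · filter_upwards [hgi] with a ha
      exact (measurePreserving_shuffle_design n ha a.2.2).map_eq
  have h8 := h7.prod (MeasurePreserving.id ((L.prod W).prod tapeLaw))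
  -- rearrange
  set E := uniformOn (oppositePairs (P.p + d) (P.k + d) P.k)
  have h9 := (measurePreserving_prodAssoc (E.prod (designLaw n (P.p + d))) (L.prod W) tapeLaw).symm
  have h10 := (measurePreserving_prodAssoc E (designLaw n (P.p + d)) (L.prod W)).prod
    (MeasurePreserving.id tapeLaw)
  exact h10.comp (h9.comp (h8.comp (h6.comp (h5.comp (h4.comp (h3.comp (h2.comp h1)))))))

end Detector

end

noncomputable section

/-! ### The planted law -/

namespace Detector

variable {P : Params} {X : Design P.n P.p} {y : Fin P.n → ℝ} {ω : ℕ → ℝ} {d : ℕ}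

theorem rank_eq (j : Fin (P.p + d)) : rank P ω d j = rankOf (rankTape P d ω) j := by
  have h : (rankOf (rankTape P d ω) j : ℕ) =
      (Finset.univ.filter fun l => rankTape P d ω l < rankTape P d ω j).card := rfl
  rw [h, rank, Finset.card_filter, Finset.card_filter]
  exact (Fin.sum_univ_eq_sum_range
    (fun l => if pre P ω P.n l < pre P ω P.n j then 1 else 0) (P.p + d)).symm

theorem entry_eq (q : Fin P.n) (l : Fin (P.p + d)) :
    entry P X ω q l = Fin.append (X q) (columns P P.n d ω q) l := by
  refine Fin.addCases (fun i => ?_) (fun i => ?_) l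
  · simp [entry]
  · simp [entry, columns]

theorem augX_eq (q : Fin P.n) (j : Fin (P.p + d)) : augX P X ω d q j =
    shuffle (Fin.append (X q) (columns P P.n d ω q)) (rankTape P d ω) (signTape P d ω) j := by
  rw [augX, rank_eq, entry_eq]
  rfl

/-- The same signed permutation acts on both vectors, so inner products are preserved; hence
permuting the columns and the signals together leaves the responses unchanged. -/
theorem sum_shuffle_mul {m : ℕ} (u v : Fin m → ℝ) {g : Fin m → ℝ} (hg : g.Injective)
    (h : Fin m → ℝ) : ∑ j, shuffle u g h j * shuffle v g h j = ∑ j, u j * v j := by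
  rw [← Equiv.sum_comp (Equiv.ofBijective _ (rankOf_bijective hg)) fun j => u j * v j]
  refine Finset.sum_congr rfl fun j _ => ?_
  simp only [shuffle, Equiv.ofBijective_apply]
  linear_combination (u (rankOf g j) * v (rankOf g j)) * coin_mul_self (h j)

theorem sum_append_mul {p d : ℕ} (u v : Fin p → ℝ) (c : Fin d → ℝ) :
    ∑ j, Fin.append u c j * Fin.append v (fun _ => 1) j = u ⬝ᵥ v + ∑ l, c l := by
  rw [Fin.sum_univ_add]
  simp [dotProduct]

theorem sum_augX_mul (hg : (rankTape P d ω).Injective) (q : Fin P.n) (β : Signal P.p) :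
    ∑ j : Fin (P.p + d), augX P X ω d q j *
      shuffle (Fin.append β fun _ => 1) (rankTape P d ω) (signTape P d ω) j =
      X q ⬝ᵥ β + ∑ l ∈ Finset.range d, pre P ω q l := by
  simp only [augX_eq]
  rw [sum_shuffle_mul _ _ hg, sum_append_mul]
  congr 1
  exact Fin.sum_univ_eq_sum_range (fun l => pre P ω q l) d

/-- At the true pair, the residual for the component selected by the label is exactly `σ w q`: the
planted columns cancel against the sums added to the response. -/
theorem min_residual_le (hg : (rankTape P d ω).Injective) {b : Signal P.p × Signal P.p}
    {z w : Fin P.n → ℝ} {q : Fin P.n} (hz : z q = 1 ∨ z q = 0) :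
    min (residual P X (mslrResponse (1 / P.σ) b X z w) ω d
        (augPair d b (rankTape P d ω) (signTape P d ω)).1 q ^ 2)
      (residual P X (mslrResponse (1 / P.σ) b X z w) ω d
        (augPair d b (rankTape P d ω) (signTape P d ω)).2 q ^ 2) ≤ P.σ ^ 2 * w q ^ 2 := by
  have hσ := P.σ_pos.ne'
  have h1 : ∀ β : Signal P.p, residual P X (mslrResponse (1 / P.σ) b X z w) ω d
      (shuffle (Fin.append β fun _ => 1) (rankTape P d ω) (signTape P d ω)) q =
      P.σ * mslrResponse (1 / P.σ) b X z w q - X q ⬝ᵥ β := by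
    intro β
    refine (congrArg (augY P (mslrResponse (1 / P.σ) b X z w) ω d q - ·)
      (sum_augX_mul (X := X) hg q β)).trans ?_
    rw [augY]
    ring
  rcases hz with hz | hz
  · refine (min_le_left _ _).trans_eq ((congrArg (· ^ 2) (h1 b.1)).trans ?_)
    simp only [mslrResponse, hz]
    field_simp
    ring
  · refine (min_le_right _ _).trans_eq ((congrArg (· ^ 2) (h1 b.2)).trans ?_)
    simp only [mslrResponse, hz]
    field_simp
    ring

theorem loss_le (hg : (rankTape P d ω).Injective) {b : Signal P.p × Signal P.p}
    {z w : Fin P.n → ℝ} (hz : ∀ q, z q = 1 ∨ z q = 0) :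
    loss P X (mslrResponse (1 / P.σ) b X z w) ω d
        (augPair d b (rankTape P d ω) (signTape P d ω)) ≤
      ∑ q : Fin P.n, if (P.n + 1) / 2 ≤ (q : ℕ) then P.σ ^ 2 * w q ^ 2 else 0 := by
  refine Finset.sum_le_sum fun q _ => ?_
  split_ifs
  · exact min_residual_le hg (hz q)
  · exact le_rfl

theorem loss_nonneg (b : Signal (guess P d).p × Signal (guess P d).p) :
    0 ≤ loss P X y ω d b :=
  Finset.sum_nonneg fun q _ => by split_ifs <;> positivity

theorem loss_swap (b : Signal (guess P d).p × Signal (guess P d).p) :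
    loss P X y ω d (b.2, b.1) = loss P X y ω d b := by
  unfold loss
  simp only [min_comm]

theorem eq_or_eq_swap_of_pairError {p : ℕ} {b b' : Signal p × Signal p}
    (h : ¬ 0 < pairError b b') : b = b' ∨ b = (b'.2, b'.1) := by
  rw [not_lt, pairError, min_le_iff] at h
  have key : ∀ u v : Signal p, ∀ x y : Signal p, ‖u - v‖ + ‖x - y‖ ≤ 0 → u = v ∧ x = y := by
    intro u v x y h
    have h1 := norm_nonneg (u - v)
    have h2 := norm_nonneg (x - y)
    exact ⟨sub_eq_zero.1 (norm_eq_zero.1 (by linarith)),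
      sub_eq_zero.1 (norm_eq_zero.1 (by linarith))⟩
  rcases h with h | h
  · obtain ⟨h1, h2⟩ := key _ _ _ _ h
    exact .inl (Prod.ext h1 h2)
  · obtain ⟨h1, h2⟩ := key _ _ _ _ h
    exact .inr (Prod.ext h2 h1)

/-- On planted data the recovery algorithm receives a genuine instance of its problem. The planted
coordinates contribute the same sum to both components, and the weights `z` and `1 - z` add up to 1.
-/
theorem start_eq (hg : (rankTape P d ω).Injective) (b : Signal P.p × Signal P.p)
    (z w : Fin P.n → ℝ) :
    start P X (mslrResponse (1 / P.σ) b X z w) ω d =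
      initState (guess P d) (augment P d ((b, X, z, w), ω)).1.2.1
        (mslrResponse 1 (augment P d ((b, X, z, w), ω)).1.1
          (augment P d ((b, X, z, w), ω)).1.2.1 (augment P d ((b, X, z, w), ω)).1.2.2.1
          (augment P d ((b, X, z, w), ω)).1.2.2.2) := by
  have hσ := P.σ_pos.ne'
  have hX : (fun (q : Fin (guess P d).n) (j : Fin (guess P d).p) =>
      augX P X ω d (train P d q) j) = (augment P d ((b, X, z, w), ω)).1.2.1 := by
    funext q j
    exact augX_eq _ _
  unfold start
  rw [hX]
  congr 1
  funext q
  have key : ∀ β : Signal P.p, (augment P d ((b, X, z, w), ω)).1.2.1 q ⬝ᵥ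
      shuffle (Fin.append β fun _ => 1) (rankTape P d ω) (signTape P d ω) =
      X (train P d q) ⬝ᵥ β + ∑ l ∈ Finset.range d, pre P ω (train P d q) l := by
    intro β
    rw [← hX]
    exact sum_augX_mul hg (train P d q) β
  have h1 : (augment P d ((b, X, z, w), ω)).1.2.1 q ⬝ᵥ
      (augment P d ((b, X, z, w), ω)).1.1.1 = _ := key b.1
  have h2 : (augment P d ((b, X, z, w), ω)).1.2.1 q ⬝ᵥ
      (augment P d ((b, X, z, w), ω)).1.1.2 = _ := key b.2
  have h3 : (augment P d ((b, X, z, w), ω)).1.2.2.1 q = z (train P d q) := rfl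
  have h4 : (augment P d ((b, X, z, w), ω)).1.2.2.2 q = P.σ * w (train P d q) := rfl
  rw [mslrResponse, h1, h2, h3, h4, augY, mslrResponse]
  field_simp
  ring

theorem lintegral_sq_gaussian : ∫⁻ x, ENNReal.ofReal (x ^ 2) ∂gaussianReal 0 1 = 1 := by
  have hm : MemLp (fun x : ℝ => x) 2 (gaussianReal 0 1) := memLp_id_gaussianReal 2
  rw [← ofReal_integral_eq_lintegral_ofReal hm.integrable_sq (.of_forall fun x => sq_nonneg x)]
  have h := variance_fun_id_gaussianReal (μ := 0) (v := 1)
  rw [variance_eq_integral (by fun_prop)] at h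
  simp only [integral_id_gaussianReal, sub_zero] at h
  rw [h]
  simp

/-- Markov's inequality. The training half is rounded up, so the test half has at most as many
samples N, and the mean is at most Nσ². -/
theorem noise_tail (hn : 0 < P.n) (hk : 0 < P.k) :
    noiseLaw P.n 1 {w | (((P.n + 1) / 2 : ℕ) : ℝ) * √P.k * P.σ ≤
      ∑ q : Fin P.n, if (P.n + 1) / 2 ≤ (q : ℕ) then P.σ ^ 2 * w q ^ 2 else 0} ≤
      ENNReal.ofReal (P.σ / √P.k) := by
  have hσ := P.σ_pos
  set N := (P.n + 1) / 2 with hN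
  have hN0 : (0 : ℝ) < (N : ℝ) := by
    have : 0 < N := by omega
    exact_mod_cast this
  have hk0 : 0 < √(P.k : ℝ) := Real.sqrt_pos.2 (by exact_mod_cast hk)
  set c := (N : ℝ) * √P.k * P.σ with hc
  have hc0 : 0 < c := by positivity
  set f : (Fin P.n → ℝ) → ℝ≥0∞ := fun w => ∑ q : Fin P.n,
    if N ≤ (q : ℕ) then ENNReal.ofReal (P.σ ^ 2) * ENNReal.ofReal (w q ^ 2) else 0 with hf
  have hfm : ∀ q : Fin P.n, Measurable fun w : Fin P.n → ℝ =>
      if N ≤ (q : ℕ) then ENNReal.ofReal (P.σ ^ 2) * ENNReal.ofReal (w q ^ 2) else 0 := by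
    intro q
    split_ifs
    · fun_prop
    · exact measurable_const
  have hint : ∫⁻ w, f w ∂noiseLaw P.n 1 ≤ ENNReal.ofReal (N * P.σ ^ 2) := by
    rw [hf, lintegral_finsetSum _ fun q _ => hfm q]
    have : ∀ q : Fin P.n, (∫⁻ w, (if N ≤ (q : ℕ) then ENNReal.ofReal (P.σ ^ 2) *
        ENNReal.ofReal (w q ^ 2) else 0) ∂noiseLaw P.n 1) =
        if N ≤ (q : ℕ) then ENNReal.ofReal (P.σ ^ 2) else 0 := by
      intro q
      split_ifs
      · rw [lintegral_const_mul _ (by fun_prop)]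
        have hmp : MeasurePreserving (fun w : Fin P.n → ℝ => w q) (noiseLaw P.n 1)
          (gaussianReal 0 1) := measurePreserving_eval _ q
        rw [hmp.lintegral_comp (f := fun x => ENNReal.ofReal (x ^ 2)) (by fun_prop),
          lintegral_sq_gaussian, mul_one]
      · simp
    rw [Finset.sum_congr rfl fun q _ => this q, ← Finset.sum_filter, Finset.sum_const,
      nsmul_eq_mul, ENNReal.ofReal_mul hN0.le, ENNReal.ofReal_natCast]
    gcongr
    rw [Finset.card_filter, Fin.sum_univ_eq_sum_range (fun q => if N ≤ q then 1 else 0),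
      ← Finset.card_filter]
    have : (Finset.range P.n).filter (N ≤ ·) ⊆ Finset.Ico N P.n := by
      intro q; simp; omega
    refine (Finset.card_le_card this).trans ?_
    rw [Nat.card_Ico]; omega
  have hsub : {w : Fin P.n → ℝ | c ≤ ∑ q : Fin P.n, if N ≤ (q : ℕ) then P.σ ^ 2 * w q ^ 2 else 0} ⊆
      {w | ENNReal.ofReal c ≤ f w} := by
    intro w hw
    refine (ENNReal.ofReal_le_ofReal hw).trans_eq ?_
    rw [ENNReal.ofReal_sum_of_nonneg fun q _ => by split_ifs <;> positivity]
    refine Finset.sum_congr rfl fun q _ => ?_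
    split_ifs
    · rw [ENNReal.ofReal_mul (by positivity)]
    · simp
  refine (measure_mono hsub).trans ?_
  refine (meas_ge_le_lintegral_div (Finset.measurable_fun_sum _ fun q _ => hfm q).aemeasurable
    (by simpa using hc0) ENNReal.ofReal_ne_top).trans ?_
  refine (ENNReal.div_le_div_right hint _).trans_eq ?_
  rw [← ENNReal.ofReal_div_of_pos hc0]
  congr 1
  rw [hc]
  field_simp

theorem labelLaw_ae (n : ℕ) (φ : unitInterval) : ∀ᵐ z ∂labelLaw n φ, ∀ q, z q = 1 ∨ z q = 0 := by
  refine ae_all_iff.2 fun q => ?_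
  have h : ∀ᵐ x ∂bernoulliMeasure (1 : ℝ) 0 φ, x = 1 ∨ x = 0 := by
    simp [bernoulliMeasure_def, ae_iff]
  exact (measurePreserving_eval (fun _ : Fin n => bernoulliMeasure (1 : ℝ) 0 φ)
    q).quasiMeasurePreserving.ae h

/-- If the guess `d` leads to a problem that `A` solves, the detector recognizes the planted
law. -/
theorem typeIIError_le {A : Prog} (hA : PolyTime A) (hk : P.k ≤ P.p) (hk0 : 0 < P.k)
    (hn : 0 < P.n) (hd : d ≤ P.p) :
    typeIIError (detector A (writeBound A)) P ≤
      recoveryError A (guess P d) (uniformOn (oppositePairs (P.p + d) (P.k + d) P.k)) +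
        ENNReal.ofReal (P.σ / √P.k) := by
  have := symmetricPrior.isProbabilityMeasure hk
  have hmp := measurePreserving_augment hk hd
  set μ := (mslrLaw P.n P.p (symmetricPrior P.p P.k) balanced 1).prod tapeLaw with hμ
  have : IsProbabilityMeasure (mslrLaw P.n P.p (symmetricPrior P.p P.k) balanced 1) := by
    unfold mslrLaw; infer_instance
  set Bad := {x : ((Signal (guess P d).p × Signal (guess P d).p) ×
      Design (guess P d).n (guess P d).p × (Fin (guess P d).n → ℝ) × (Fin (guess P d).n → ℝ)) ×
      (ℕ → ℝ) | ¬ ExactlyRecovers A (guess P d) x.1.1 x.1.2.1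
      (mslrResponse 1 x.1.1 x.1.2.1 x.1.2.2.1 x.1.2.2.2) x.2} with hBad
  set Big := {w : Fin P.n → ℝ | (((P.n + 1) / 2 : ℕ) : ℝ) * √P.k * P.σ ≤
      ∑ q : Fin P.n, if (P.n + 1) / 2 ≤ (q : ℕ) then P.σ ^ 2 * w q ^ 2 else 0} with hBig
  have hrank : ∀ᵐ x ∂μ, (rankTape P d x.2).Injective := by
    have h1 : ∀ᵐ ω ∂tapeLaw, (rankTape P d ω).Injective :=
      (measurePreserving_fst.comp (measurePreserving_fst.comp (measurePreserving_fst.comp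
        (measurePreserving_tape (P := P) (n := 0) hd (Nat.zero_le _))))).quasiMeasurePreserving.ae
        iidGaussian_ae_injective
    exact measurePreserving_snd.quasiMeasurePreserving.ae h1
  have hlab : ∀ᵐ x ∂μ, ∀ q, x.1.2.2.1 q = 1 ∨ x.1.2.2.1 q = 0 := by
    have h1 : MeasurePreserving (fun x : ((Signal P.p × Signal P.p) × Design P.n P.p ×
        (Fin P.n → ℝ) × (Fin P.n → ℝ)) × (ℕ → ℝ) => x.1.2.2.1) μ (labelLaw P.n balanced) :=
      measurePreserving_fst.comp (measurePreserving_snd.comp (measurePreserving_snd.comp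
        measurePreserving_fst))
    exact h1.quasiMeasurePreserving.ae (labelLaw_ae _ _)
  have hnoise : MeasurePreserving (fun x : ((Signal P.p × Signal P.p) × Design P.n P.p ×
      (Fin P.n → ℝ) × (Fin P.n → ℝ)) × (ℕ → ℝ) => x.1.2.2.2) μ (noiseLaw P.n 1) :=
    measurePreserving_snd.comp (measurePreserving_snd.comp (measurePreserving_snd.comp
      measurePreserving_fst))
  have hsub : {x : ((Signal P.p × Signal P.p) × Design P.n P.p ×
      (Fin P.n → ℝ) × (Fin P.n → ℝ)) × (ℕ → ℝ) | ¬ DeclaresPlanted (detector A (writeBound A)) P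
      x.1.2.1 (mslrResponse (1 / P.σ) x.1.1 x.1.2.1 x.1.2.2.1 x.1.2.2.2) x.2} ≤ᵐ[μ]
      (augment P d ⁻¹' Bad ∪ (fun x => x.1.2.2.2) ⁻¹' Big : Set _) := by
    filter_upwards [hrank, hlab] with ⟨⟨b, X, z, w⟩, ω⟩ hg hz hx
    by_contra hcon
    apply hx
    obtain ⟨h1, h2⟩ := not_or.1 hcon
    rw [Set.mem_preimage, hBad, Set.mem_ofPred_eq, not_not] at h1
    obtain ⟨t, mA, hr, he⟩ := h1
    rw [← start_eq hg] at hr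
    refine (declaresPlanted_detector hA hk).2 ⟨d, hd, t, mA, hr, ?_⟩
    have hloss := loss_le (X := X) hg (b := b) (z := z) (w := w) hz
    have h2' : (∑ q : Fin P.n, if (P.n + 1) / 2 ≤ (q : ℕ) then P.σ ^ 2 * w q ^ 2 else 0) <
      (((P.n + 1) / 2 : ℕ) : ℝ) * √P.k * P.σ := not_le.1 h2
    have hout : loss P X (mslrResponse (1 / P.σ) b X z w) ω d (outputPair (guess P d).p mA) =
        loss P X (mslrResponse (1 / P.σ) b X z w) ω d
          (augPair d b (rankTape P d ω) (signTape P d ω)) := by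
      -- Recovery is only up to relabelling, to which the loss is insensitive.
      rcases eq_or_eq_swap_of_pairError he with h | h
      · rw [h]; rfl
      · rw [h]; exact loss_swap _
    unfold Passes
    rw [hout]
    have h3 := pow_lt_pow_left₀ (hloss.trans_lt h2') (loss_nonneg _) two_ne_zero
    rwa [mul_pow, mul_pow, Real.sq_sqrt (Nat.cast_nonneg _)] at h3
  calc typeIIError (detector A (writeBound A)) P
      ≤ μ (augment P d ⁻¹' Bad ∪ (fun x => x.1.2.2.2) ⁻¹' Big : Set _) := measure_mono_ae hsub
    _ ≤ μ (augment P d ⁻¹' Bad) + μ ((fun x => x.1.2.2.2) ⁻¹' Big) := measure_union_le _ _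
    -- `Measure.le_map_apply` holds for arbitrary sets, so the failure event of `A` need not be
    -- shown measurable.
    _ ≤ μ.map (augment P d) Bad + μ.map (fun x => x.1.2.2.2) Big :=
      add_le_add (Measure.le_map_apply hmp.measurable.aemeasurable _)
        (Measure.le_map_apply hnoise.measurable.aemeasurable _)
    _ ≤ _ := by
      rw [hmp.map_eq, hnoise.map_eq]
      exact add_le_add le_rfl (noise_tail hn hk0)

end Detector

end

noncomputable section

/-! ### The null law -/

/-- The Gaussian density is at most 1/√(2π), and the remaining Lebesgue integral is √(πτ)/v by
translation invariance, uniformly in the centre `c`. -/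
theorem lintegral_exp_neg_sq_gaussian {v τ : ℝ} (hv : 0 < v) (hτ : 0 < τ) (c : ℝ) :
    ∫⁻ x, ENNReal.ofReal (Real.exp (-(v * x - c) ^ 2 / τ)) ∂gaussianReal 0 1 ≤
      ENNReal.ofReal (√τ / (v * √2)) := by
  have hpdf : ∀ x, gaussianPDF 0 1 x ≤ ENNReal.ofReal (√(2 * Real.pi))⁻¹ := by
    intro x
    refine ENNReal.ofReal_le_ofReal ?_
    rw [gaussianPDFReal]
    simp only [NNReal.coe_one, mul_one]
    refine mul_le_of_le_one_right (by positivity) (Real.exp_le_one_iff.2 ?_)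
    have := sq_nonneg (x - 0)
    linarith
  have hint : Integrable fun x : ℝ => Real.exp (-(v * x - c) ^ 2 / τ) := by
    have h := (integrable_exp_neg_mul_sq (b := v ^ 2 / τ) (by positivity)).comp_sub_right (c / v)
    refine h.congr (.of_forall fun x => ?_)
    simp only
    congr 1
    field_simp
  have hval : ∫ x : ℝ, Real.exp (-(v * x - c) ^ 2 / τ) = √(Real.pi / (v ^ 2 / τ)) := by
    rw [← integral_gaussian,
      ← integral_sub_right_eq_self (fun x => Real.exp (-(v ^ 2 / τ) * x ^ 2)) (c / v)]
    refine integral_congr_ae (.of_forall fun x => ?_)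
    simp only
    congr 1
    field_simp
  rw [gaussianReal_of_var_ne_zero _ one_ne_zero, lintegral_withDensity_eq_lintegral_mul _
    (measurable_gaussianPDF 0 1) (by fun_prop)]
  calc ∫⁻ x, (gaussianPDF 0 1 * fun x => ENNReal.ofReal (Real.exp (-(v * x - c) ^ 2 / τ))) x
      ≤ ∫⁻ x, ENNReal.ofReal (√(2 * Real.pi))⁻¹ *
          ENNReal.ofReal (Real.exp (-(v * x - c) ^ 2 / τ)) :=
        lintegral_mono fun x => mul_le_mul_left (hpdf x) _
    _ = ENNReal.ofReal (√τ / (v * √2)) := by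
      rw [lintegral_const_mul _ (by fun_prop), ← ofReal_integral_eq_lintegral_ofReal hint
        (.of_forall fun x => (Real.exp_pos _).le), hval, ← ENNReal.ofReal_mul (by positivity)]
      congr 1
      have hpi := Real.pi_pos
      rw [Real.sqrt_div hpi.le, Real.sqrt_div (by positivity), Real.sqrt_sq hv.le,
        Real.sqrt_mul (by norm_num)]
      have := Real.sqrt_pos.2 hpi
      field_simp

/-- Given any two fits to `v u q` that do not depend on `u`, it is unlikely that the smaller squared
errors have a small sum. -/
theorem pi_gaussian_sum_min_sq_lt {ι : Type*} [Fintype ι] {v τ : ℝ} (hv : 0 < v) (hτ : 0 < τ)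
    (c₁ c₂ : ι → ℝ) :
    Measure.pi (fun _ : ι => gaussianReal 0 1) {u | ∑ q, min ((v * u q - c₁ q) ^ 2)
      ((v * u q - c₂ q) ^ 2) < Fintype.card ι * τ} ≤
      ENNReal.ofReal (Real.exp 1 * (√2 * √τ / v)) ^ Fintype.card ι := by
  -- Chernoff bound: on the event, ∑(1 - min/τ) is positive, so the product of the factors e ·
  -- exp(-min/τ) is at least 1. Independence factorises its mean, and the exponential of a minimum
  -- is at most the sum over the two fits.
  set f : ι → ℝ → ℝ≥0∞ := fun q x => ENNReal.ofReal
    (Real.exp 1 * Real.exp (-min ((v * x - c₁ q) ^ 2) ((v * x - c₂ q) ^ 2) / τ)) with hf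
  have hfm : ∀ q, Measurable (f q) := fun q => by fun_prop
  have hfi : ∀ q, ∫⁻ x, f q x ∂gaussianReal 0 1 ≤
      ENNReal.ofReal (Real.exp 1 * (√2 * √τ / v)) := by
    intro q
    calc ∫⁻ x, f q x ∂gaussianReal 0 1
        ≤ ∫⁻ x, ENNReal.ofReal (Real.exp 1) * (ENNReal.ofReal
            (Real.exp (-(v * x - c₁ q) ^ 2 / τ)) + ENNReal.ofReal
            (Real.exp (-(v * x - c₂ q) ^ 2 / τ))) ∂gaussianReal 0 1 := by
          refine lintegral_mono fun x => ?_
          simp only [hf]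
          rw [ENNReal.ofReal_mul (Real.exp_pos 1).le]
          gcongr
          rcases min_choice ((v * x - c₁ q) ^ 2) ((v * x - c₂ q) ^ 2) with h | h <;> rw [h]
          · exact le_self_add
          · exact le_add_self
      _ ≤ ENNReal.ofReal (Real.exp 1) * (ENNReal.ofReal (√τ / (v * √2)) +
            ENNReal.ofReal (√τ / (v * √2))) := by
          rw [lintegral_const_mul _ (by fun_prop), lintegral_add_left (by fun_prop)]
          gcongr <;> exact lintegral_exp_neg_sq_gaussian hv hτ _
      _ = _ := by
          rw [← ENNReal.ofReal_add (by positivity) (by positivity),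
            ← ENNReal.ofReal_mul (Real.exp_pos 1).le]
          congr 2
          have h2 : √2 * √2 = (2 : ℝ) := Real.mul_self_sqrt (by norm_num)
          field_simp
          rw [sq, h2]
          ring
  have hsub : {u : ι → ℝ | ∑ q, min ((v * u q - c₁ q) ^ 2) ((v * u q - c₂ q) ^ 2) <
      Fintype.card ι * τ} ⊆ {u | 1 ≤ ∏ q, f q (u q)} := by
    intro u hu
    rw [Set.mem_ofPred_eq] at hu ⊢
    simp only [hf]
    rw [← ENNReal.ofReal_prod_of_nonneg fun q _ => by positivity, ENNReal.one_le_ofReal]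
    simp only [← Real.exp_add]
    rw [← Real.exp_sum, Real.one_le_exp_iff, Finset.sum_add_distrib, Finset.sum_const,
      Finset.card_univ, nsmul_eq_mul, mul_one, ← Finset.sum_div, Finset.sum_neg_distrib]
    have := (div_lt_iff₀ hτ).2 hu
    rw [neg_div]
    linarith
  refine (measure_mono hsub).trans ?_
  have h1 := mul_meas_ge_le_lintegral₀ (μ := Measure.pi (fun _ : ι => gaussianReal 0 1))
    (f := fun u => ∏ q, f q (u q))
    (Finset.measurable_fun_prod _ fun q _ => (hfm q).comp (measurable_pi_apply q)).aemeasurable 1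
  rw [one_mul] at h1
  refine h1.trans ?_
  have hind : iIndepFun (fun q (u : ι → ℝ) => f q (u q))
      (Measure.pi (fun _ : ι => gaussianReal 0 1)) :=
    iIndepFun_pi (X := f) fun q => (hfm q).aemeasurable
  have h2 := lintegral_prod_eq_prod_lintegral_of_indepFun Finset.univ
    (fun q (u : ι → ℝ) => f q (u q)) hind (fun q => (hfm q).comp (measurable_pi_apply q))
  rw [h2]
  refine (Finset.prod_le_prod' fun q _ => ?_).trans_eq (Finset.prod_const _)
  exact ((measurePreserving_eval (fun _ : ι => gaussianReal 0 1) q).lintegral_comp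
    (hfm q)).trans_le (hfi q)

/-- Moves one part of the middle factor, here the held-out noise, to the end, so that Fubini can
condition on everything else. -/
theorem MeasureTheory.MeasurePreserving.split_right {β γ δ ε ζ : Type*}
    [MeasurableSpace β] [MeasurableSpace γ] [MeasurableSpace δ] [MeasurableSpace ε]
    [MeasurableSpace ζ] {f : γ → δ × ε} {μc : Measure γ} {μd : Measure δ} {μe : Measure ε}
    [SFinite μc] [SFinite μd] [SFinite μe] (hf : MeasurePreserving f μc (μd.prod μe))
    (μb : Measure β) (μz : Measure ζ) [SFinite μb] [SFinite μz] :
    MeasurePreserving (fun x : (β × γ) × ζ => (((x.1.1, (f x.1.2).1), x.2), (f x.1.2).2))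
      ((μb.prod μc).prod μz) (((μb.prod μd).prod μz).prod μe) := by
  have h1 := (measurePreserving_prodAssoc μb μd μe).symm.comp ((MeasurePreserving.id μb).prod hf)
  have h2 := measurePreserving_prodAssoc (μb.prod μd) μe μz
  have h3 := (MeasurePreserving.id (μb.prod μd)).prod (Measure.measurePreserving_swap
    (μ := μe) (ν := μz))
  have h4 := (measurePreserving_prodAssoc (μb.prod μd) μz μe).symm
  exact h4.comp (h3.comp (h2.comp (h1.prod (MeasurePreserving.id μz))))

/-! ### The estimates as measurable functions of the training data, and the type I error -/

namespace Detector

variable {P : Params} {d : ℕ} {α : Type*} [MeasurableSpace α]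
  {X : α → Design P.n P.p} {y : α → Fin P.n → ℝ} {ω : α → ℕ → ℝ}

theorem measurable_pre (hω : Measurable ω) (q l : ℕ) : Measurable fun a => pre P (ω a) q l :=
  (measurable_pi_apply _).comp hω

theorem measurable_tail (hω : Measurable ω) : Measurable fun a => tail P (ω a) :=
  measurable_pi_lambda _ fun _ => (measurable_pi_apply _).comp hω

theorem measurable_rank (hω : Measurable ω) (j : ℕ) : Measurable fun a => rank P (ω a) d j := by
  simp only [rank, Finset.card_filter]
  exact Finset.measurable_fun_sum _ fun l _ => Measurable.ite
    (measurableSet_lt (measurable_pre hω _ _) (measurable_pre hω _ _)) measurable_const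
    measurable_const

theorem measurable_augX (hX : Measurable X) (hω : Measurable ω) (q : Fin P.n) (j : ℕ) :
    Measurable fun a => augX P (X a) (ω a) d q j := by
  refine Measurable.mul (Measurable.ite (measurableSet_lt (measurable_pre hω _ _)
    measurable_const) measurable_const measurable_const)
    (measurable_apply_countable (F := fun a l => entry P (X a) (ω a) q l) (fun l => ?_)
      (measurable_rank hω j))
  by_cases h : l < P.p
  · simp only [entry, h, dif_pos]
    exact (measurable_pi_apply _).comp ((measurable_pi_apply _).comp hX)
  · simp only [entry, h, dif_neg, not_false_eq_true]
    exact measurable_pre hω _ _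

theorem measurable_augY (hy : Measurable y) (hω : Measurable ω) (q : Fin P.n) :
    Measurable fun a => augY P (y a) (ω a) d q :=
  (((measurable_pi_apply q).comp hy).const_mul _).add
    (Finset.measurable_fun_sum _ fun _ _ => measurable_pre hω _ _)

theorem measurable_initState {X : α → Design P.n P.p} {y : α → Fin P.n → ℝ}
    (hX : ∀ q j, Measurable fun a => X a q j) (hy : ∀ q, Measurable fun a => y a q) :
    Measurable fun a => initState P (X a) (y a) := by
  refine .ramState (fun u x => measurable_const) (fun u x j => ?_) measurable_const
  simp only [initState]
  split_ifs
  · exact hX _ _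
  · exact measurable_const
  · exact hy _
  all_goals exact measurable_const

theorem measurable_start (hX : Measurable X) (hy : Measurable y) (hω : Measurable ω) :
    Measurable fun a => start P (X a) (y a) (ω a) d :=
  measurable_initState (fun _ _ => measurable_augX hX hω _ _) fun _ => measurable_augY hy hω _

/-- The part of a residual that does not depend on the response. -/
def offset (P : Params) (X : Design P.n P.p) (ω : ℕ → ℝ) (d : ℕ) (b : Signal (guess P d).p)
    (q : Fin P.n) : ℝ :=
  ∑ j : Fin (guess P d).p, augX P X ω d q j * b j - ∑ l ∈ Finset.range d, pre P ω q l

theorem residual_eq (X : Design P.n P.p) (y : Fin P.n → ℝ) (ω : ℕ → ℝ)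
    (b : Signal (guess P d).p) (q : Fin P.n) :
    residual P X y ω d b q = P.σ * y q - offset P X ω d b q := by
  rw [residual, augY, offset]; ring

theorem measurable_offset (hX : Measurable X) (hω : Measurable ω)
    {b : α → Signal (guess P d).p} (hb : ∀ j, Measurable fun a => b a j) (q : Fin P.n) :
    Measurable fun a => offset P (X a) (ω a) d (b a) q :=
  (Finset.measurable_fun_sum _ fun (j : Fin (guess P d).p) _ => (measurable_augX hX hω q j).mul (hb j)).sub
    (Finset.measurable_fun_sum _ fun _ _ => measurable_pre hω _ _)

/-- The estimates depend on the training responses only; under the null law this makes them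
independent of the held-out responses. -/
theorem start_congr {X : Design P.n P.p} {y y' : Fin P.n → ℝ} {ω : ℕ → ℝ}
    (h : ∀ q : Fin P.n, (q : ℕ) < (P.n + 1) / 2 → y q = y' q) :
    start P X y ω d = start P X y' ω d := by
  unfold start
  congr 1
  funext q
  rw [augY, augY, h _ q.2]

/-- The data that the recovery algorithm depends on. -/
abbrev TrainData (P : Params) (h : ℕ) : Type :=
  (Design P.n P.p × ({q : Fin P.n // (q : ℕ) < h} → ℝ)) × (ℕ → ℝ)

/-- Under the null law, each guess is unlikely to be accepted. -/
theorem measure_accepts_le {A : Prog} (hA : PolyTime A) (hk : P.k ≤ P.p) (hk0 : 0 < P.k)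
    {h : ℕ} (hn : P.n = h + h) (hd : d ≤ P.p) :
    (((designLaw P.n P.p).prod (noiseLaw P.n 1)).prod tapeLaw)
      {x | Accepts A P x.1.1 (√(P.k / P.σ ^ 2 + 1) • x.1.2) x.2 d} ≤
      ENNReal.ofReal (Real.exp 1 * (√2 * √(P.σ / √P.k))) ^ h := by
  obtain ⟨C, η, hA⟩ := hA
  have hσ := P.σ_pos
  have hk0' : 0 < √(P.k : ℝ) := Real.sqrt_pos.2 (by exact_mod_cast hk0)
  set s := √(P.k / P.σ ^ 2 + 1) with hs
  have hs0 : 0 < s := Real.sqrt_pos.2 (by positivity)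
  have hcard : Fintype.card {q : Fin P.n // ¬ (q : ℕ) < h} = h := by
    rw [Fintype.card_subtype_compl, Fintype.card_fin, Fintype.card_subtype, Finset.card_filter,
      Fin.sum_univ_eq_sum_range (fun q => if q < h then 1 else 0), ← Finset.card_filter]
    have : (Finset.range P.n).filter (· < h) = Finset.range h := by ext q; simp; omega
    rw [this, Finset.card_range]; omega
  -- The held-out responses are filled with zeros, which the recovery algorithm does not see.
  let ext : ({q : Fin P.n // (q : ℕ) < h} → ℝ) → Fin P.n → ℝ := fun u q => if hq : (q : ℕ) < h then s * u ⟨q, hq⟩ else 0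
  have hX : Measurable fun x : TrainData P h => x.1.1 := by fun_prop
  have hω : Measurable fun x : TrainData P h => x.2 := by fun_prop
  have hy : Measurable fun x : TrainData P h => ext x.1.2 := by
    refine measurable_pi_lambda _ fun q => ?_
    by_cases hq : (q : ℕ) < h
    · simp only [ext, hq, dif_pos]; fun_prop
    · simp only [ext, hq, dif_neg, not_false_eq_true]; fun_prop
  have hrun : ∀ x : TrainData P h, ∃ m t, Run (tail P x.2) A (start P x.1.1 (ext x.1.2) x.2 d) t m := by
    intro x
    obtain ⟨t, -, m, hm⟩ := exists_run_tail hA hk (X := x.1.1) (y := ext x.1.2) (ω := x.2) d hd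
    exact ⟨m, t, hm⟩
  choose G hG using hrun
  have hGm : Measurable G := measurable_of_run (measurable_tail hω) (measurable_start hX hy hω) hG
  set c₁ : TrainData P h → {q : Fin P.n // ¬ (q : ℕ) < h} → ℝ := fun x q =>
    offset P x.1.1 x.2 d (outputPair (guess P d).p (G x)).1 q with hc₁
  set c₂ : TrainData P h → {q : Fin P.n // ¬ (q : ℕ) < h} → ℝ := fun x q =>
    offset P x.1.1 x.2 d (outputPair (guess P d).p (G x)).2 q with hc₂
  have hc₁m : ∀ q, Measurable fun x => c₁ x q := fun q =>
    measurable_offset hX hω (fun j => (RamState.measurable_real 3 0 j).comp hGm) _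
  have hc₂m : ∀ q, Measurable fun x => c₂ x q := fun q =>
    measurable_offset hX hω (fun j => (RamState.measurable_real 3 1 j).comp hGm) _
  -- The threshold per test sample: acceptance means that the loss is below `h * τ`.
  set τ := √P.k * P.σ with hτ
  have hτ0 : 0 < τ := by positivity
  set S : Set (TrainData P h × ({q : Fin P.n // ¬ (q : ℕ) < h} → ℝ)) := {x | ∑ q, min ((P.σ * s * x.2 q - c₁ x.1 q) ^ 2)
    ((P.σ * s * x.2 q - c₂ x.1 q) ^ 2) < Fintype.card {q : Fin P.n // ¬ (q : ℕ) < h} * τ} with hS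
  have hSm : MeasurableSet S := by
    refine measurableSet_lt (Finset.measurable_fun_sum _ fun q _ => ?_) measurable_const
    have h1 : Measurable fun x : TrainData P h × ({q : Fin P.n // ¬ (q : ℕ) < h} → ℝ) =>
      c₁ x.1 q := (hc₁m q).comp measurable_fst
    have h2 : Measurable fun x : TrainData P h × ({q : Fin P.n // ¬ (q : ℕ) < h} → ℝ) =>
      c₂ x.1 q := (hc₂m q).comp measurable_fst
    fun_prop
  let split : (Design P.n P.p × (Fin P.n → ℝ)) × (ℕ → ℝ) → TrainData P h × ({q : Fin P.n // ¬ (q : ℕ) < h} → ℝ) := fun x =>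
    (((x.1.1, fun q => x.1.2 q), x.2), fun q => x.1.2 q)
  have hsplit : MeasurePreserving split
      (((designLaw P.n P.p).prod (noiseLaw P.n 1)).prod tapeLaw)
      ((((designLaw P.n P.p).prod (Measure.pi fun _ : {q : Fin P.n // (q : ℕ) < h} => gaussianReal 0 1)).prod tapeLaw).prod
        (Measure.pi fun _ : {q : Fin P.n // ¬ (q : ℕ) < h} => gaussianReal 0 1)) := by
    have h1 : MeasurePreserving (fun w : Fin P.n → ℝ =>
        ((fun q : {q : Fin P.n // (q : ℕ) < h} => w q),
          fun q : {q : Fin P.n // ¬ (q : ℕ) < h} => w q)) (noiseLaw P.n 1) _ :=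
      measurePreserving_piEquivPiSubtypeProd (fun _ => gaussianReal 0 1) fun q : Fin P.n => (q : ℕ) < h
    exact h1.split_right _ _
  have hsub : {x : (Design P.n P.p × (Fin P.n → ℝ)) × (ℕ → ℝ) |
      Accepts A P x.1.1 (s • x.1.2) x.2 d} ⊆ split ⁻¹' S := by
    rintro ⟨⟨X, w⟩, ω⟩ ⟨t, m, hr, hp⟩
    have hst : start P X (s • w) ω d = start P X (ext fun q => w q) ω d := by
      refine start_congr fun q hq => ?_
      have hq : (q : ℕ) < h := by omega
      simp [ext, hq]
    simp only at hr hp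
    rw [hst] at hr
    obtain ⟨t', hr'⟩ := hG ((X, fun q => w q), ω) |>.imp fun _ h => h
    have hm : m = G ((X, fun q => w q), ω) := (Run.deterministic hr hr').2
    have hlt := abs_lt_of_sq_lt_sq (a := loss P X (s • w) ω d (outputPair (guess P d).p m))
      (b := (((P.n + 1) / 2 : ℕ) : ℝ) * τ) (by
        rw [hτ, mul_pow, mul_pow, Real.sq_sqrt (Nat.cast_nonneg _)]
        rw [Passes] at hp; linarith) (by positivity)
    replace hlt := (le_abs_self _).trans_lt hlt
    rw [show (P.n + 1) / 2 = h by omega] at hlt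
    rw [Set.mem_preimage, hS, Set.mem_ofPred_eq, hcard]
    refine lt_of_eq_of_lt ?_ hlt
    rw [loss, ← Finset.sum_filter, Finset.sum_subtype (p := fun q : Fin P.n => ¬ (q : ℕ) < h) _
      (fun q => by simp; omega)]
    refine Finset.sum_congr rfl fun q _ => ?_
    simp only [residual_eq, hc₁, hc₂, split, hm, Pi.smul_apply, smul_eq_mul, mul_assoc]
  -- The scale of the held-out responses is σs = √(k + σ²) ≥ √k, while √τ = √(σ/√k) · √k.
  have hbound : Real.exp 1 * (√2 * √τ / (P.σ * s)) ≤ Real.exp 1 * (√2 * √(P.σ / √P.k)) := by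
    have h1 : √(P.k : ℝ) ≤ P.σ * s := by
      rw [hs, ← Real.sqrt_sq hσ.le, ← Real.sqrt_mul (sq_nonneg _)]
      refine Real.sqrt_le_sqrt ?_
      rw [Real.sqrt_sq hσ.le]
      field_simp
      nlinarith
    have h2 : √τ = √(P.σ / √P.k) * √P.k := by
      have h3 : τ = P.σ / √P.k * √P.k ^ 2 := by rw [hτ]; field_simp
      rw [h3, Real.sqrt_mul (by positivity), Real.sqrt_sq hk0'.le]
    rw [h2, mul_div_assoc, mul_div_assoc]
    gcongr
    exact mul_le_of_le_one_right (by positivity) ((div_le_one (by positivity)).2 h1)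
  calc _ ≤ _ := measure_mono hsub
    _ = _ := hsplit.measure_preimage hSm.nullMeasurableSet
    _ ≤ ENNReal.ofReal (Real.exp 1 * (√2 * √τ / (P.σ * s))) ^ h := by
      rw [Measure.prod_apply hSm]
      refine lintegral_le_const (.of_forall fun x => ?_)
      have := pi_gaussian_sum_min_sq_lt (mul_pos hσ hs0) hτ0 (c₁ x) (c₂ x)
      rw [hcard] at this
      simp only [hS, hcard]
      exact this
    _ ≤ _ := by gcongr

theorem typeIError_le {A : Prog} (hA : PolyTime A) (hk : P.k ≤ P.p) (hk0 : 0 < P.k)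
    {h : ℕ} (hn : P.n = h + h) :
    typeIError (detector A (writeBound A)) P ≤
      (P.p + 1) * ENNReal.ofReal (Real.exp 1 * (√2 * √(P.σ / √P.k))) ^ h := by
  have hsub : {x : (Design P.n P.p × (Fin P.n → ℝ)) × (ℕ → ℝ) |
      DeclaresPlanted (detector A (writeBound A)) P x.1.1 (√(P.k / P.σ ^ 2 + 1) • x.1.2) x.2} ⊆
      ⋃ d ∈ Finset.range (P.p + 1),
        {x | Accepts A P x.1.1 (√(P.k / P.σ ^ 2 + 1) • x.1.2) x.2 d} := by
    intro x hx
    obtain ⟨d, hd, h⟩ := (declaresPlanted_detector hA hk).1 hx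
    exact Set.mem_biUnion (Finset.mem_coe.2 (Finset.mem_range.2 (by omega))) h
  refine (measure_mono hsub).trans ((measure_biUnion_finset_le _ _).trans ?_)
  refine (Finset.sum_le_card_nsmul _ _ _ fun d hd =>
    measure_accepts_le hA hk hk0 hn (Nat.lt_succ_iff.1 (Finset.mem_range.1 hd))).trans_eq ?_
  rw [Finset.card_range, nsmul_eq_mul, Nat.cast_succ]

end Detector

end

noncomputable section

/-! ### Comparison of parameters -/

/-- Parameters of the same order, the second ones with at most the dimension and the sparsity of the
first ones. -/
structure Comparable (c : ℝ) (P Q : Params) : Prop where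
  σ_eq : Q.σ = P.σ
  p_le : (Q.p : ℝ) ≤ P.p
  le_p : (P.p : ℝ) ≤ 2 * Q.p
  n_le : (Q.n : ℝ) ≤ 2 * P.n
  le_n : (P.n : ℝ) ≤ Q.n
  k_le : (Q.k : ℝ) ≤ P.k
  le_k : c * P.k ≤ Q.k
  p_large : (4 : ℝ) ≤ P.p
  k_pos : (0 : ℝ) < P.k

namespace Comparable

variable {c : ℝ} {P Q : Params}

theorem p_pos (h : Comparable c P Q) : (1 : ℝ) < Q.p := by linarith [h.le_p, h.p_large]

theorem k_pos' (h : Comparable c P Q) (hc : 0 < c) : (0 : ℝ) < Q.k := (mul_pos hc h.k_pos).trans_le h.le_k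

theorem log_pos (h : Comparable c P Q) : 0 < Real.log Q.p := Real.log_pos h.p_pos

theorem log_le (h : Comparable c P Q) : Real.log Q.p ≤ Real.log P.p :=
  Real.log_le_log (zero_lt_one.trans h.p_pos) h.p_le

theorem snr_le (h : Comparable c P Q) : c * P.snr ≤ Q.snr := by
  rw [Params.snr, Params.snr, h.σ_eq, mul_div_assoc']
  exact div_le_div_of_nonneg_right h.le_k (sq_nonneg _)

theorem add_le (h : Comparable c P Q) (hc1 : c ≤ 1) : c * (P.k + P.σ ^ 2) ≤ Q.k + Q.σ ^ 2 := by
  rw [h.σ_eq, mul_add]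
  exact add_le_add h.le_k (mul_le_of_le_one_left (sq_nonneg _) hc1)

/-- Bernoulli's inequality (1 + x)^c ≤ 1 + cx: if the signal-to-noise ratio loses at most a factor
`c`, so does the logarithm. -/
theorem log_snr_le (h : Comparable c P Q) (hc : 0 < c) (hc1 : c ≤ 1) :
    c * Real.log (1 + P.k / P.σ ^ 2) ≤ Real.log (1 + Q.k / Q.σ ^ 2) := by
  have hx : 0 ≤ P.k / P.σ ^ 2 := by positivity
  rw [← Real.log_rpow (by positivity)]
  refine Real.log_le_log (by positivity) ?_
  refine (rpow_one_add_le_one_add_mul_self (by linarith) hc.le hc1).trans ?_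
  have := h.snr_le
  rw [Params.snr, Params.snr] at this
  linarith

end Comparable

variable {c : ℝ} {P Q : ℕ → Params}

theorem BaseRegime.of_comparable (hP : BaseRegime P) (h : ∀ᶠ i in atTop, Comparable c (P i) (Q i)) :
    BaseRegime Q := by
  obtain ⟨h1, h2, h3⟩ := hP
  refine ⟨?_, ?_, ?_⟩
  · have h4 : Tendsto (fun i => ((P i).p : ℝ) / 2) atTop atTop :=
      (tendsto_natCast_atTop_atTop.comp h1).atTop_div_const two_pos
    refine tendsto_natCast_atTop_iff.1 (tendsto_atTop_mono' _ ?_ h4)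
    filter_upwards [h] with i hi
    linarith [hi.le_p]
  · refine (IsBigO.of_bound 1 ?_ |>.trans_isLittleO h2).trans_isBigO (IsBigO.of_bound √2 ?_)
    · filter_upwards [h] with i hi
      simpa using hi.k_le
    · filter_upwards [h] with i hi
      rw [Real.norm_of_nonneg (Real.sqrt_nonneg _), Real.norm_of_nonneg (Real.sqrt_nonneg _),
        ← Real.sqrt_mul (by norm_num)]
      exact Real.sqrt_le_sqrt hi.le_p
  · refine (IsBigO.of_bound 1 ?_ |>.trans_isLittleO h3).trans_isBigO (IsBigO.of_bound 1 ?_)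
    · filter_upwards [h] with i hi
      rw [one_mul, Real.norm_of_nonneg (le_max_of_le_left (Nat.cast_nonneg _)),
        Real.norm_of_nonneg (le_max_of_le_left (Nat.cast_nonneg _))]
      exact max_le_max hi.k_le hi.log_le
    · filter_upwards [h] with i hi
      simpa using hi.le_n

theorem RegimeC1.of_comparable (hP : RegimeC1 P) (hc : 0 < c) (hc1 : c ≤ 1)
    (h : ∀ᶠ i in atTop, Comparable c (P i) (Q i)) : RegimeC1 Q := by
  refine ⟨hP.1.of_comparable h, ?_⟩
  refine (IsBigO.of_bound 2 ?_ |>.trans_isLittleO hP.2).trans_isBigO (IsBigO.of_bound (1 / c ^ 2) ?_)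
  · filter_upwards [h] with i hi
    simpa using hi.n_le
  · filter_upwards [h] with i hi
    have h1 := hi.log_pos
    have h2 := h1.trans_le hi.log_le
    have h3 := hi.add_le hc1
    have h4 : 0 < (P i).k + (P i).σ ^ 2 := add_pos hi.k_pos (pow_pos (P i).σ_pos 2)
    rw [Real.norm_of_nonneg (by positivity), Real.norm_of_nonneg (by positivity), ← mul_assoc]
    refine mul_le_mul ?_ (one_div_le_one_div_of_le h1 hi.log_le) (by positivity) (by positivity)
    rw [div_mul_eq_mul_div, one_mul, le_div_iff₀ (by positivity), mul_comm, ← mul_pow]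
    exact pow_le_pow_left₀ (by positivity) h3 2

theorem RegimeC2.of_comparable (hP : RegimeC2 P) (hc : 0 < c) (hc1 : c ≤ 1)
    (h : ∀ᶠ i in atTop, Comparable c (P i) (Q i)) : RegimeC2 Q := by
  refine ⟨hP.1.of_comparable h, ?_⟩
  refine (IsBigO.of_bound (1 / c) ?_ |>.trans hP.2).trans (IsBigO.of_bound 1 ?_)
  · filter_upwards [h] with i hi
    have h1 := hi.log_pos
    have h2 := h1.trans_le hi.log_le
    have h3 := hi.log_snr_le hc hc1
    have h4 : 0 < Real.log (1 + (P i).k / (P i).σ ^ 2) :=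
      Real.log_pos (lt_add_of_pos_right _ (div_pos hi.k_pos (pow_pos (P i).σ_pos 2)))
    have h5 := (mul_pos hc h4).trans_le h3
    rw [Real.norm_of_nonneg (by positivity), Real.norm_of_nonneg (by positivity), one_div_mul_eq_div,
      div_div, mul_comm _ c]
    exact div_le_div₀ (by positivity) (mul_le_mul hi.k_le hi.log_le h1.le (Nat.cast_nonneg _))
      (by positivity) h3
  · filter_upwards [h] with i hi
    simpa using hi.le_n

/-- Identifies the sample size bound of the hard regime with that of C₁. -/
theorem Params.sq_mul_snr_add_one {P : Params} (hk : (0 : ℝ) < P.k) :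
    (P.k : ℝ) ^ 2 * (P.snr + 1) ^ 2 / P.snr ^ 2 = (P.k + P.σ ^ 2) ^ 2 := by
  have := P.σ_pos
  rw [Params.snr]
  field_simp

theorem RegimeC1.hardRegime (hQ : RegimeC1 Q) (hk : ∀ᶠ i in atTop, (0 : ℝ) < (Q i).k) :
    HardRegime Q := by
  refine ⟨hQ.1, hQ.2.congr' EventuallyEq.rfl ?_⟩
  filter_upwards [hk] with i hi
  rw [Params.sq_mul_snr_add_one hi]

theorem tendsto_div_atTop_of_isLittleO {f g : ℕ → ℝ} (h : f =o[atTop] g)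
    (hf : ∀ᶠ i in atTop, 0 < f i) (hg : ∀ᶠ i in atTop, 0 < g i) :
    Tendsto (fun i => g i / f i) atTop atTop := by
  have h1 : Tendsto (fun i => f i / g i) atTop (𝓝[>] 0) :=
    tendsto_nhdsWithin_iff.2 ⟨h.tendsto_div_nhds_zero, by
      filter_upwards [hf, hg] with i hi hi' using div_pos hi hi'⟩
  exact h1.inv_tendsto_nhdsGT_zero.congr fun i => inv_div _ _

/-- Both terms of the minimum dominate log p: the second by the base regime, and the first, which
equals (k + σ²)²/n, by C₁. -/
theorem RegimeC1.tendsto_hardnessExponent (hQ : RegimeC1 Q)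
    (hk : ∀ᶠ i in atTop, (0 : ℝ) < (Q i).k) :
    Tendsto (fun i => (Q i).hardnessExponent / Real.log (Q i).p) atTop atTop := by
  have hlog : ∀ᶠ i in atTop, 0 < Real.log (Q i).p := by
    filter_upwards [hQ.1.1.eventually_gt_atTop 1] with i hi
    exact Real.log_pos (by exact_mod_cast hi)
  have hn : (fun i => Real.log (Q i).p) =o[atTop] fun i => ((Q i).n : ℝ) := by
    refine IsBigO.trans_isLittleO (IsBigO.of_bound 1 ?_) hQ.1.2.2
    filter_upwards [hlog] with i hi
    rw [one_mul, Real.norm_of_nonneg hi.le, Real.norm_of_nonneg (le_max_of_le_right hi.le)]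
    exact le_max_right _ _
  have hn0 : ∀ᶠ i in atTop, (0 : ℝ) < (Q i).n := by
    filter_upwards [hn.bound one_pos, hlog] with i hi hi'
    rw [one_mul, Real.norm_of_nonneg hi'.le, Real.norm_of_nonneg (Nat.cast_nonneg _)] at hi
    exact hi'.trans_le hi
  have h1 := tendsto_div_atTop_of_isLittleO hn hlog hn0
  have h2 := tendsto_div_atTop_of_isLittleO hQ.2 hn0 (by
    filter_upwards [hlog, hk] with i hi hi'
    have := (Q i).σ_pos
    positivity)
  refine tendsto_atTop.2 fun M => ?_
  filter_upwards [tendsto_atTop.1 h1 M, tendsto_atTop.1 h2 M, hlog, hn0, hk] with i hi hi' hl hn hk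
  rw [Params.hardnessExponent, le_div_iff₀ hl, le_min_iff]
  refine ⟨?_, (le_div_iff₀ hl).1 hi⟩
  have h3 := Params.sq_mul_snr_add_one hk
  rw [mul_comm ((Q i).n : ℝ), ← div_div, h3, ← le_div_iff₀ hl]
  refine hi'.trans_eq ?_
  field_simp

theorem tendsto_σ_div_sqrt (hsnr : Tendsto (fun i => (Q i).snr) atTop atTop) :
    Tendsto (fun i => (Q i).σ / √(Q i).k) atTop (𝓝 0) := by
  have h : ∀ i, (Q i).σ / √(Q i).k = (√(Q i).snr)⁻¹ := by
    intro i
    rw [Params.snr, Real.sqrt_div (Nat.cast_nonneg _), Real.sqrt_sq (Q i).σ_pos.le, inv_div]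
  simp only [h]
  exact (Real.tendsto_sqrt_atTop.comp hsnr).inv_tendsto_atTop

/-! ### The reduction -/

namespace Detector

/-- The detection problem that is embedded into recovery along `P` with `a` opposite common support
points. -/
def reduced (P : Params) (a : ℕ) : Params := ⟨P.p - P.k + a, P.n + P.n, a, P.σ, P.σ_pos⟩

/-- The reason for the form of `reduced`: planting `k - a` coordinates restores dimension and
sparsity, and halving the sample leaves `n` training samples. -/
theorem guess_reduced {P : Params} {a : ℕ} (ha : a ≤ P.k) (hk : P.k ≤ P.p) :
    guess (reduced P a) (P.k - a) = P := by
  obtain ⟨p, n, k, σ, hσ⟩ := P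
  simp only [guess, reduced, Params.mk.injEq, and_true] at *
  omega

theorem recoveryError_guess_reduced (A : Prog) {P : Params} {a : ℕ} (ha : a ≤ P.k)
    (hk : P.k ≤ P.p) (hk0 : 0 < P.k) :
    recoveryError A (guess (reduced P a) (P.k - a))
      (uniformOn (oppositePairs ((reduced P a).p + (P.k - a)) ((reduced P a).k + (P.k - a)) a)) =
    recoveryError A P (overlapPrior P.p P.k 1 (1 - 2 * (a : ℝ) / P.k)) := by
  rw [overlapPrior_eq hk0]
  -- The types of the priors depend on the parameters, so the equality is substituted for a variable
  -- `P'` instead of being rewritten.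
  have key : ∀ P' : Params, P' = P → recoveryError A P' (uniformOn (oppositePairs P'.p P'.k a)) =
      recoveryError A P (uniformOn (oppositePairs P.p P.k a)) := by
    rintro _ rfl; rfl
  exact key _ (guess_reduced ha hk)

theorem isPartiallySymmetricPrior_overlapPrior {p k a : ℕ} (ha : a ≤ k) (hk : k ≤ p) (hk0 : 0 < k) :
    IsPartiallySymmetricPrior p k a (overlapPrior p k 1 (1 - 2 * (a : ℝ) / k)) := by
  rw [overlapPrior_eq hk0]
  have h := isPartiallySymmetricPrior_uniformOn (p := p - k + a) (d := k - a) (k := a) (by omega)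
  rwa [show p - k + a + (k - a) = p by omega, show a + (k - a) = k by omega] at h

theorem comparable_reduced {P : Params} {a : ℕ} {c : ℝ} (ha : c * P.k ≤ a) (hak : a ≤ P.k)
    (hk : 2 * P.k ≤ P.p) (hk0 : 0 < P.k) (hp : 4 ≤ P.p) : Comparable c P (reduced P a) where
  σ_eq := rfl
  p_le := by
    have : P.p - P.k + a ≤ P.p := by omega
    exact_mod_cast this
  le_p := by
    have : P.p ≤ 2 * (P.p - P.k + a) := by omega
    exact_mod_cast this
  n_le := by simp only [reduced]; push_cast; linarith
  le_n := by simp [reduced]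
  k_le := by exact_mod_cast hak
  le_k := ha
  p_large := by exact_mod_cast hp
  k_pos := by exact_mod_cast hk0

theorem tendsto_typeIError {A : Prog} (hA : PolyTime A) (hQ : BaseRegime Q)
    (hsnr : Tendsto (fun i => (Q i).snr) atTop atTop) (hk : ∀ᶠ i in atTop, 0 < (Q i).k)
    (hkp : ∀ᶠ i in atTop, (Q i).k ≤ (Q i).p) {h : ℕ → ℕ} (hn : ∀ i, (Q i).n = h i + h i) :
    Tendsto (fun i => typeIError (detector A (writeBound A)) (Q i)) atTop (𝓝 0) := by
  have hρ : Tendsto (fun i => Real.exp 1 * (√2 * √((Q i).σ / √(Q i).k))) atTop (𝓝 0) := by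
    have h1 := (((Real.continuous_sqrt.tendsto 0).comp (tendsto_σ_div_sqrt hsnr)).const_mul
      √2).const_mul (Real.exp 1)
    simpa using h1
  have hlim : Tendsto (fun i => ENNReal.ofReal (2 / (Q i).p)) atTop (𝓝 0) := by
    have h1 : Tendsto (fun i => (2 : ℝ) / (Q i).p) atTop (𝓝 0) :=
      (tendsto_natCast_atTop_atTop.comp hQ.1).const_div_atTop 2
    simpa using ENNReal.tendsto_ofReal h1
  refine tendsto_of_tendsto_of_tendsto_of_le_of_le' tendsto_const_nhds hlim
    (.of_forall fun _ => zero_le) ?_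
  -- Eventually each test sample contributes a factor at most e⁻², and the constant 1/2 turns n = 2h
  -- into h ≥ log p. A single guess is thus accepted with probability at most p⁻², which beats the p
  -- + 1 guesses.
  filter_upwards [hρ.eventually_le_const (Real.exp_pos (-2)), hk, hkp, hQ.1.eventually_ge_atTop 1,
    hQ.2.2.bound (by norm_num : (0 : ℝ) < 1 / 2)] with i h1 hk hkp hp hb
  refine (typeIError_le hA hkp hk (hn i)).trans ?_
  have hp1 : (1 : ℝ) ≤ (Q i).p := by exact_mod_cast hp
  have hlog : Real.log (Q i).p ≤ h i := by
    rw [Real.norm_of_nonneg (le_max_of_le_left (Nat.cast_nonneg _)),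
      Real.norm_of_nonneg (Nat.cast_nonneg _), hn i] at hb
    have := (le_max_right _ _).trans hb
    push_cast at this
    linarith
  have h2 : Real.exp (-2) ^ h i ≤ ((Q i).p ^ 2 : ℝ)⁻¹ := by
    rw [← Real.exp_nat_mul, ← Real.exp_log (by positivity : (0 : ℝ) < ((Q i).p : ℝ) ^ 2),
      ← Real.exp_neg, Real.log_pow]
    refine Real.exp_le_exp.2 ?_
    push_cast
    linarith
  calc ((Q i).p + 1 : ℝ≥0∞) * ENNReal.ofReal _ ^ h i
      ≤ ENNReal.ofReal ((Q i).p + 1) * ENNReal.ofReal (((Q i).p ^ 2 : ℝ)⁻¹) := by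
        rw [← ENNReal.ofReal_pow (by positivity), ENNReal.ofReal_add (by positivity) zero_le_one,
          ENNReal.ofReal_natCast, ENNReal.ofReal_one]
        gcongr
        exact (pow_le_pow_left₀ (by positivity) h1 _).trans h2
    _ ≤ ENNReal.ofReal (2 / (Q i).p) := by
        rw [← ENNReal.ofReal_mul (by positivity)]
        refine ENNReal.ofReal_le_ofReal ?_
        rw [← div_eq_mul_inv, div_le_div_iff₀ (by positivity) (by positivity)]
        nlinarith

end Detector


theorem detectionHardnessFails_of_solvesRecovery {a : ℕ → ℕ} {A : Prog} (hC1 : RegimeC1 P)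
    (hC2 : RegimeC2 P) (hsnr : Tendsto (fun i => (P i).snr) atTop atTop) (hc : 0 < c) (hc1 : c ≤ 1)
    (ha : ∀ᶠ i in atTop, c * (P i).k ≤ (a i : ℝ) ∧ a i ≤ (P i).k)
    (hP : ∀ᶠ i in atTop, 0 < (P i).k ∧ 2 * (P i).k ≤ (P i).p) (hA : PolyTime A)
    (hrec : SolvesRecovery A P
      fun i => overlapPrior (P i).p (P i).k 1 (1 - 2 * (a i : ℝ) / (P i).k)) :
    DetectionHardnessFails P := by
  set Q := fun i => Detector.reduced (P i) (a i) with hQdef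
  have h : ∀ᶠ i in atTop, Comparable c (P i) (Q i) := by
    filter_upwards [ha, hP, hC1.1.1.eventually_ge_atTop 4] with i ha hP hp
    exact Detector.comparable_reduced ha.1 ha.2 hP.2 hP.1 hp
  have hQ1 := hC1.of_comparable hc hc1 h
  have hk : ∀ᶠ i in atTop, (0 : ℝ) < (Q i).k := h.mono fun i hi => hi.k_pos' hc
  have hsnrQ : Tendsto (fun i => (Q i).snr) atTop atTop :=
    tendsto_atTop_mono' _ (h.mono fun i hi => hi.snr_le) (hsnr.const_mul_atTop hc)
  refine ⟨Q, fun i => rfl, ⟨IsBigO.of_bound 1 ?_, IsBigO.of_bound 2 ?_⟩,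
    ⟨IsBigO.of_bound 2 ?_, IsBigO.of_bound 1 ?_⟩, ⟨IsBigO.of_bound 1 ?_, IsBigO.of_bound (1 / c) ?_⟩,
    hsnrQ, hQ1, hC2.of_comparable hc hc1 h, hQ1.hardRegime hk, hQ1.tendsto_hardnessExponent hk,
    Detector.detector A (Detector.writeBound A), Detector.polyTime_detector hA, ?_⟩
  · filter_upwards [h] with i hi
    simpa using hi.p_le
  · filter_upwards [h] with i hi
    simpa using hi.le_p
  · filter_upwards [h] with i hi
    simpa using hi.n_le
  · filter_upwards [h] with i hi
    simpa using hi.le_n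
  · filter_upwards [h] with i hi
    simpa using hi.k_le
  · filter_upwards [h] with i hi
    rw [Real.norm_of_nonneg (Nat.cast_nonneg _), Real.norm_of_nonneg (Nat.cast_nonneg _),
      one_div_mul_eq_div, le_div_iff₀ hc, mul_comm]
    exact hi.le_k
  have hkp : ∀ᶠ i in atTop, (Q i).k ≤ (Q i).p := .of_forall fun i => Nat.le_add_left _ _
  have hI := Detector.tendsto_typeIError hA hQ1.1 hsnrQ (hk.mono fun i hi => by exact_mod_cast hi)
    hkp (h := fun i => (P i).n) fun i => rfl
  have hσ : Tendsto (fun i => ENNReal.ofReal ((Q i).σ / √(Q i).k)) atTop (𝓝 0) := by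
    simpa using ENNReal.tendsto_ofReal (tendsto_σ_div_sqrt hsnrQ)
  have hII : Tendsto (fun i => typeIIError (Detector.detector A (Detector.writeBound A)) (Q i))
      atTop (𝓝 0) := by
    refine tendsto_of_tendsto_of_tendsto_of_le_of_le' tendsto_const_nhds
      (by simpa using Tendsto.add hrec hσ) (.of_forall fun _ => zero_le) ?_
    filter_upwards [ha, hP, hk, hkp, hQ1.1.2.2.bound one_pos] with i ha hP hk hkp hb
    have hk' : 0 < (Q i).k := by exact_mod_cast hk
    have hn : 0 < (Q i).n := by
      rw [one_mul, Real.norm_of_nonneg (le_max_of_le_left (Nat.cast_nonneg _)),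
        Real.norm_of_nonneg (Nat.cast_nonneg _)] at hb
      exact_mod_cast hk.trans_le ((le_max_left _ _).trans hb)
    -- The right guess is among those tried; this uses 2k ≤ p.
    have hd : (P i).k - a i ≤ (Q i).p := by
      have : (Q i).p = (P i).p - (P i).k + a i := rfl
      omega
    have := Detector.typeIIError_le hA hkp hk' hn hd
    have heq := Detector.recoveryError_guess_reduced A ha.2 (by omega) hP.1
    exact this.trans_eq (congrArg (· + _) heq)
  unfold StronglyDetects
  simpa using hI.add hII

/-- A positive signal-to-noise ratio excludes k = 0, and k ≤ √p/2 ≤ p/2 eventually. The second bound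
makes `k - a` an admissible guess and keeps p* = p - k + a at least p/2. -/
theorem eventually_pos_and_two_mul_le (hP : BaseRegime P)
    (hsnr : Tendsto (fun i => (P i).snr) atTop atTop) :
    ∀ᶠ i in atTop, 0 < (P i).k ∧ 2 * (P i).k ≤ (P i).p := by
  filter_upwards [hP.2.1.bound (by norm_num : (0 : ℝ) < 1 / 2), hsnr.eventually_gt_atTop 0,
    hP.1.eventually_ge_atTop 1] with i h1 h2 hp
  refine ⟨Nat.pos_of_ne_zero fun h => ?_, ?_⟩
  · simp [Params.snr, h] at h2
  · rw [Real.norm_of_nonneg (Nat.cast_nonneg _), Real.norm_of_nonneg (Real.sqrt_nonneg _)] at h1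
    have hp1 : (1 : ℝ) ≤ (P i).p := by exact_mod_cast hp
    have h3 : √((P i).p : ℝ) ≤ (P i).p := by
      rw [Real.sqrt_le_left (by positivity)]
      nlinarith
    have : (2 * (P i).k : ℝ) ≤ (P i).p := by linarith
    exact_mod_cast this

end

theorem mainTheorem8
    (P : ℕ → Params) (hC1 : RegimeC1 P) (hC2 : RegimeC2 P)
    (hsnr : Tendsto (fun i => (P i).snr) atTop atTop)
    (a : ℕ → ℕ) (c : ℝ) (hc : 0 < c)
    (ha : ∀ᶠ i in atTop, c * (P i).k ≤ (a i : ℝ) ∧ a i ≤ (P i).k)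
    (A : Prog) (hA : PolyTime A) :
    (SolvesPSBMSLR A P a → DetectionHardnessFails P) ∧
    (SolvesRecovery A P
        (fun i => overlapPrior (P i).p (P i).k 1 (1 - 2 * (a i : ℝ) / (P i).k)) →
      DetectionHardnessFails P) := by
  have hP := eventually_pos_and_two_mul_le hC1.1 hsnr
  -- The comparison of parameters needs a constant at most 1.
  have ha' : ∀ᶠ i in atTop, min c 1 * (P i).k ≤ (a i : ℝ) ∧ a i ≤ (P i).k := by
    filter_upwards [ha] with i hi
    exact ⟨(mul_le_mul_of_nonneg_right (min_le_left _ _) (Nat.cast_nonneg _)).trans hi.1, hi.2⟩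
  have key := detectionHardnessFails_of_solvesRecovery (A := A) hC1 hC2 hsnr (lt_min hc one_pos)
    (min_le_right _ _) ha' hP hA
  -- The overlap prior is itself partially symmetric with `a` opposite points, so solving the
  -- problem for all such priors includes this one.
  refine ⟨fun h => key (h _ ?_), key⟩
  filter_upwards [ha, hP] with i ha hP
  exact Detector.isPartiallySymmetricPrior_overlapPrior ha.2 (by omega) hP.1
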